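/- **Setting.** A simple graph $G$ with source $s$ and sink $t$ is an oriented series-parallel graph if (1) it is a single edge $s - t$, or (2) it is a serial superedge, i.e. a chain of $k\ge 2$ oriented series-parallel graphs $G_1,\dots,G_k$ (the principal subgraphs) in which $s$ is the source of $G_1$, $t$ is the sink of $G_k$, the sink of $G_i$ is the source of $G_{i+1}$, and the $G_i$ are otherwise disjoint, or (3) it is a parallel superedge, i.e. a union of $k\ge 2$ oriented series-parallel graphs $G_1,\dots,G_k$ with the same source $s$ and sink $t$, pairwise sharing no other vertex and no edge. It is given by a decomposition tree in which the types alternate: no principal subgraph of a serial (parallel) superedge is itself given as a serial (parallel) superedge. Let $\mathrm{Aut}_{\mathrm{or}}(G)$ be the group of automorphisms of $G$ that fix $s$ and $t$, let $\mathsf{ST}(G)$ be the set of spanning trees of $G$, and let $\mathsf{NT}(G)$ be the set of near trees of $G$: the graphs obtained from a spanning tree of $G$ by deleting one edge so that $s$ and $t$ lie in different components. $\mathsf{ST}(G)/\mathrm{Aut}_{\mathrm{or}}(G)$ and $\mathsf{NT}(G)/\mathrm{Aut}_{\mathrm{or}}(G)$ are the sets of orbits. **Algorithms.** Forests are output explicitly,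 as lists of edges. *Both spanning and near trees.* For a single edge, output the edge as the only spanning tree and the edgeless graph as the only near tree. For a serial superedge, call the algorithm on every $G_i$; output as spanning trees all unions of one listed spanning tree of each $G_i$, and as near trees, for each $i$, all unions of one listed near tree of $G_i$ with one listed spanning tree of each other $G_j$. For a parallel superedge, partition the $G_i$ into classes $E_1,\dots,E_\ell$ under isomorphisms that fix $s$ and $t$, by comparing each $G_i$ with the representatives found so far (the test compares the two decomposition trees recursively, matching children in order at serial nodes and greedily in any order at parallel nodes, and returns an isomorphism); call the algorithm on the representatives $R_1,\dots,R_\ell$ only; output as near trees all unions obtained by assigning, for each $j$, a multiset of $|E_j|$ listed near trees of $R_j$ to the members of $E_j$ (moved by the isomorphisms found), and as spanning trees, for each $i$, all unions obtained by assigning a listed spanning tree of $R_i$ to $R_i$, a multiset of $|E_i|-1$ listed near trees of $R_i$ to the other members of $E_i$, and a multiset of $|E_j|$ listed near trees of $R_j$ to the members of $E_j$ for each $j\ne i$. *Spanning trees only.* For a single edge, output the edge. For a serial superedge, call this algorithm on every $G_i$ and output all unions. For a parallel superedge, partition the $G_i$ into classes, call the first algorithm on the representatives, and form the spanning trees as above.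 Let $B(G)$ and $T(G)$ be the numbers of elementary steps of the first and of the second algorithm, where an elementary step visits or creates one list cell, reads or writes one array entry, or compares two labels; the trees of a union are copied explicitly, once the choice of all its parts is made. **Theorem.** There are absolute constants $c, C>0$ such that for every oriented series-parallel graph $(G,s,t)$ with $n$ vertices, given by any alternating decomposition tree: 1. The first algorithm outputs exactly one spanning tree from each orbit of $\mathsf{ST}(G)/\mathrm{Aut}_{\mathrm{or}}(G)$ and exactly one near tree from each orbit of $\mathsf{NT}(G)/\mathrm{Aut}_{\mathrm{or}}(G)$, and $$c\,n\left(\left|\frac{\mathsf{ST}(G)}{\mathrm{Aut}_{\mathrm{or}}(G)}\right|+\left|\frac{\mathsf{NT}(G)}{\mathrm{Aut}_{\mathrm{or}}(G)}\right|\right)\le B(G)\le C\,n\left(\left|\frac{\mathsf{ST}(G)}{\mathrm{Aut}_{\mathrm{or}}(G)}\right|+\left|\frac{\mathsf{NT}(G)}{\mathrm{Aut}_{\mathrm{or}}(G)}\right|\right).$$ 2. The second algorithm outputs exactly one spanning tree from each orbit of $\mathsf{ST}(G)/\mathrm{Aut}_{\mathrm{or}}(G)$, and $$c\,n\left|\frac{\mathsf{ST}(G)}{\mathrm{Aut}_{\mathrm{or}}(G)}\right|\le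 T(G)\le C\,n\left|\frac{\mathsf{ST}(G)}{\mathrm{Aut}_{\mathrm{or}}(G)}\right|.$$ -/

import Mathlib

/-! ### Running times: a value together with the number of elementary steps spent on it -/

/-- The outcome of a computation: the computed value and the number of elementary steps. An
elementary step is one operation of a random access machine whose words hold labels, numbers and
pointers (visiting or creating a list cell, reading or writing an array entry, comparing labels). -/
structure Timed.{u} (α : Type u) where
  val : α
  steps : ℕ

namespace Timed

universe u v

/-- Running two computations one after the other adds up their steps. -/
instance : Monad Timed.{u} where
  pure a := ⟨a, 0⟩
  bind x f := ⟨(f x.val).val, x.steps + (f x.val).steps⟩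

/-- Spend `n` steps. -/
def tick (n : ℕ) : Timed PUnit.{u + 1} := ⟨PUnit.unit, n⟩

/-- Run `f` on the entries of a list, one after the other, and list the results. -/
def mapList {α : Type v} {β : Type u} (f : α → Timed β) : List α → Timed (List β)
  | [] => do
    tick 1
    pure []
  | a :: l => do
    tick 1
    let b ← f a
    let bs ← mapList f l
    pure (b :: bs)

/-- Run `f 0, …, f (k - 1)` one after the other and store the results in an array. -/
def table {β : Type u} (k : ℕ) (f : Fin k → Timed β) : Timed (Fin k → β) :=
  ⟨fun i => (f i).val, ∑ i, ((f i).steps + 1)⟩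

/-- Concatenate two lists, by copying the first one in front of the second. -/
def append {α : Type u} (l₁ l₂ : List α) : Timed (List α) := ⟨l₁ ++ l₂, l₁.length + 1⟩

/-- Concatenate a list of lists, by copying all of them into one new list. -/
def flatten {α : Type u} : List (List α) → Timed (List α)
  | [] => do
    tick 1
    pure []
  | l :: ls => do
    let r ← flatten ls
    append l r

/-- One step of `multisets`: given an algorithm `f` that lists the multisets of some size `m`
with entries in a list, list the multisets of size `m + 1`. -/
def multisetsStep {α : Type u} (f : List α → Timed (List (List α))) :
    List α → Timed (List (List α))
  | [] => do
    tick 1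
    pure []
  | a :: l => do
    let xs ← f (a :: l)
    let withA ← mapList (fun x => do
      tick 1
      pure (a :: x)) xs
    let withoutA ← multisetsStep f l
    append withA withoutA

/-- List all multisets of size `m` whose entries are (positions in) the given list; a multiset is
output as a list whose entries occur in the order of the given list. -/
def multisets {α : Type u} : ℕ → List α → Timed (List (List α))
  | 0 => fun _ => do
    tick 1
    pure [[]]
  | m + 1 => multisetsStep (multisets m)

end Timed

/-! ### Series-parallel graphs and their decomposition trees -/

/-- Decomposition trees with vertex labels in `V`: an edge node `u --- v` with source `u` and sink
`v`, an S-node with an ordered family of children, or a P-node with a family of children. -/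
inductive SPTree.{u} (V : Type u) : Type u
  | edge (u v : V) : SPTree V
  | series (k : ℕ) (c : Fin k → SPTree V) : SPTree V
  | parallel (k : ℕ) (c : Fin k → SPTree V) : SPTree V

namespace SPTree

universe u

variable {V : Type u}

/-- The vertices of the graph of a decomposition tree. -/
def verts : SPTree V → Set V
  | edge u v => {u, v}
  | series _ c => ⋃ i, (c i).verts
  | parallel _ c => ⋃ i, (c i).verts

/-- The edges of the graph of a decomposition tree. -/
def edges : SPTree V → Set (Sym2 V)
  | edge u v => {s(u, v)}
  | series _ c => ⋃ i, (c i).edges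
  | parallel _ c => ⋃ i, (c i).edges

/-- `D.IsSP s t`: the tree `D` builds a simple series-parallel graph with source `s` and sink `t`.
* An edge node is a single edge `s --- t`.
* An S-node links `k ≥ 2` series-parallel graphs in a chain, along junctions
  `s = p 0, p 1, …, p k = t`; the `i`-th graph has terminals `p i` and `p (i + 1)`, and two of
  the graphs share no vertex, except for the junction between two consecutive ones.
* A P-node links `k ≥ 2` series-parallel graphs that have the same terminals `s` and `t`, and any
  two of which share no other vertex and no edge. -/
def IsSP : SPTree V → V → V → Prop
  | edge u v, s, t => u = s ∧ v = t ∧ s ≠ t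
  | series k c, s, t => 2 ≤ k ∧ ∃ p : Fin (k + 1) → V, p 0 = s ∧ p (Fin.last k) = t ∧
      (∀ i : Fin k, (c i).IsSP (p i.castSucc) (p i.succ)) ∧
      ∀ i j : Fin k, i < j → ∀ v ∈ (c i).verts, v ∈ (c j).verts →
        (j : ℕ) = (i : ℕ) + 1 ∧ v = p i.succ
  | parallel k c, s, t => 2 ≤ k ∧ (∀ i : Fin k, (c i).IsSP s t) ∧
      ∀ i j : Fin k, i ≠ j → (∀ v ∈ (c i).verts, v ∈ (c j).verts → v = s ∨ v = t) ∧
        Disjoint (c i).edges (c j).edges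

/-- The root is an S-node. -/
def IsSeries : SPTree V → Prop
  | series _ _ => True
  | _ => False

/-- The root is a P-node. -/
def IsParallel : SPTree V → Prop
  | parallel _ _ => True
  | _ => False

/-- No child of an S-node is an S-node, and no child of a P-node is a P-node. -/
def Alternating : SPTree V → Prop
  | edge _ _ => True
  | series _ c => ∀ i, ¬ (c i).IsSeries ∧ (c i).Alternating
  | parallel _ c => ∀ i, ¬ (c i).IsParallel ∧ (c i).Alternating

/-- `D` is a decomposition tree of the oriented series-parallel graph `(G, s, t)`, with alternating
node types. -/
structure IsDecompositionOf (D : SPTree V) (G : SimpleGraph V) (s t : V) : Prop where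
  isSP : D.IsSP s t
  alternating : D.Alternating
  verts_eq : D.verts = Set.univ
  edges_eq : D.edges = G.edgeSet

end SPTree

/-! ### Spanning trees, near trees and oriented automorphisms -/

section Orbits

universe u

variable {V : Type u}

/-- The spanning trees of `G` (a subgraph that contains all the vertices is given by its
adjacency relation). -/
def spanningTreeSet (G : SimpleGraph V) : Set (SimpleGraph V) := {T | T ≤ G ∧ T.IsTree}

/-- The near trees of `G` with respect to the terminals `s` and `t`: a spanning tree minus one
edge, such that `s` and `t` lie in different components of what remains. -/
def nearTreeSet (G : SimpleGraph V) (s t : V) : Set (SimpleGraph V) :=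
  {N | ∃ T ∈ spanningTreeSet G, ∃ e ∈ T.edgeSet, N = T.deleteEdges {e} ∧ ¬ N.Reachable s t}

/-- The group of the automorphisms of `G` that fix `s` and `t`. -/
def autOr (G : SimpleGraph V) (s t : V) : Subgroup (G ≃g G) where
  carrier := {σ | σ s = s ∧ σ t = t}
  mul_mem' := by
    rintro σ τ ⟨h₁, h₂⟩ ⟨h₃, h₄⟩
    exact ⟨by rw [RelIso.mul_apply, h₃, h₁], by rw [RelIso.mul_apply, h₄, h₂]⟩
  one_mem' := ⟨rfl, rfl⟩
  inv_mem' := by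
    rintro σ ⟨h₁, h₂⟩
    refine ⟨?_, ?_⟩
    · nth_rewrite 1 [← h₁]
      exact RelIso.inv_apply_self σ s
    · nth_rewrite 1 [← h₂]
      exact RelIso.inv_apply_self σ t

/-- `T₁ = σ T₂` for some automorphism `σ` of `G` that fixes `s` and `t`. -/
def OrEquiv (G : SimpleGraph V) (s t : V) (T₁ T₂ : SimpleGraph V) : Prop :=
  ∃ σ ∈ autOr G s t, T₁ = T₂.map σ.toEquiv.toEmbedding

/-- The set of the orbits, under the automorphisms of `G` that fix `s` and `t`, of the members
of `S`. -/
def orbitsOr (G : SimpleGraph V) (s t : V) (S : Set (SimpleGraph V)) :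
    Set (Set (SimpleGraph V)) :=
  (fun T => {T' | OrEquiv G s t T' T}) '' S

end Orbits

/-! ### The algorithms -/

/-- A spanning tree or near tree, written out explicitly as the list of its edges. -/
abbrev Forest.{u} (V : Type u) : Type u := List (Sym2 V)

/-- The graph on the vertex set `V` with the listed edges. -/
def Forest.graph.{u} {V : Type u} (F : Forest V) : SimpleGraph V :=
  SimpleGraph.fromEdgeSet {e | e ∈ F}

/-- The list `L` consists of members of `S`, exactly one from each orbit. -/
def IsRepresentatives.{u} {V : Type u} (G : SimpleGraph V) (s t : V) (S : Set (SimpleGraph V))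
    (L : List (Forest V)) : Prop :=
  (∀ F ∈ L, F.graph ∈ S) ∧
    ∀ T ∈ S, ∃! i : Fin L.length, OrEquiv G s t (L.get i).graph T

namespace SPTree

universe u

variable {V : Type u}

open Timed

/-! #### Testing oriented isomorphism -/

/-- Compare the children of two S-nodes in order: `rows` holds, for each child of the first one,
the procedure that compares it with another tree. -/
def matchSeries : List (SPTree V → Timed (Option (List (V × V)))) → List (SPTree V) →
    Timed (Option (List (V × V)))
  | [], [] => do
    tick 1
    pure (some [])
  | row :: rows, y :: ys => do
    tick 1
    match ← row y with
    | none => pure none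
    | some π => do
      match ← matchSeries rows ys with
      | none => pure none
      | some π' => do
        let l ← append π π'
        pure (some l)
  | _, _ => do
    tick 1
    pure none

/-- Find the first tree in a list that `row` accepts, and take it out of the list. -/
def matchFirst (row : SPTree V → Timed (Option (List (V × V)))) : List (SPTree V) →
    Timed (Option (List (V × V) × List (SPTree V)))
  | [] => do
    tick 1
    pure none
  | y :: ys => do
    tick 1
    match ← row y with
    | some π => pure (some (π, ys))
    | none => do
      match ← matchFirst row ys with
      | none => pure none
      | some (π, rest) => pure (some (π, y :: rest))

/-- Match the children of two P-nodes with each other, in any order. -/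
def matchParallel : List (SPTree V → Timed (Option (List (V × V)))) → List (SPTree V) →
    Timed (Option (List (V × V)))
  | [], [] => do
    tick 1
    pure (some [])
  | [], _ :: _ => do
    tick 1
    pure none
  | row :: rows, ys => do
    tick 1
    match ← matchFirst row ys with
    | none => pure none
    | some (π, rest) => do
      match ← matchParallel rows rest with
      | none => pure none
      | some π' => do
        let l ← append π π'
        pure (some l)

/-- Test whether the graphs of two decomposition trees are isomorphic by an isomorphism that maps
source to source and sink to sink. If so, return such an isomorphism, as a list of pairs of a vertex
and its image (in which a pair may be repeated). -/
def isoTest : SPTree V → SPTree V → Timed (Option (List (V × V)))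
  | edge u v, edge u' v' => do
    tick 1
    pure (some [(u, u'), (v, v')])
  | series _ c, series _ c' => do
    tick 1
    matchSeries (List.ofFn fun i => isoTest (c i)) (List.ofFn c')
  | parallel _ c, parallel _ c' => do
    tick 1
    matchParallel (List.ofFn fun i => isoTest (c i)) (List.ofFn c')
  | _, _ => do
    tick 1
    pure none

/-- Store a vertex map that is given as a list of pairs in an array. -/
def toVertexMap [DecidableEq V] (π : List (V × V)) : Timed (V → V) := do
  tick (π.length + 1)
  pure fun v => (π.lookup v).getD v

/-- An oriented isomorphism class among `k` principal subgraphs: its representative, and for every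
other member an oriented isomorphism from the representative to this member. -/
structure IsoClass (k : ℕ) (V : Type u) : Type u where
  rep : Fin k
  others : List (V → V)

/-- Put the `i`-th principal subgraph into its class, or open a new class for it. -/
def insertClass [DecidableEq V] {k : ℕ} (c : Fin k → SPTree V) (i : Fin k) :
    List (IsoClass k V) → Timed (List (IsoClass k V))
  | [] => do
    tick 1
    pure [⟨i, []⟩]
  | E :: Es => do
    tick 1
    match ← isoTest (c E.rep) (c i) with
    | some π => do
      let ρ ← toVertexMap π
      pure (⟨E.rep, ρ :: E.others⟩ :: Es)
    | none => do
      let Es' ← insertClass c i Es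
      pure (E :: Es')

/-- Put the listed principal subgraphs into their classes, one after the other. -/
def insertClasses [DecidableEq V] {k : ℕ} (c : Fin k → SPTree V) :
    List (Fin k) → List (IsoClass k V) → Timed (List (IsoClass k V))
  | [], Es => do
    tick 1
    pure Es
  | i :: is, Es => do
    tick 1
    let Es' ← insertClass c i Es
    insertClasses c is Es'

/-- Partition the principal subgraphs into oriented isomorphism classes. -/
def isoClasses [DecidableEq V] {k : ℕ} (c : Fin k → SPTree V) : Timed (List (IsoClass k V)) :=
  insertClasses c (List.finRange k) []

/-! #### Composing trees -/

/-- Extend each of the given partial choices of trees by each of the given trees. -/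
def compose (trees : List (Forest V)) (partials : List (List (Forest V))) :
    Timed (List (List (Forest V))) := do
  let rows ← mapList (fun P => mapList (fun T => do
    tick 1
    pure (T :: P)) trees) partials
  flatten rows

/-- All ways to choose one tree from each of the given lists. -/
def choices : List (List (Forest V)) → Timed (List (List (Forest V)))
  | [] => do
    tick 1
    pure [[]]
  | trees :: rest => do
    let partials ← choices rest
    compose trees partials

/-- All unions of trees, one chosen from each of the given lists. -/
def unions (factors : List (List (Forest V))) : Timed (List (Forest V)) := do
  let cs ← choices factors
  mapList flatten cs

/-- Move each listed tree by the corresponding vertex map, and form the union. -/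
def assign : List (V → V) → List (Forest V) → Timed (Forest V)
  | ρ :: ρs, F :: Fs => do
    let F' ← mapList (fun e => do
      tick 1
      pure (Sym2.map ρ e)) F
    let rest ← assign ρs Fs
    append F' rest
  | _, _ => do
    tick 1
    pure []

/-- For an isomorphism class `E` whose representative has the nonequivalent near trees `near`:
assign each multiset of `|E|` of them to the members of `E`. -/
def classNear {k : ℕ} (E : IsoClass k V) (near : List (Forest V)) : Timed (List (Forest V)) := do
  tick (E.others.length + 1)
  let Ms ← multisets (E.others.length + 1) near
  mapList (assign (id :: E.others)) Ms

/-- For an isomorphism class `E` whose representative has the nonequivalent spanning trees `span` and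
the nonequivalent near trees `near`: assign each of the spanning trees to the representative and
each multiset of `|E| - 1` of the near trees to the other members of `E`. -/
def classSpan {k : ℕ} (E : IsoClass k V) (span near : List (Forest V)) :
    Timed (List (Forest V)) := do
  tick (E.others.length + 1)
  let Ms ← multisets E.others.length near
  let rows ← mapList (fun T => mapList (fun M => assign (id :: E.others) (T :: M)) Ms) span
  flatten rows

/-- The near trees of a P-node: a near tree on every principal subgraph. -/
def parallelNear {k l : ℕ} (E : Fin l → IsoClass k V) (near : Fin l → List (Forest V)) :
    Timed (List (Forest V)) := do
  let factors ← mapList (fun j => classNear (E j) (near j)) (List.finRange l)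
  unions factors

/-- The spanning trees of a P-node: for each class `E i`, a spanning tree on the representative of
`E i`, and near trees on all the other principal subgraphs. -/
def parallelSpan {k l : ℕ} (E : Fin l → IsoClass k V) (span near : Fin l → List (Forest V)) :
    Timed (List (Forest V)) := do
  let rows ← mapList (fun i => do
    let factors ← mapList (fun j =>
      if j = i then classSpan (E j) (span j) (near j) else classNear (E j) (near j))
      (List.finRange l)
    unions factors) (List.finRange l)
  flatten rows

/-- The spanning trees of an S-node: a spanning tree on every principal subgraph. -/
def seriesSpan {k : ℕ} (span : Fin k → List (Forest V)) : Timed (List (Forest V)) := do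
  let factors ← mapList (fun j => do
    tick 1
    pure (span j)) (List.finRange k)
  unions factors

/-- The near trees of an S-node: for each `i`, a near tree on the `i`-th principal subgraph, and
spanning trees on the others. -/
def seriesNear {k : ℕ} (span near : Fin k → List (Forest V)) : Timed (List (Forest V)) := do
  let rows ← mapList (fun i => do
    let factors ← mapList (fun j => do
      tick 1
      pure (if j = i then near j else span j)) (List.finRange k)
    unions factors) (List.finRange k)
  flatten rows

/-! #### The recursive generation algorithms -/

/-- `serial_both_trees` and `parallel_both_trees`: generate both the nonequivalent spanning trees
and the nonequivalent near trees. -/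
def bothTrees [DecidableEq V] : SPTree V → Timed (List (Forest V) × List (Forest V))
  | edge u v => do
    tick 1
    pure ([[s(u, v)]], [[]])
  | series k c => do
    let sub ← table k fun i => bothTrees (c i)
    let span ← seriesSpan fun i => (sub i).1
    let near ← seriesNear (fun i => (sub i).1) (fun i => (sub i).2)
    pure (span, near)
  | parallel _ c => do
    let Es ← isoClasses c
    let sub ← table Es.length fun j => bothTrees (c (Es.get j).rep)
    let span ← parallelSpan Es.get (fun j => (sub j).1) (fun j => (sub j).2)
    let near ← parallelNear Es.get (fun j => (sub j).2)
    pure (span, near)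

/-- `serial_spanning_trees` and `parallel_spanning_trees`: generate the nonequivalent spanning
trees only. -/
def spanningTrees [DecidableEq V] : SPTree V → Timed (List (Forest V))
  | edge u v => do
    tick 1
    pure [[s(u, v)]]
  | series k c => do
    let sub ← table k fun i => spanningTrees (c i)
    seriesSpan sub
  | parallel _ c => do
    let Es ← isoClasses c
    let sub ← table Es.length fun j => bothTrees (c (Es.get j).rep)
    parallelSpan Es.get (fun j => (sub j).1) (fun j => (sub j).2)

end SPTree

/-!
The algorithms are correct because a decomposition tree with alternating node types is determined
by its oriented graph, up to the order of the children of P-nodes, and they are fast because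
hardly anything they list is wasted.

*Trees and types.* Along a decomposition tree `D`, spanning trees and near trees have a recursive
description `IsTreeOn`: on an S-node, all parts carry spanning trees, except for one near tree if
the whole is a near tree; on a P-node, all parts carry near trees, except for one spanning tree if
the whole is a spanning tree. Connectivity obeys the same recursion
(`IsChain.connects_true_iff`, `IsBundle.connects_true_iff` and their companions), which is proved
with cuts of the vertex set, since these can be glued along the terminals. Spanning trees are the
minimal connecting sets, so `IsDecompositionOf.isTree_iff` and
`IsDecompositionOf.mem_nearTreeSet_iff` identify `IsTreeOn` with the graph-theoretic notions. The
type `ty D F` of a set `F` of edges is the tree `D` with the edges of `F` marked, up to the order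
of the children of P-nodes. At a P-node it is the multiset of the types of the parts, which is why
multisets of near trees of a class representative enumerate the types without repetition
(`IsSP.lists_bothTrees`); the classes are found correctly because
isomorphism is an equivalence relation, so that the greedy matching of children never runs into a
dead end (`isoClasses_spec`).

*Types and orbits.* Two subgraphs are in the same orbit if and only if they have the same type
(`IsDecompositionOf.orEquiv_iff`). An isomorphism of trees induces a vertex map by gluing
(`Match.exists_isoVia`). Conversely, an automorphism maps `D` to another alternating tree of the
same graph, so the uniqueness `isoVia_id_of_edges_eq` is needed: the inner junctions of an S-node
are the vertices that separate the terminals, and the number of those that come before an edge is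
the index of its child; the children of a P-node are the parts that stay connected without the
terminals.

*Running time.* Writing the output takes at least as many steps as its total length, which gives
the lower bounds (`IsSP.le_steps`). For the upper bounds, let `m` be the number of edges, which is
less than twice the number of vertices (`IsSP.esize_le`), and let `S` and `N` be the numbers of
listed spanning trees and near trees. Comparing the children of a P-node takes `O(m²)` steps, which
is `O(m S)` since `m` is `O(S)` there: the trees of different parts vary independently, so linear
lower bounds for the children add up. The steps of the recursive calls are bounded, by induction,
by `300 m (2 S + 3 N)` at S-nodes and by `300 m (3 S + 2 N)` at other nodes. Since the node types
alternate, and `S` and `N` grow from the children to the parent, the calls use up at most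
`300 m (S + 2 N)` and `300 m (2 S + N)` of this, and the rest pays for the work at the node itself
(`IsSP.bounds_bothTrees`, `IsSP.spanningTrees_steps_le`).
-/

/-! ### Values and step counts of the list operations -/

namespace Timed

universe u v

section Basic

variable {α β : Type u}

@[simp] theorem bind_val (x : Timed α) (f : α → Timed β) : (x >>= f).val = (f x.val).val := rfl

@[simp] theorem bind_steps (x : Timed α) (f : α → Timed β) :
    (x >>= f).steps = x.steps + (f x.val).steps := rfl

@[simp] theorem pure_val (a : α) : (pure a : Timed α).val = a := rfl

@[simp] theorem pure_steps (a : α) : (pure a : Timed α).steps = 0 := rfl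

@[simp] theorem tick_steps (n : ℕ) : (tick n).steps = n := rfl

@[simp] theorem append_val (l₁ l₂ : List α) : (append l₁ l₂).val = l₁ ++ l₂ := rfl

@[simp] theorem append_steps (l₁ l₂ : List α) : (append l₁ l₂).steps = l₁.length + 1 := rfl

@[simp] theorem mapList_val {α : Type v} (f : α → Timed β) (l : List α) :
    (mapList f l).val = l.map fun a => (f a).val := by
  induction l with
  | nil => rfl
  | cons a l ih => simp [mapList, ih]

@[simp] theorem mapList_steps {α : Type v} (f : α → Timed β) (l : List α) :
    (mapList f l).steps = (l.map fun a => (f a).steps + 1).sum + 1 := by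
  induction l with
  | nil => rfl
  | cons a l ih => simp [mapList, ih]; ring

@[simp] theorem flatten_val (l : List (List α)) : (flatten l).val = l.flatten := by
  induction l with
  | nil => rfl
  | cons a l ih => simp [flatten, ih]

@[simp] theorem flatten_steps (l : List (List α)) :
    (flatten l).steps = (l.map fun a => a.length + 1).sum + 1 := by
  induction l with
  | nil => rfl
  | cons a l ih => simp [flatten, ih]; ring

end Basic

/-! ### Listing multisets -/

section Multisets

variable {α : Type u} {β : Type v}

theorem multisets_succ_nil (m : ℕ) : (multisets (m + 1) ([] : List α)).val = [] := rfl

theorem multisets_succ_cons (m : ℕ) (a : α) (l : List α) :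
    (multisets (m + 1) (a :: l)).val =
      ((multisets m (a :: l)).val.map fun x => a :: x) ++ (multisets (m + 1) l).val := by
  change (multisetsStep (multisets m) (a :: l)).val = _ ++ (multisetsStep (multisets m) l).val
  simp [multisetsStep]

theorem multisets_succ_cons_steps (m : ℕ) (a : α) (l : List α) :
    (multisets (m + 1) (a :: l)).steps = (multisets m (a :: l)).steps +
      3 * (multisets m (a :: l)).val.length + 2 + (multisets (m + 1) l).steps := by
  change (multisetsStep (multisets m) (a :: l)).steps = _ + (multisetsStep (multisets m) l).steps
  simp [multisetsStep]; ring

theorem length_multisets (m : ℕ) (l : List α) :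
    (multisets m l).val.length = Nat.multichoose l.length m := by
  induction m generalizing l with
  | zero => simp [multisets]
  | succ m ihm =>
    induction l with
    | nil => simp [multisets_succ_nil]
    | cons a l ih =>
      rw [multisets_succ_cons, List.length_append, List.length_map, ih, ihm, List.length_cons,
        Nat.multichoose_succ_succ, add_comm]

theorem multichoose_pos {n : ℕ} (hn : 0 < n) (m : ℕ) : 0 < Nat.multichoose n m := by
  rw [Nat.multichoose_eq]
  exact Nat.choose_pos (by omega)

theorem multisets_steps_le (m : ℕ) (l : List α) (hl : l ≠ []) :
    (multisets m l).steps ≤ 7 * (m + 1) * Nat.multichoose l.length m := by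
  induction m generalizing l with
  | zero => simp [multisets]
  | succ m ihm =>
    induction l with
    | nil => exact absurd rfl hl
    | cons a l ih =>
      rw [multisets_succ_cons_steps, length_multisets]
      have h1 := ihm (a :: l) hl
      rcases eq_or_ne l [] with rfl | hne
      · have : (multisets (m + 1) ([] : List α)).steps = 1 := rfl
        rw [this]
        simp only [List.length_cons, List.length_nil, zero_add, Nat.multichoose_one] at h1 ⊢
        omega
      · have h2 := ih hne
        rw [List.length_cons] at h1 ⊢
        rw [Nat.multichoose_succ_succ]
        have h3 := multichoose_pos (n := l.length + 1) (by omega) m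
        nlinarith

theorem mem_multisets {m : ℕ} {l M : List α} (hM : M ∈ (multisets m l).val) :
    M.length = m ∧ ∀ x ∈ M, x ∈ l := by
  induction m generalizing l M with
  | zero => simp [multisets] at hM; simp [hM]
  | succ m ihm =>
    induction l with
    | nil => simp [multisets_succ_nil] at hM
    | cons a l ih =>
      rw [multisets_succ_cons, List.mem_append, List.mem_map] at hM
      rcases hM with ⟨M', hM', rfl⟩ | hM
      · obtain ⟨h1, h2⟩ := ihm hM'
        simp only [List.length_cons, h1, true_and, List.mem_cons, forall_eq_or_imp, true_or]
        simpa using h2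
      · exact ⟨(ih hM).1, fun x hx => List.mem_cons_of_mem _ ((ih hM).2 x hx)⟩

/-- Every multiset of `m` values of `g` on the list is listed. -/
theorem exists_mem_multisets (g : α → β) {m : ℕ} {l : List α} {q : Multiset β}
    (hq : q.card = m) (hql : ∀ x ∈ q, x ∈ l.map g) :
    ∃ M ∈ (multisets m l).val, (↑(M.map g) : Multiset β) = q := by
  classical
  induction m generalizing l q with
  | zero =>
    rw [Multiset.card_eq_zero] at hq
    exact ⟨[], by simp [multisets], by simp [hq]⟩
  | succ m ihm =>
    induction l with
    | nil =>
      obtain ⟨x, hx⟩ := Multiset.card_pos_iff_exists_mem.1 (by omega : 0 < q.card)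
      simpa using hql x hx
    | cons a l ih =>
      rw [multisets_succ_cons]
      by_cases ha : g a ∈ q
      · obtain ⟨q', rfl⟩ := Multiset.exists_cons_of_mem ha
        obtain ⟨M, hM, hMq⟩ := ihm (l := a :: l) (q := q') (by simpa using hq)
          fun x hx => hql x (Multiset.mem_cons_of_mem hx)
        refine ⟨a :: M, List.mem_append_left _ (List.mem_map_of_mem hM), ?_⟩
        simp [← hMq]
      · obtain ⟨M, hM, hMq⟩ := ih fun x hx => by
          have := hql x hx
          rw [List.map_cons, List.mem_cons] at this
          exact this.resolve_left fun h => ha (h ▸ hx)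
        exact ⟨M, List.mem_append_right _ hM, hMq⟩

/-- If `g` separates the entries of the list, it separates the listed multisets. -/
theorem nodup_map_multisets (g : α → β) (m : ℕ) {l : List α} (hl : (l.map g).Nodup) :
    ((multisets m l).val.map fun M => (↑(M.map g) : Multiset β)).Nodup := by
  induction m generalizing l with
  | zero => simp [multisets]
  | succ m ihm =>
    induction l with
    | nil => simp [multisets_succ_nil]
    | cons a l ih =>
      rw [multisets_succ_cons, List.map_append, List.nodup_append']
      rw [List.map_cons, List.nodup_cons] at hl
      refine ⟨?_, ih hl.2, ?_⟩
      · have := (ihm (l := a :: l) (by simpa using hl)).map (f := fun q => g a ::ₘ q)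
          fun _ _ h => (Multiset.cons_inj_right _).1 h
        rw [List.map_map] at this ⊢
        exact this
      · rw [List.disjoint_left]
        intro q h1 h2
        rw [List.map_map, List.mem_map] at h1
        rw [List.mem_map] at h2
        obtain ⟨M, -, rfl⟩ := h1
        obtain ⟨M', hM', h⟩ := h2
        have h3 : g a ∈ (↑(M'.map g) : Multiset β) := by simp [h]
        rw [Multiset.mem_coe, List.mem_map] at h3
        obtain ⟨x, hx, hxa⟩ := h3
        exact hl.1 (List.mem_map.2 ⟨x, (mem_multisets hM').2 x hx, hxa⟩)

end Multisets

end Timed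

/-! ### Unions of chosen forests -/

namespace SPTree

open Timed

universe u

variable {V : Type u}

theorem choices_nil_val : (choices ([] : List (List (Forest V)))).val = [[]] := rfl

theorem choices_cons_val (L : List (Forest V)) (Ls : List (List (Forest V))) :
    (choices (L :: Ls)).val = (choices Ls).val.flatMap fun P => L.map fun T => T :: P := by
  simp [choices, compose, List.flatMap]

theorem unions_val (Ls : List (List (Forest V))) :
    (unions Ls).val = (choices Ls).val.map List.flatten := by
  simp [unions]

theorem length_choices (Ls : List (List (Forest V))) :
    (choices Ls).val.length = (Ls.map List.length).prod := by
  induction Ls with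
  | nil => rfl
  | cons L Ls ih => simp [choices_cons_val, List.length_flatMap, ih, mul_comm]

theorem mem_choices {Ls : List (List (Forest V))} {P : List (Forest V)} :
    P ∈ (choices Ls).val ↔ List.Forall₂ (fun T L => T ∈ L) P Ls := by
  induction Ls generalizing P with
  | nil => simp [choices_nil_val]
  | cons L Ls ih =>
    simp only [choices_cons_val, List.mem_flatMap, List.mem_map, ih, List.forall₂_cons_right_iff]
    constructor
    · rintro ⟨P', hP', T, hT, rfl⟩
      exact ⟨T, P', hT, hP', rfl⟩
    · rintro ⟨T, P', hT, hP', rfl⟩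
      exact ⟨P', hP', T, hT, rfl⟩

theorem length_unions (Ls : List (List (Forest V))) :
    (unions Ls).val.length = (Ls.map List.length).prod := by
  rw [unions_val, List.length_map, length_choices]

theorem choices_steps_le (Ls : List (List (Forest V))) (h : ∀ L ∈ Ls, L ≠ []) :
    (choices Ls).steps ≤ (8 * Ls.length + 1) * (Ls.map List.length).prod := by
  induction Ls with
  | nil => simp [choices]
  | cons L Ls ih =>
    have h1 := ih fun L hL => h L (List.mem_cons_of_mem _ hL)
    have h2 : (choices (L :: Ls)).steps = (choices Ls).steps +
        ((choices Ls).val.length * (2 * L.length + 2) + 1 +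
          ((choices Ls).val.length * (L.length + 1) + 1)) := by
      simp only [choices, compose, bind_steps, mapList_steps, mapList_val, flatten_steps,
        tick_steps, pure_steps, pure_val, bind_val, List.map_map, Function.comp_def,
        List.length_map, List.map_const', List.sum_replicate, smul_eq_mul]
      ring
    have hL : 0 < L.length := List.length_pos_iff.2 (h L (by simp))
    have hP : 0 < (Ls.map List.length).prod :=
      List.prod_pos fun x hx => by
        obtain ⟨L', hL', rfl⟩ := List.mem_map.1 hx
        exact List.length_pos_iff.2 (h L' (List.mem_cons_of_mem _ hL'))
    rw [h2, length_choices, List.map_cons, List.prod_cons, List.length_cons]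
    generalize (Ls.map List.length).prod = p at *
    generalize L.length = a at *
    have h3 : p ≤ a * p := Nat.le_mul_of_pos_left _ hL
    have h4 : (8 * Ls.length + 1) * p ≤ (8 * Ls.length + 1) * (a * p) := Nat.mul_le_mul_left _ h3
    nlinarith

section Family

variable {ι K : Type*} {E : ι → Set (Sym2 V)} {κ : ι → Set (Sym2 V) → K}

theorem mem_unions_map {js : List ι} {L : ι → List (Forest V)} {F : Forest V} :
    F ∈ (unions (js.map L)).val ↔
      ∃ P : List (Forest V), List.Forall₂ (fun T j => T ∈ L j) P js ∧ P.flatten = F := by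
  simp [unions_val, mem_choices, List.forall₂_map_right_iff]

/-- All lengths of unions are equal if this holds for the forests of each factor. -/
theorem length_of_mem_unions {js : List ι} {L : ι → List (Forest V)} {w : ι → ℕ}
    (hw : ∀ j ∈ js, ∀ F ∈ L j, F.length = w j) {F : Forest V}
    (hF : F ∈ (unions (js.map L)).val) : F.length = (js.map w).sum := by
  obtain ⟨P, hP, rfl⟩ := mem_unions_map.1 hF
  clear hF
  induction hP with
  | nil => rfl
  | cons h _ ih =>
    simp only [List.flatten_cons, List.length_append, List.map_cons, List.sum_cons]
    rw [hw _ (by simp) _ h, ih fun j hj => hw j (List.mem_cons_of_mem _ hj)]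

theorem unions_steps_le (js : List ι) (L : ι → List (Forest V)) {w : ι → ℕ}
    (hL : ∀ j ∈ js, L j ≠ []) (hw : ∀ j ∈ js, ∀ F ∈ L j, F.length = w j) :
    (unions (js.map L)).steps ≤
      (9 * js.length + (js.map w).sum + 4) * (js.map fun j => (L j).length).prod := by
  have h1 := choices_steps_le (js.map L) (by simpa using hL)
  have h2 := length_choices (js.map L)
  rw [List.map_map] at h1 h2
  change _ ≤ _ * (js.map fun j => (L j).length).prod at h1
  change _ = (js.map fun j => (L j).length).prod at h2
  have h3 : (unions (js.map L)).steps = (choices (js.map L)).steps +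
      (((choices (js.map L)).val.map fun P => (flatten P).steps + 1).sum + 1) := by
    simp [unions]
  have h4 : ∀ x ∈ (choices (js.map L)).val.map (fun P => (flatten P).steps + 1),
      x ≤ (js.map w).sum + js.length + 2 := by
    intro x hx
    obtain ⟨P, hP, rfl⟩ := List.mem_map.1 hx
    rw [mem_choices, List.forall₂_map_right_iff] at hP
    have h5 : P.length = js.length := hP.length_eq
    have h6 := length_of_mem_unions hw (mem_unions_map.2 ⟨P, hP, rfl⟩)
    rw [List.length_flatten] at h6
    rw [flatten_steps, List.sum_map_add]
    simp [h5]
    omega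
  have h5 := List.sum_le_card_nsmul _ _ h4
  rw [List.length_map, h2, smul_eq_mul] at h5
  have h6 : 0 < (js.map fun j => (L j).length).prod :=
    List.prod_pos fun x hx => by
      obtain ⟨j, hj, rfl⟩ := List.mem_map.1 hx
      exact List.length_pos_iff.2 (hL j hj)
  rw [h3]
  rw [List.length_map] at h1
  generalize (js.map fun j => (L j).length).prod = p at *
  nlinarith

/-- Every listed union is copied, at the cost of its length. -/
theorem sum_length_le_unions_steps (Ls : List (List (Forest V))) :
    ((unions Ls).val.map fun F => F.length + 1).sum ≤ (unions Ls).steps := by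
  have h : (unions Ls).steps = (choices Ls).steps +
      (((choices Ls).val.map fun P => (flatten P).steps + 1).sum + 1) := by
    simp [unions]
  rw [h, unions_val, List.map_map]
  refine le_trans (List.sum_le_sum (g := fun P => (flatten P).steps + 1) fun P _ => ?_) (by omega)
  simp only [Function.comp_apply, flatten_steps, List.length_flatten, List.sum_map_add]
  simp only [List.map_const', List.sum_replicate, smul_eq_mul, mul_one]
  omega

/-- On the part `E j`, a union of forests coincides with the forest that was chosen for `j`. -/
theorem eq_on_part_of_mem_unions {js : List ι} {L : ι → List (Forest V)} (hjs : js.Nodup)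
    (hE : ∀ i j, i ≠ j → Disjoint (E i) (E j)) (hL : ∀ j ∈ js, ∀ F ∈ L j, ∀ e ∈ F, e ∈ E j)
    {F : Forest V} (hF : F ∈ (unions (js.map L)).val) :
    (∀ e ∈ F, ∃ j ∈ js, e ∈ E j) ∧ ∀ j ∈ js, ∃ T ∈ L j, ∀ e ∈ E j, e ∈ F ↔ e ∈ T := by
  obtain ⟨P, hP, rfl⟩ := mem_unions_map.1 hF
  clear hF
  induction hP with
  | nil => simp
  | @cons T j P js h _ ih =>
    rw [List.nodup_cons] at hjs
    obtain ⟨h1, h2⟩ := ih hjs.2 fun j hj => hL j (List.mem_cons_of_mem _ hj)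
    simp only [List.flatten_cons, List.mem_append, List.mem_cons, exists_eq_or_imp,
      forall_eq_or_imp]
    refine ⟨?_, ⟨T, h, fun e he => ⟨?_, Or.inl⟩⟩, fun i hi => ?_⟩
    · rintro e (he | he)
      · exact Or.inl (hL j (by simp) T h e he)
      · exact Or.inr (h1 e he)
    · rintro (he' | he')
      · exact he'
      · obtain ⟨i, hi, hei⟩ := h1 e he'
        exact absurd he (Set.disjoint_left.1 (hE i j fun hij => hjs.1 (hij ▸ hi)) hei)
    · obtain ⟨T', hT', h3⟩ := h2 i hi
      refine ⟨T', hT', fun e he => ⟨?_, fun h => Or.inr ((h3 e he).2 h)⟩⟩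
      rintro (he' | he')
      · exact absurd he (Set.disjoint_left.1 (hE j i fun hij => hjs.1 (hij ▸ hi))
          (hL j (by simp) T h e he'))
      · exact (h3 e he).1 he'

/-- Any choice of keys of the factors is realized by a listed union. -/
theorem exists_mem_unions {js : List ι} {L : ι → List (Forest V)} (hjs : js.Nodup)
    (hE : ∀ i j, i ≠ j → Disjoint (E i) (E j)) (hL : ∀ j ∈ js, ∀ F ∈ L j, ∀ e ∈ F, e ∈ E j)
    (hκ : ∀ j F F', (∀ e ∈ E j, e ∈ F ↔ e ∈ F') → κ j F = κ j F')
    (q : ι → K) (hq : ∀ j ∈ js, ∃ F ∈ L j, κ j {e | e ∈ F} = q j) :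
    ∃ F ∈ (unions (js.map L)).val, ∀ j ∈ js, κ j {e | e ∈ F} = q j := by
  have h : ∃ P : List (Forest V),
      List.Forall₂ (fun T j => T ∈ L j ∧ κ j {e | e ∈ T} = q j) P js := by
    clear hjs hL
    induction js with
    | nil => exact ⟨[], List.Forall₂.nil⟩
    | cons j js ih =>
      obtain ⟨P, hP⟩ := ih fun j hj => hq j (List.mem_cons_of_mem _ hj)
      obtain ⟨F, hF⟩ := hq j (by simp)
      exact ⟨F :: P, List.Forall₂.cons hF hP⟩
  obtain ⟨P, hP⟩ := h
  refine ⟨P.flatten, mem_unions_map.2 ⟨P, hP.imp fun _ _ h => h.1, rfl⟩, ?_⟩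
  have key : ∀ j ∈ js, ∃ T, κ j {e | e ∈ T} = q j ∧ T ∈ L j ∧ ∀ e ∈ E j, e ∈ P.flatten ↔ e ∈ T := by
    clear hq
    induction hP with
    | nil => simp
    | @cons T j P js h hP ih =>
      rw [List.nodup_cons] at hjs
      have h0 := ih hjs.2 fun j hj => hL j (List.mem_cons_of_mem _ hj)
      have h1 := (eq_on_part_of_mem_unions hjs.2 hE (fun j hj => hL j (List.mem_cons_of_mem _ hj))
        (mem_unions_map.2 ⟨P, hP.imp fun _ _ h => h.1, rfl⟩)).1
      intro i hi
      rcases List.mem_cons.1 hi with rfl | hi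
      · refine ⟨T, h.2, h.1, fun e he => ?_⟩
        rw [List.flatten_cons, List.mem_append, or_iff_left]
        intro he'
        obtain ⟨j, hj, hej⟩ := h1 e he'
        exact Set.disjoint_left.1 (hE j i fun hij => hjs.1 (hij ▸ hj)) hej he
      · obtain ⟨T', h2, h3, h4⟩ := h0 i hi
        refine ⟨T', h2, h3, fun e he => ?_⟩
        rw [List.flatten_cons, List.mem_append, or_iff_right, h4 e he]
        intro he'
        exact Set.disjoint_left.1 (hE j i fun hij => hjs.1 (hij ▸ hi))
          (hL j (by simp) T h.1 e he') he
  intro j hj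
  obtain ⟨T, h1, -, h2⟩ := key j hj
  rw [← h1]
  exact hκ j _ _ h2

/-- If keys separate the forests of each factor, the families of keys separate the unions. -/
theorem nodup_unions {js : List ι} {L : ι → List (Forest V)} (hjs : js.Nodup)
    (hE : ∀ i j, i ≠ j → Disjoint (E i) (E j)) (hL : ∀ j ∈ js, ∀ F ∈ L j, ∀ e ∈ F, e ∈ E j)
    (hκ : ∀ j F F', (∀ e ∈ E j, e ∈ F ↔ e ∈ F') → κ j F = κ j F')
    (hn : ∀ j ∈ js, ((L j).map fun F => κ j {e | e ∈ F}).Nodup) :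
    ((unions (js.map L)).val.map fun F => js.map fun j => κ j {e | e ∈ F}).Nodup := by
  induction js with
  | nil => simp [unions_val, choices_nil_val]
  | cons j js ih =>
    rw [List.nodup_cons] at hjs
    have hL' := fun j hj => hL j (List.mem_cons_of_mem _ hj)
    have ih' := ih hjs.2 hL' fun j hj => hn j (List.mem_cons_of_mem _ hj)
    have hj := hn j (by simp)
    have hLj := hL j (by simp)
    rw [unions_val, List.map_map, List.Nodup, List.pairwise_map] at ih' ⊢
    rw [List.map_cons, choices_cons_val, List.pairwise_flatMap]
    -- the key of a union at `j`, and at the other indices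
    have hk1 : ∀ P ∈ (choices (js.map L)).val, ∀ T ∈ L j,
        κ j {e | e ∈ (T :: P).flatten} = κ j {e | e ∈ T} := by
      intro P hP T hT
      have hP' : P.flatten ∈ (unions (js.map L)).val := by
        rw [unions_val]; exact List.mem_map_of_mem hP
      refine hκ _ _ _ fun e he => ?_
      simp only [List.flatten_cons, List.mem_append, Set.mem_ofPred_eq, or_iff_left_iff_imp]
      intro he'
      obtain ⟨i, hi, hei⟩ := (eq_on_part_of_mem_unions hjs.2 hE hL' hP').1 e he'
      exact absurd he (Set.disjoint_left.1 (hE i j fun hij => hjs.1 (hij ▸ hi)) hei)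
    have hk2 : ∀ P, ∀ T ∈ L j, (js.map fun i => κ i {e | e ∈ (T :: P).flatten}) =
        js.map fun i => κ i {e | e ∈ P.flatten} := by
      intro P T hT
      refine List.map_congr_left fun i hi => hκ _ _ _ fun e he => ?_
      simp only [List.flatten_cons, List.mem_append, Set.mem_ofPred_eq, or_iff_right_iff_imp]
      intro he'
      exact absurd he (Set.disjoint_left.1 (hE j i fun hij => hjs.1 (hij ▸ hi)) (hLj T hT e he'))
    refine ⟨fun P hP => ?_, ih'.imp_of_mem fun {P P'} hP hP' hne T' hT' T'' hT'' => ?_⟩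
    · rw [List.Nodup, List.pairwise_map] at hj
      rw [List.pairwise_map]
      refine hj.imp_of_mem fun {T T'} hT hT' hne h => hne ?_
      simp only [Function.comp_apply, List.map_cons, List.cons.injEq] at h
      rw [← hk1 P hP T hT, ← hk1 P hP T' hT', h.1]
    · obtain ⟨T, hT, rfl⟩ := List.mem_map.1 hT'
      obtain ⟨T', hT', rfl⟩ := List.mem_map.1 hT''
      intro h
      simp only [Function.comp_apply, List.map_cons, List.cons.injEq] at h hne
      exact hne (by rw [← hk2 P T hT, ← hk2 P' T' hT', h.2])

end Family

end SPTree

/-! ### Matching decomposition trees -/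

/-- Two finite families agree up to a bijection of their index sets if they have the same
multiset of values. -/
theorem exists_equiv_iff_map_univ_eq {α β T : Type*} [Fintype α] [Fintype β] (f : α → T)
    (g : β → T) : (∃ e : α ≃ β, ∀ i, f i = g (e i)) ↔
      Multiset.map f Finset.univ.val = Multiset.map g Finset.univ.val := by
  classical
  constructor
  · rintro ⟨e, he⟩
    have h1 : Multiset.map (fun i => e i) (Finset.univ : Finset α).val = Finset.univ.val :=
      Multiset.map_univ_val_equiv e
    rw [← h1, Multiset.map_map]
    exact Multiset.map_congr rfl fun i _ => he i
  · intro h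
    have h1 : ∀ t, Nonempty ({i // f i = t} ≃ {j // g j = t}) := by
      intro t
      have h2 := congrArg (Multiset.count t) h
      rw [Multiset.count_map, Multiset.count_map] at h2
      rw [← Fintype.card_eq, Fintype.card_subtype, Fintype.card_subtype]
      simpa [Finset.card_def, eq_comm] using h2
    refine ⟨(Equiv.sigmaFiberEquiv f).symm.trans
      ((Equiv.sigmaCongrRight fun t => (h1 t).some).trans (Equiv.sigmaFiberEquiv g)), fun i => ?_⟩
    exact ((h1 (f i)).some ⟨i, rfl⟩).2.symm

namespace SPTree

universe u

variable {V : Type u}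

/-- `Match r D D'`: the trees `D` and `D'` have the same shape, up to the order of the children of
P-nodes, in such a way that any two corresponding edge nodes are related by `r`, a relation between
the source and sink of the one and the source and sink of the other. -/
def Match (r : V → V → V → V → Prop) : SPTree V → SPTree V → Prop
  | edge u v, edge u' v' => r u v u' v'
  | series k c, series k' c' =>
    ∃ e : Fin k ≃ Fin k', (∀ i, (e i : ℕ) = i) ∧ ∀ i, Match r (c i) (c' (e i))
  | parallel k c, parallel k' c' => ∃ e : Fin k ≃ Fin k', ∀ i, Match r (c i) (c' (e i))
  | _, _ => False

theorem fin_equiv_eq_of_val {k : ℕ} {e : Fin k ≃ Fin k} (he : ∀ i, (e i : ℕ) = i) :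
    e = Equiv.refl _ := by
  ext i
  simp [he i]

theorem mem_edges_node {k : ℕ} {c : Fin k → SPTree V} {e : Sym2 V} :
    (e ∈ (series k c).edges ↔ ∃ i, e ∈ (c i).edges) ∧
      (e ∈ (parallel k c).edges ↔ ∃ i, e ∈ (c i).edges) := by
  simp [edges]

theorem Match.imp {r r' : V → V → V → V → Prop} {D D' : SPTree V} (h : Match r D D')
    (hr : ∀ u v u' v', s(u, v) ∈ D.edges → s(u', v') ∈ D'.edges → r u v u' v' → r' u v u' v') :
    Match r' D D' := by
  induction D generalizing D' with
  | edge u v =>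
    cases D' with
    | edge u' v' => exact hr _ _ _ _ rfl rfl h
    | series _ _ => exact h
    | parallel _ _ => exact h
  | series k c ih =>
    cases D' with
    | edge u' v' => exact h
    | series k' c' =>
      obtain ⟨e, he, h⟩ := h
      exact ⟨e, he, fun i => ih i (h i) fun u v u' v' h1 h2 =>
        hr u v u' v' (mem_edges_node.1.2 ⟨i, h1⟩) (mem_edges_node.1.2 ⟨_, h2⟩)⟩
    | parallel _ _ => exact h
  | parallel k c ih =>
    cases D' with
    | edge u' v' => exact h
    | series _ _ => exact h
    | parallel k' c' =>
      obtain ⟨e, h⟩ := h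
      exact ⟨e, fun i => ih i (h i) fun u v u' v' h1 h2 =>
        hr u v u' v' (mem_edges_node.2.2 ⟨i, h1⟩) (mem_edges_node.2.2 ⟨_, h2⟩)⟩

theorem Match.refl {r : V → V → V → V → Prop} (hr : ∀ u v, r u v u v) (D : SPTree V) :
    Match r D D := by
  induction D with
  | edge u v => exact hr u v
  | series k c ih => exact ⟨Equiv.refl _, fun _ => rfl, ih⟩
  | parallel k c ih => exact ⟨Equiv.refl _, ih⟩

theorem Match.symm {r r' : V → V → V → V → Prop} {D D' : SPTree V} (h : Match r D D')
    (hr : ∀ u v u' v', r u v u' v' → r' u' v' u v) : Match r' D' D := by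
  induction D generalizing D' with
  | edge u v =>
    cases D' with
    | edge u' v' => exact hr _ _ _ _ h
    | series _ _ => exact h
    | parallel _ _ => exact h
  | series k c ih =>
    cases D' with
    | edge u' v' => exact h
    | series k' c' =>
      obtain ⟨e, he, h⟩ := h
      refine ⟨e.symm, fun i => ?_, fun i => ih (e.symm i) (by simpa using h (e.symm i))⟩
      have := he (e.symm i)
      rw [Equiv.apply_symm_apply] at this
      exact this.symm
    | parallel _ _ => exact h
  | parallel k c ih =>
    cases D' with
    | edge u' v' => exact h
    | series _ _ => exact h
    | parallel k' c' =>
      obtain ⟨e, h⟩ := h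
      exact ⟨e.symm, fun i => ih (e.symm i) (by simpa using h (e.symm i))⟩

theorem Match.trans {r₁ r₂ r : V → V → V → V → Prop} {D₁ D₂ D₃ : SPTree V} (h₁ : Match r₁ D₁ D₂)
    (h₂ : Match r₂ D₂ D₃)
    (hr : ∀ u v u' v' u'' v'', r₁ u v u' v' → r₂ u' v' u'' v'' → r u v u'' v'') :
    Match r D₁ D₃ := by
  induction D₁ generalizing D₂ D₃ with
  | edge u v =>
    cases D₂ <;> cases D₃ <;> first | exact h₁.elim | exact h₂.elim | exact hr _ _ _ _ _ _ h₁ h₂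
  | series k c ih =>
    cases D₂ <;> cases D₃ <;> try first | exact h₁.elim | exact h₂.elim
    obtain ⟨e, he, h₁⟩ := h₁
    obtain ⟨e', he', h₂⟩ := h₂
    exact ⟨e.trans e', fun i => by simp [he, he'], fun i => ih i (h₁ i) (h₂ (e i))⟩
  | parallel k c ih =>
    cases D₂ <;> cases D₃ <;> try first | exact h₁.elim | exact h₂.elim
    obtain ⟨e, h₁⟩ := h₁
    obtain ⟨e', h₂⟩ := h₂
    exact ⟨e.trans e', fun i => ih i (h₁ i) (h₂ (e i))⟩

/-! ### Marked decomposition trees -/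

/-- Decomposition trees with marked edges, up to the order of the children of P-nodes. Only the
marks on edges of the tree matter. -/
def markedSetoid (V : Type u) : Setoid (SPTree V × Set (Sym2 V)) where
  r x y := Match (fun u v u' v' => s(u, v) ∈ x.2 ↔ s(u', v') ∈ y.2) x.1 y.1
  iseqv :=
    { refl := fun x => Match.refl (fun _ _ => Iff.rfl) x.1
      symm := fun h => h.symm fun _ _ _ _ => Iff.symm
      trans := fun h h' => h.trans h' fun _ _ _ _ _ _ => Iff.trans }

/-- The type of the set `F` of edges in the graph of `D`: two sets have the same type if and only
if they correspond under an isomorphism of decomposition trees. -/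
def ty (D : SPTree V) (F : Set (Sym2 V)) : Quotient (markedSetoid V) := Quotient.mk _ (D, F)

/-- The shape of a decomposition tree, up to the order of the children of P-nodes. -/
def shape (D : SPTree V) : Quotient (markedSetoid V) := ty D ∅

theorem ty_eq_ty {D D' : SPTree V} {F F' : Set (Sym2 V)} :
    ty D F = ty D' F' ↔ Match (fun u v u' v' => s(u, v) ∈ F ↔ s(u', v') ∈ F') D D' :=
  Quotient.eq (r := markedSetoid V)

theorem shape_eq_shape {D D' : SPTree V} :
    shape D = shape D' ↔ Match (fun _ _ _ _ => True) D D' := by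
  simp [shape, ty_eq_ty]

theorem Match.shape_eq {r : V → V → V → V → Prop} {D D' : SPTree V} (h : Match r D D') :
    shape D = shape D' :=
  shape_eq_shape.2 (h.imp fun _ _ _ _ _ _ _ => trivial)

theorem shape_eq_of_ty_eq {D D' : SPTree V} {F F' : Set (Sym2 V)} (h : ty D F = ty D' F') :
    shape D = shape D' :=
  (ty_eq_ty.1 h).shape_eq

theorem ty_congr {D : SPTree V} {F F' : Set (Sym2 V)} (h : ∀ e ∈ D.edges, e ∈ F ↔ e ∈ F') :
    ty D F = ty D F' := by
  have h1 : Match (fun u v u' v' => u = u' ∧ v = v') D D := Match.refl (fun _ _ => ⟨rfl, rfl⟩) D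
  refine ty_eq_ty.2 (h1.imp ?_)
  rintro u v _ _ hu - ⟨rfl, rfl⟩
  exact h _ hu

theorem ty_series_eq {k : ℕ} {c : Fin k → SPTree V} {F F' : Set (Sym2 V)} :
    ty (series k c) F = ty (series k c) F' ↔ ∀ i, ty (c i) F = ty (c i) F' := by
  simp only [ty_eq_ty]
  constructor
  · rintro ⟨e, he, h⟩
    rw [fin_equiv_eq_of_val he] at h
    exact h
  · exact fun h => ⟨Equiv.refl _, fun _ => rfl, h⟩

theorem ty_parallel_eq {k k' : ℕ} {c : Fin k → SPTree V} {c' : Fin k' → SPTree V}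
    {F F' : Set (Sym2 V)} : ty (parallel k c) F = ty (parallel k' c') F' ↔
      (Finset.univ.val.map fun i => ty (c i) F) = Finset.univ.val.map fun i => ty (c' i) F' := by
  rw [← exists_equiv_iff_map_univ_eq, ty_eq_ty]
  simp only [ty_eq_ty]
  rfl

theorem shape_parallel_eq {k k' : ℕ} {c : Fin k → SPTree V} {c' : Fin k' → SPTree V} :
    shape (parallel k c) = shape (parallel k' c') ↔
      (Finset.univ.val.map fun i => shape (c i)) = Finset.univ.val.map fun i => shape (c' i) :=
  ty_parallel_eq

/-! ### Vertices, edges and terminals -/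

/-- The number of edge nodes. -/
def esize : SPTree V → ℕ
  | edge _ _ => 1
  | series _ c => ∑ i, (c i).esize
  | parallel _ c => ∑ i, (c i).esize

/-- The number of vertices other than the terminals, computed along the tree. -/
def inner : SPTree V → ℕ
  | edge _ _ => 0
  | series k c => ∑ i, (c i).inner + (k - 1)
  | parallel _ c => ∑ i, (c i).inner

theorem Match.numbers_eq {r : V → V → V → V → Prop} {D D' : SPTree V} (h : Match r D D') :
    D.esize = D'.esize ∧ D.inner = D'.inner := by
  induction D generalizing D' with
  | edge u v => cases D' <;> first | exact h.elim | exact ⟨rfl, rfl⟩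
  | series k c ih =>
    cases D' <;> try exact h.elim
    rename_i c'
    obtain ⟨e, he, h⟩ := h
    have hk := Fin.equiv_iff_eq.1 ⟨e⟩
    subst hk
    refine ⟨?_, congrArg (· + (k - 1)) ?_⟩
    · exact (Finset.sum_congr rfl fun i _ => (ih i (h i)).1).trans
        (Equiv.sum_comp e fun i => (c' i).esize)
    · exact (Finset.sum_congr rfl fun i _ => (ih i (h i)).2).trans
        (Equiv.sum_comp e fun i => (c' i).inner)
  | parallel k c ih =>
    cases D' <;> try exact h.elim
    rename_i c'
    obtain ⟨e, h⟩ := h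
    exact ⟨(Finset.sum_congr rfl fun i _ => (ih i (h i)).1).trans
        (Equiv.sum_comp e fun i => (c' i).esize),
      (Finset.sum_congr rfl fun i _ => (ih i (h i)).2).trans
        (Equiv.sum_comp e fun i => (c' i).inner)⟩

theorem esize_eq_of_shape_eq {D D' : SPTree V} (h : shape D = shape D') : D.esize = D'.esize :=
  (shape_eq_shape.1 h).numbers_eq.1

theorem inner_eq_of_shape_eq {D D' : SPTree V} (h : shape D = shape D') : D.inner = D'.inner :=
  (shape_eq_shape.1 h).numbers_eq.2

theorem mem_verts_node {k : ℕ} {c : Fin k → SPTree V} {v : V} :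
    (v ∈ (series k c).verts ↔ ∃ i, v ∈ (c i).verts) ∧
      (v ∈ (parallel k c).verts ↔ ∃ i, v ∈ (c i).verts) := by
  simp [verts]

theorem mem_verts_iff {D : SPTree V} {v : V} : v ∈ D.verts ↔ ∃ e ∈ D.edges, v ∈ e := by
  induction D with
  | edge a b => simp [verts, edges]
  | series k c ih =>
    simp only [mem_verts_node.1, mem_edges_node.1, ih]
    tauto
  | parallel k c ih =>
    simp only [mem_verts_node.2, mem_edges_node.2, ih]
    tauto

theorem mem_verts_of_mem_edges {D : SPTree V} {u v : V} (h : s(u, v) ∈ D.edges) :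
    u ∈ D.verts ∧ v ∈ D.verts :=
  ⟨mem_verts_iff.2 ⟨_, h, by simp⟩, mem_verts_iff.2 ⟨_, h, by simp⟩⟩

theorem finite_verts (D : SPTree V) : D.verts.Finite := by
  induction D with
  | edge a b => simp [verts]
  | series k c ih => exact Set.finite_iUnion ih
  | parallel k c ih => exact Set.finite_iUnion ih

/-- The properties of the junctions `p` of the S-node with children `c`. -/
structure IsChain {k : ℕ} (c : Fin k → SPTree V) (p : Fin (k + 1) → V) : Prop where
  two_le : 2 ≤ k
  isSP : ∀ i : Fin k, (c i).IsSP (p i.castSucc) (p i.succ)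
  overlap : ∀ i j : Fin k, i < j → ∀ v ∈ (c i).verts, v ∈ (c j).verts →
    (j : ℕ) = (i : ℕ) + 1 ∧ v = p i.succ

/-- The properties of the children `c` of a P-node with terminals `s` and `t`. -/
structure IsBundle {k : ℕ} (c : Fin k → SPTree V) (s t : V) : Prop where
  two_le : 2 ≤ k
  isSP : ∀ i : Fin k, (c i).IsSP s t
  overlap : ∀ i j : Fin k, i ≠ j → ∀ v ∈ (c i).verts, v ∈ (c j).verts → v = s ∨ v = t
  disjoint : ∀ i j : Fin k, i ≠ j → Disjoint (c i).edges (c j).edges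

theorem isSP_series_iff {k : ℕ} {c : Fin k → SPTree V} {s t : V} :
    (series k c).IsSP s t ↔
      ∃ p : Fin (k + 1) → V, p 0 = s ∧ p (Fin.last k) = t ∧ IsChain c p := by
  constructor
  · rintro ⟨hk, p, h0, h1, h2, h3⟩
    exact ⟨p, h0, h1, hk, h2, h3⟩
  · rintro ⟨p, h0, h1, hk, h2, h3⟩
    exact ⟨hk, p, h0, h1, h2, h3⟩

theorem isSP_parallel_iff {k : ℕ} {c : Fin k → SPTree V} {s t : V} :
    (parallel k c).IsSP s t ↔ IsBundle c s t := by
  constructor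
  · rintro ⟨hk, h2, h3⟩
    exact ⟨hk, h2, fun i j h => (h3 i j h).1, fun i j h => (h3 i j h).2⟩
  · rintro ⟨hk, h2, h3, h4⟩
    exact ⟨hk, h2, fun i j h => ⟨h3 i j h, h4 i j h⟩⟩

theorem IsSP.terminals_mem {D : SPTree V} {s t : V} (h : D.IsSP s t) :
    s ∈ D.verts ∧ t ∈ D.verts := by
  induction D generalizing s t with
  | edge a b =>
    obtain ⟨rfl, rfl, -⟩ := h
    simp [verts]
  | series k c ih =>
    obtain ⟨p, rfl, rfl, hc⟩ := isSP_series_iff.1 h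
    have hk := hc.two_le
    constructor
    · exact mem_verts_node.1.2 ⟨⟨0, by omega⟩, (ih _ (hc.isSP _)).1⟩
    · refine mem_verts_node.1.2 ⟨⟨k - 1, by omega⟩, ?_⟩
      convert (ih _ (hc.isSP ⟨k - 1, by omega⟩)).2
      simp only [Fin.ext_iff, Fin.val_last, Fin.val_succ]
      omega
  | parallel k c ih =>
    have hc := isSP_parallel_iff.1 h
    have hk := hc.two_le
    have := ih _ (hc.isSP ⟨0, by omega⟩)
    exact ⟨mem_verts_node.2.2 ⟨_, this.1⟩, mem_verts_node.2.2 ⟨_, this.2⟩⟩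

theorem IsChain.left_mem {k : ℕ} {c : Fin k → SPTree V} {p : Fin (k + 1) → V} (hc : IsChain c p)
    (i : Fin k) : p i.castSucc ∈ (c i).verts :=
  (hc.isSP i).terminals_mem.1

theorem IsChain.right_mem {k : ℕ} {c : Fin k → SPTree V} {p : Fin (k + 1) → V} (hc : IsChain c p)
    (i : Fin k) : p i.succ ∈ (c i).verts :=
  (hc.isSP i).terminals_mem.2

theorem IsSP.ne {D : SPTree V} {s t : V} (h : D.IsSP s t) : s ≠ t := by
  induction D generalizing s t with
  | edge a b => exact h.2.2
  | series k c ih =>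
    obtain ⟨p, rfl, rfl, hc⟩ := isSP_series_iff.1 h
    have hk := hc.two_le
    intro heq
    have h0 := hc.left_mem ⟨0, by omega⟩
    have h1 := hc.right_mem ⟨k - 1, by omega⟩
    have e1 : Fin.succ (⟨k - 1, by omega⟩ : Fin k) = Fin.last k := by
      simp only [Fin.ext_iff, Fin.val_last, Fin.val_succ]; omega
    have e0 : Fin.castSucc (⟨0, by omega⟩ : Fin k) = 0 := rfl
    rw [e1, ← heq] at h1
    have h2 := hc.overlap ⟨0, by omega⟩ ⟨k - 1, by omega⟩ (by simp [Fin.lt_def]; omega) _ h0 h1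
    exact ih _ (hc.isSP ⟨0, by omega⟩) h2.2
  | parallel k c ih =>
    have hc := isSP_parallel_iff.1 h
    have hk := hc.two_le
    exact ih _ (hc.isSP ⟨0, by omega⟩)

theorem IsChain.junction_injective {k : ℕ} {c : Fin k → SPTree V} {p : Fin (k + 1) → V}
    (hc : IsChain c p) : Function.Injective p := by
  have key : ∀ i j : Fin (k + 1), i < j → p i ≠ p j := by
    intro i j hij heq
    have hjk := j.2
    rw [Fin.lt_def] at hij
    obtain ⟨i', rfl⟩ : ∃ i' : Fin k, i = i'.castSucc := ⟨⟨i, by omega⟩, rfl⟩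
    obtain ⟨j', rfl⟩ : ∃ j' : Fin k, j = j'.succ :=
      ⟨⟨j - 1, by omega⟩, by simp only [Fin.ext_iff, Fin.val_succ]; omega⟩
    have h0 := hc.left_mem i'
    have h1 := hc.right_mem j'
    rw [← heq] at h1
    simp only [Fin.val_castSucc, Fin.val_succ] at hij
    rcases Nat.lt_or_ge i' j' with h | h
    · exact (hc.isSP i').ne (hc.overlap i' j' h _ h0 h1).2
    · have : i' = j' := by ext; omega
      subst this
      exact (hc.isSP i').ne heq
  intro i j h
  rcases lt_trichotomy i j with hij | hij | hij
  · exact absurd h (key _ _ hij)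
  · exact hij
  · exact absurd h.symm (key _ _ hij)

theorem IsSP.not_isDiag {D : SPTree V} {s t : V} (h : D.IsSP s t) {e : Sym2 V} (he : e ∈ D.edges) :
    ¬ e.IsDiag := by
  induction D generalizing s t with
  | edge a b =>
    obtain ⟨rfl, rfl, hab⟩ := h
    cases he
    simpa using hab
  | series k c ih =>
    obtain ⟨p, rfl, rfl, hc⟩ := isSP_series_iff.1 h
    obtain ⟨i, hi⟩ := mem_edges_node.1.1 he
    exact ih i (hc.isSP i) hi
  | parallel k c ih =>
    obtain ⟨i, hi⟩ := mem_edges_node.2.1 he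
    exact ih i ((isSP_parallel_iff.1 h).isSP i) hi

theorem IsChain.disjoint_edges {k : ℕ} {c : Fin k → SPTree V} {p : Fin (k + 1) → V}
    (hc : IsChain c p) (i j : Fin k) (hij : i ≠ j) : Disjoint (c i).edges (c j).edges := by
  have key : ∀ i j : Fin k, i < j → Disjoint (c i).edges (c j).edges := by
    intro i j hij
    rw [Set.disjoint_left]
    intro e h1 h2
    induction e using Sym2.ind with
    | _ a b =>
      have ha := hc.overlap i j hij _ (mem_verts_of_mem_edges h1).1 (mem_verts_of_mem_edges h2).1
      have hb := hc.overlap i j hij _ (mem_verts_of_mem_edges h1).2 (mem_verts_of_mem_edges h2).2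
      exact (hc.isSP i).not_isDiag h1 (by simp [ha.2, hb.2])
  rcases lt_or_gt_of_ne hij with h | h
  · exact key _ _ h
  · exact (key _ _ h).symm

theorem IsSP.exists_mem_edges {D : SPTree V} {s t : V} (h : D.IsSP s t) : ∃ e, e ∈ D.edges := by
  obtain ⟨e, he, -⟩ := mem_verts_iff.1 h.terminals_mem.1
  exact ⟨e, he⟩

theorem IsSP.esize_pos {D : SPTree V} {s t : V} (h : D.IsSP s t) : 0 < D.esize := by
  induction D generalizing s t with
  | edge a b => exact Nat.one_pos
  | series k c ih =>
    obtain ⟨p, rfl, rfl, hc⟩ := isSP_series_iff.1 h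
    have hk := hc.two_le
    exact Finset.sum_pos (fun i _ => ih i (hc.isSP i)) ⟨⟨0, by omega⟩, by simp⟩
  | parallel k c ih =>
    have hc := isSP_parallel_iff.1 h
    have hk := hc.two_le
    exact Finset.sum_pos (fun i _ => ih i (hc.isSP i)) ⟨⟨0, by omega⟩, by simp⟩

/-- The number of vertices of a series-parallel graph is `inner + 2`. -/
theorem IsSP.ncard_verts {D : SPTree V} {s t : V} (h : D.IsSP s t) :
    D.verts.ncard = D.inner + 2 := by
  have hs : ∀ {D : SPTree V} {s t : V}, D.IsSP s t → (D.verts \ {s}).ncard + 1 = D.verts.ncard :=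
    fun {D s t} h => Set.ncard_sdiff_singleton_add_one h.terminals_mem.1 D.finite_verts
  have hst : ∀ {D : SPTree V} {s t : V}, D.IsSP s t →
      (D.verts \ {s, t}).ncard + 2 = D.verts.ncard := fun {D s t} h => by
    rw [← Set.ncard_pair h.ne]
    refine Set.ncard_sdiff_add_ncard_of_subset ?_ D.finite_verts
    rintro v (rfl | rfl)
    exacts [h.terminals_mem.1, h.terminals_mem.2]
  induction D generalizing s t with
  | edge a b =>
    obtain ⟨rfl, rfl, hab⟩ := h
    exact Set.ncard_pair hab
  | series k c ih =>
    rw [← hs h]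
    obtain ⟨p, rfl, rfl, hc⟩ := isSP_series_iff.1 h
    have hk := hc.two_le
    have h1 : (series k c).verts \ {p 0} = ⋃ i, (c i).verts \ {p i.castSucc} := by
      ext v
      simp only [Set.mem_sdiff, mem_verts_node.1, Set.mem_singleton_iff, Set.mem_iUnion]
      constructor
      · rintro ⟨⟨i, hi⟩, hv⟩
        by_cases h2 : v = p i.castSucc
        · have hi0 : (i : ℕ) ≠ 0 := by
            intro h0
            exact hv (h2.trans (congrArg p (Fin.ext h0)))
          have h3 := hc.right_mem ⟨i - 1, by omega⟩
          have h4 : Fin.succ (⟨i - 1, by omega⟩ : Fin k) = i.castSucc := by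
            simp only [Fin.ext_iff, Fin.val_succ, Fin.val_castSucc]; omega
          rw [h4] at h3
          refine ⟨⟨i - 1, by omega⟩, h2 ▸ h3, fun h5 => ?_⟩
          have h6 := hc.junction_injective (h2.symm.trans h5)
          simp only [Fin.ext_iff, Fin.val_castSucc] at h6
          omega
        · exact ⟨i, hi, h2⟩
      · rintro ⟨i, hi, hv⟩
        refine ⟨⟨i, hi⟩, ?_⟩
        rintro rfl
        rcases Nat.eq_zero_or_pos i with h0 | h0
        · exact hv (congrArg p (Fin.ext h0.symm))
        · have h2 := hc.overlap ⟨0, by omega⟩ i h0 _ (hc.left_mem ⟨0, by omega⟩) hi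
          have h3 := hc.junction_injective h2.2
          simp [Fin.ext_iff] at h3
    have h2 : Pairwise (Function.onFun Disjoint fun i => (c i).verts \ {p i.castSucc}) := by
      have key : ∀ i j : Fin k, i < j →
          Disjoint ((c i).verts \ {p i.castSucc}) ((c j).verts \ {p j.castSucc}) := by
        intro i j hij
        rw [Set.disjoint_left]
        rintro v ⟨hi, -⟩ ⟨hj, hv⟩
        obtain ⟨h3, h4⟩ := hc.overlap i j hij v hi hj
        exact hv (h4.trans (congrArg p (Fin.ext (by simp [h3]))))
      intro i j hij
      rcases lt_or_gt_of_ne hij with h | h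
      · exact key _ _ h
      · exact (key _ _ h).symm
    rw [h1, Set.ncard_iUnion_of_finite (fun i => (c i).finite_verts.sdiff) h2,
      finsum_eq_sum_of_fintype]
    have h3 : ∀ i, ((c i).verts \ {p i.castSucc}).ncard = (c i).inner + 1 := fun i => by
      have := hs (hc.isSP i)
      rw [ih i (hc.isSP i)] at this
      omega
    simp only [h3, inner, Finset.sum_add_distrib, Finset.sum_const, Finset.card_univ,
      Fintype.card_fin, smul_eq_mul, mul_one]
    omega
  | parallel k c ih =>
    rw [← hst h]
    have hc := isSP_parallel_iff.1 h
    have h1 : (parallel k c).verts \ {s, t} = ⋃ i, (c i).verts \ {s, t} := by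
      ext v
      simp only [Set.mem_sdiff, mem_verts_node.2, Set.mem_iUnion]
      tauto
    have h2 : Pairwise (Function.onFun Disjoint fun i => (c i).verts \ {s, t}) := by
      intro i j hij
      rw [Function.onFun, Set.disjoint_left]
      rintro v ⟨hi, hv⟩ ⟨hj, -⟩
      exact hv (hc.overlap i j hij v hi hj)
    rw [h1, Set.ncard_iUnion_of_finite (fun i => (c i).finite_verts.sdiff) h2,
      finsum_eq_sum_of_fintype]
    have h3 : ∀ i, ((c i).verts \ {s, t}).ncard = (c i).inner := fun i => by
      have := hst (hc.isSP i)
      rw [ih i (hc.isSP i)] at this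
      omega
    simp only [h3, inner]

/-- At most one child of a P-node is an edge. -/
theorem IsBundle.eq_of_edge {k : ℕ} {c : Fin k → SPTree V} {s t : V} (hc : IsBundle c s t)
    {i j : Fin k} {u v u' v' : V} (hi : c i = edge u v) (hj : c j = edge u' v') : i = j := by
  by_contra hij
  have h1 := hc.isSP i
  have h2 := hc.isSP j
  have h3 := hc.disjoint i j hij
  rw [hi] at h1 h3
  rw [hj] at h2 h3
  obtain ⟨rfl, rfl, -⟩ := h1
  obtain ⟨rfl, rfl, -⟩ := h2
  simp [edges] at h3

/-- A series-parallel graph is sparse. -/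
theorem IsSP.esize_le {D : SPTree V} {s t : V} (h : D.IsSP s t) (ha : D.Alternating) :
    D.esize ≤ 2 * D.inner + 1 ∧ (D.IsSeries → D.esize ≤ 2 * D.inner) := by
  induction D generalizing s t with
  | edge a b => simp [esize, IsSeries]
  | series k c ih =>
    obtain ⟨p, rfl, rfl, hc⟩ := isSP_series_iff.1 h
    have hk := hc.two_le
    have h1 : ∑ i, (c i).esize ≤ ∑ i, (2 * (c i).inner + 1) :=
      Finset.sum_le_sum fun i _ => (ih i (hc.isSP i) (ha i).2).1
    rw [Finset.sum_add_distrib, ← Finset.mul_sum] at h1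
    simp only [Finset.sum_const, Finset.card_univ, Fintype.card_fin, smul_eq_mul, mul_one] at h1
    simp only [esize, inner]
    omega
  | parallel k c ih =>
    classical
    have hc := isSP_parallel_iff.1 h
    have h1 : ∀ i, (c i).esize ≤ 2 * (c i).inner + if ∃ u v, c i = edge u v then 1 else 0 := by
      intro i
      have hi := ih i (hc.isSP i) (ha i).2
      have hp := (ha i).1
      split_ifs with he
      · exact hi.1
      · refine hi.2 ?_
        match hci : c i with
        | edge u v => exact absurd ⟨u, v, hci⟩ he
        | series _ _ => trivial
        | parallel _ _ => rw [hci] at hp; exact absurd trivial hp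
    have h2 := Finset.sum_le_sum fun i (_ : i ∈ Finset.univ) => h1 i
    rw [Finset.sum_add_distrib, ← Finset.mul_sum, Finset.sum_boole] at h2
    have h3 : (Finset.univ.filter fun i => ∃ u v, c i = edge u v).card ≤ 1 := by
      refine Finset.card_le_one.2 fun i hi j hj => ?_
      simp only [Finset.mem_filter] at hi hj
      obtain ⟨-, u, v, hi⟩ := hi
      obtain ⟨-, u', v', hj⟩ := hj
      exact hc.eq_of_edge hi hj
    simp only [esize, inner, IsSeries, false_imp_iff, and_true, Nat.cast_id] at h2 ⊢
    omega

/-! ### Isomorphisms -/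

/-- The vertex map `φ` is an isomorphism of decomposition trees from `D` to `D'`. -/
def IsoVia (φ : V → V) (D D' : SPTree V) : Prop :=
  Match (fun u v u' v' => φ u = u' ∧ φ v = v') D D'

theorem IsoVia.congr {φ ψ : V → V} {D D' : SPTree V} (h : IsoVia φ D D')
    (hφ : ∀ v ∈ D.verts, ψ v = φ v) : IsoVia ψ D D' :=
  Match.imp h fun u v u' v' hu _ h => by
    rw [hφ u (mem_verts_of_mem_edges hu).1, hφ v (mem_verts_of_mem_edges hu).2]
    exact h

theorem IsoVia.terminals {φ : V → V} {D D' : SPTree V} (h : IsoVia φ D D') {s t s' t' : V}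
    (hD : D.IsSP s t) (hD' : D'.IsSP s' t') : φ s = s' ∧ φ t = t' := by
  induction D generalizing D' s t s' t' with
  | edge u v =>
    cases D' <;> try exact h.elim
    obtain ⟨rfl, rfl, -⟩ := hD
    obtain ⟨rfl, rfl, -⟩ := hD'
    exact h
  | series k c ih =>
    cases D' <;> try exact h.elim
    obtain ⟨e, he, h⟩ := h
    have hk := Fin.equiv_iff_eq.1 ⟨e⟩
    subst hk
    rw [fin_equiv_eq_of_val he] at h
    obtain ⟨p, rfl, rfl, hc⟩ := isSP_series_iff.1 hD
    obtain ⟨p', rfl, rfl, hc'⟩ := isSP_series_iff.1 hD'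
    have hk := hc.two_le
    have h0 := (ih ⟨0, by omega⟩ (h _) (hc.isSP _) (hc'.isSP _)).1
    have h1 := (ih ⟨k - 1, by omega⟩ (h _) (hc.isSP _) (hc'.isSP _)).2
    have e1 : Fin.succ (⟨k - 1, by omega⟩ : Fin k) = Fin.last k := by
      simp only [Fin.ext_iff, Fin.val_last, Fin.val_succ]; omega
    simp only [Equiv.refl_apply, e1] at h1
    exact ⟨h0, h1⟩
  | parallel k c ih =>
    cases D' <;> try exact h.elim
    obtain ⟨e, h⟩ := h
    have hc := isSP_parallel_iff.1 hD
    have hc' := isSP_parallel_iff.1 hD'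
    have hk := hc.two_le
    exact ih ⟨0, by omega⟩ (h _) (hc.isSP _) (hc'.isSP _)

theorem IsoVia.map_mem_edges {φ : V → V} {D D' : SPTree V} (h : IsoVia φ D D') {e : Sym2 V}
    (he : e ∈ D.edges) : e.map φ ∈ D'.edges := by
  induction D generalizing D' with
  | edge u v =>
    cases D' <;> try exact h.elim
    obtain ⟨rfl, rfl⟩ := h
    cases he
    rfl
  | series k c ih =>
    cases D' <;> try exact h.elim
    obtain ⟨e', -, h⟩ := h
    obtain ⟨i, hi⟩ := mem_edges_node.1.1 he
    exact mem_edges_node.1.2 ⟨_, ih i (h i) hi⟩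
  | parallel k c ih =>
    cases D' <;> try exact h.elim
    obtain ⟨e', h⟩ := h
    obtain ⟨i, hi⟩ := mem_edges_node.2.1 he
    exact mem_edges_node.2.2 ⟨_, ih i (h i) hi⟩

theorem IsoVia.exists_of_mem_edges {φ : V → V} {D D' : SPTree V} (h : IsoVia φ D D') {e' : Sym2 V}
    (he : e' ∈ D'.edges) : ∃ e ∈ D.edges, e.map φ = e' := by
  induction D generalizing D' with
  | edge u v =>
    cases D' <;> try exact h.elim
    obtain ⟨rfl, rfl⟩ := h
    cases he
    exact ⟨_, rfl, rfl⟩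
  | series k c ih =>
    cases D' <;> try exact h.elim
    obtain ⟨e', -, h⟩ := h
    obtain ⟨i, hi⟩ := mem_edges_node.1.1 he
    obtain ⟨e, h1, h2⟩ := ih _ (h (e'.symm i)) (by simpa using hi)
    exact ⟨e, mem_edges_node.1.2 ⟨_, h1⟩, h2⟩
  | parallel k c ih =>
    cases D' <;> try exact h.elim
    obtain ⟨e', h⟩ := h
    obtain ⟨i, hi⟩ := mem_edges_node.2.1 he
    obtain ⟨e, h1, h2⟩ := ih _ (h (e'.symm i)) (by simpa using hi)
    exact ⟨e, mem_edges_node.2.2 ⟨_, h1⟩, h2⟩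

theorem IsoVia.image_verts {φ : V → V} {D D' : SPTree V} (h : IsoVia φ D D') :
    φ '' D.verts = D'.verts := by
  ext w
  simp only [Set.mem_image, mem_verts_iff]
  constructor
  · rintro ⟨v, ⟨e, he, hv⟩, rfl⟩
    exact ⟨_, h.map_mem_edges he, Sym2.mem_map.2 ⟨v, hv, rfl⟩⟩
  · rintro ⟨e', he', hw⟩
    obtain ⟨e, he, rfl⟩ := h.exists_of_mem_edges he'
    obtain ⟨v, hv, rfl⟩ := Sym2.mem_map.1 hw
    exact ⟨v, ⟨e, he, hv⟩, rfl⟩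

/-- An isomorphism of decomposition trees is injective, because both graphs have the same number
of vertices. -/
theorem IsoVia.injOn {φ : V → V} {D D' : SPTree V} (h : IsoVia φ D D') {s t s' t' : V}
    (hD : D.IsSP s t) (hD' : D'.IsSP s' t') : Set.InjOn φ D.verts := by
  refine Set.injOn_of_ncard_image_eq ?_ D.finite_verts
  rw [h.image_verts, hD.ncard_verts, hD'.ncard_verts, Match.numbers_eq h |>.2]

theorem IsoVia.map_mem_iff {φ : V → V} {D D' : SPTree V} (h : IsoVia φ D D') {s t s' t' : V}
    (hD : D.IsSP s t) (hD' : D'.IsSP s' t') {F : Set (Sym2 V)} (hF : F ⊆ D.edges) {e : Sym2 V}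
    (he : e ∈ D.edges) : e.map φ ∈ Sym2.map φ '' F ↔ e ∈ F := by
  refine ⟨?_, fun h => ⟨e, h, rfl⟩⟩
  rintro ⟨e', he', heq⟩
  have hinj := h.injOn hD hD'
  have he'D := hF he'
  induction e using Sym2.ind with
  | _ a b =>
    induction e' using Sym2.ind with
    | _ a' b' =>
      obtain ⟨ha, hb⟩ := mem_verts_of_mem_edges he
      obtain ⟨ha', hb'⟩ := mem_verts_of_mem_edges he'D
      simp only [Sym2.map_mk, Sym2.eq_iff] at heq
      rcases heq with ⟨h1, h2⟩ | ⟨h1, h2⟩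
      · rwa [← hinj ha' ha h1, ← hinj hb' hb h2]
      · rw [Sym2.eq_swap]
        rwa [← hinj ha' hb h1, ← hinj hb' ha h2]

/-- Moving a set of edges along an isomorphism does not change its type. -/
theorem IsoVia.ty_image {φ : V → V} {D D' : SPTree V} (h : IsoVia φ D D') {s t s' t' : V}
    (hD : D.IsSP s t) (hD' : D'.IsSP s' t') {F : Set (Sym2 V)} (hF : F ⊆ D.edges) :
    ty D' (Sym2.map φ '' F) = ty D F := by
  refine (ty_eq_ty.2 (Match.imp h ?_)).symm
  rintro u v _ _ hu - ⟨rfl, rfl⟩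
  exact (h.map_mem_iff hD hD' hF hu).symm

/-- Vertex maps of the children of an S-node that agree on the junctions can be glued. -/
theorem IsChain.exists_glue {k : ℕ} {c : Fin k → SPTree V} {p : Fin (k + 1) → V}
    (hc : IsChain c p) {W : Type*} {φ : Fin k → V → W} {p' : Fin (k + 1) → W}
    (h : ∀ i, φ i (p i.castSucc) = p' i.castSucc ∧ φ i (p i.succ) = p' i.succ) :
    ∃ ψ : V → W, ∀ i, ∀ v ∈ (c i).verts, ψ v = φ i v := by
  classical
  have key : ∀ i j, ∀ v ∈ (c i).verts, v ∈ (c j).verts → i < j → φ i v = φ j v := by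
    intro i j v hi hj hij
    obtain ⟨h1, rfl⟩ := hc.overlap i j hij v hi hj
    have h2 : i.succ = j.castSucc := Fin.ext (by simp [h1])
    rw [(h i).2, h2, (h j).1]
  have hk := hc.two_le
  refine ⟨fun v => φ (if hv : ∃ i, v ∈ (c i).verts then hv.choose else ⟨0, by omega⟩) v,
    fun i v hv => ?_⟩
  have hex : ∃ i, v ∈ (c i).verts := ⟨i, hv⟩
  simp only [hex, dite_true]
  rcases lt_trichotomy hex.choose i with h1 | h1 | h1
  · exact key _ _ v hex.choose_spec hv h1
  · rw [h1]
  · exact (key _ _ v hv hex.choose_spec h1).symm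

/-- Vertex maps of the children of a P-node that agree on the terminals can be glued. -/
theorem IsBundle.exists_glue {k : ℕ} {c : Fin k → SPTree V} {s t : V}
    (hc : IsBundle c s t) {W : Type*} {φ : Fin k → V → W} {s' t' : W}
    (h : ∀ i, φ i s = s' ∧ φ i t = t') :
    ∃ ψ : V → W, ∀ i, ∀ v ∈ (c i).verts, ψ v = φ i v := by
  classical
  have hk := hc.two_le
  refine ⟨fun v => φ (if hv : ∃ i, v ∈ (c i).verts then hv.choose else ⟨0, by omega⟩) v,
    fun i v hv => ?_⟩
  have hex : ∃ i, v ∈ (c i).verts := ⟨i, hv⟩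
  simp only [hex, dite_true]
  by_cases h1 : hex.choose = i
  · rw [h1]
  · rcases hc.overlap _ _ h1 v hex.choose_spec hv with rfl | rfl
    · rw [(h _).1, (h _).1]
    · rw [(h _).2, (h _).2]

/-- Every matching of two series-parallel graphs is induced by a vertex map. -/
theorem Match.exists_isoVia {r : V → V → V → V → Prop} {D D' : SPTree V} (h : Match r D D')
    {s t s' t' : V} (hD : D.IsSP s t) (hD' : D'.IsSP s' t') :
    ∃ φ : V → V, Match (fun u v u' v' => r u v u' v' ∧ φ u = u' ∧ φ v = v') D D' := by
  classical
  have hiso : ∀ {φ : V → V} {D D' : SPTree V},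
      Match (fun u v u' v' => r u v u' v' ∧ φ u = u' ∧ φ v = v') D D' → IsoVia φ D D' :=
    fun h => Match.imp h fun _ _ _ _ _ _ h => h.2
  have hcongr : ∀ {φ ψ : V → V} {D D' : SPTree V}, (∀ v ∈ D.verts, ψ v = φ v) →
      Match (fun u v u' v' => r u v u' v' ∧ φ u = u' ∧ φ v = v') D D' →
      Match (fun u v u' v' => r u v u' v' ∧ ψ u = u' ∧ ψ v = v') D D' := fun hφ h =>
    Match.imp h fun u v u' v' hu _ h => by
      rwa [hφ u (mem_verts_of_mem_edges hu).1, hφ v (mem_verts_of_mem_edges hu).2]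
  induction D generalizing D' s t s' t' with
  | edge u v =>
    cases D' <;> try exact h.elim
    rename_i u' v'
    obtain ⟨rfl, rfl, huv⟩ := hD
    exact ⟨fun w => if w = u then u' else v', h, by simp, by simp [huv.symm]⟩
  | series k c ih =>
    cases D' <;> try exact h.elim
    obtain ⟨e, he, h⟩ := h
    have hk := Fin.equiv_iff_eq.1 ⟨e⟩
    subst hk
    rw [fin_equiv_eq_of_val he] at h
    obtain ⟨p, rfl, rfl, hc⟩ := isSP_series_iff.1 hD
    obtain ⟨p', rfl, rfl, hc'⟩ := isSP_series_iff.1 hD'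
    choose φ hφ using fun i => ih i (h i) (hc.isSP i) (hc'.isSP i)
    obtain ⟨ψ, hψ⟩ := hc.exists_glue (φ := φ) (p' := p') fun i =>
      (hiso (hφ i)).terminals (hc.isSP i) (hc'.isSP i)
    exact ⟨ψ, Equiv.refl _, fun _ => rfl, fun i => hcongr (hψ i) (hφ i)⟩
  | parallel k c ih =>
    cases D' <;> try exact h.elim
    obtain ⟨e, h⟩ := h
    have hc := isSP_parallel_iff.1 hD
    have hc' := isSP_parallel_iff.1 hD'
    choose φ hφ using fun i => ih i (h i) (hc.isSP i) (hc'.isSP _)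
    obtain ⟨ψ, hψ⟩ := hc.exists_glue (φ := φ) fun i =>
      (hiso (hφ i)).terminals (hc.isSP i) (hc'.isSP _)
    exact ⟨ψ, e, fun i => hcongr (hψ i) (hφ i)⟩

end SPTree

/-! ### The isomorphism test -/

namespace SPTree

open Timed

universe u

variable {V : Type u}

/-- The total number of nodes of a decomposition tree. -/
def nsize : SPTree V → ℕ
  | edge _ _ => 1
  | series _ c => 1 + ∑ i, (c i).nsize
  | parallel _ c => 1 + ∑ i, (c i).nsize

theorem nsize_pos (D : SPTree V) : 0 < D.nsize := by
  cases D <;> simp only [nsize] <;> omega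

/-- As every inner node has at least two children, edge nodes make up more than half of the
nodes. -/
theorem IsSP.nsize_lt {D : SPTree V} {s t : V} (h : D.IsSP s t) : D.nsize < 2 * D.esize := by
  induction D generalizing s t with
  | edge a b => simp [nsize, esize]
  | series k c ih =>
    obtain ⟨p, rfl, rfl, hc⟩ := isSP_series_iff.1 h
    have hk := hc.two_le
    have h1 : ∑ i, ((c i).nsize + 1) ≤ ∑ i, 2 * (c i).esize :=
      Finset.sum_le_sum fun i _ => ih i (hc.isSP i)
    rw [Finset.sum_add_distrib, ← Finset.mul_sum] at h1
    simp only [Finset.sum_const, Finset.card_univ, Fintype.card_fin, smul_eq_mul, mul_one] at h1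
    simp only [esize, nsize]
    omega
  | parallel k c ih =>
    have hc := isSP_parallel_iff.1 h
    have hk := hc.two_le
    have h1 : ∑ i, ((c i).nsize + 1) ≤ ∑ i, 2 * (c i).esize :=
      Finset.sum_le_sum fun i _ => ih i (hc.isSP i)
    rw [Finset.sum_add_distrib, ← Finset.mul_sum] at h1
    simp only [Finset.sum_const, Finset.card_univ, Fintype.card_fin, smul_eq_mul, mul_one] at h1
    simp only [esize, nsize]
    omega

/-- A procedure that compares a fixed tree with another one. -/
abbrev Row (V : Type u) : Type u := SPTree V → Timed (Option (List (V × V)))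

theorem matchSeries_cons (row : Row V) (rows : List (Row V)) (y : SPTree V) (ys : List (SPTree V)) :
    matchSeries (row :: rows) (y :: ys) = (do
      tick 1
      match ← row y with
      | none => pure none
      | some π => do
        match ← matchSeries rows ys with
        | none => pure none
        | some π' => do
          let l ← append π π'
          pure (some l)) := rfl

theorem matchParallel_cons (row : Row V) (rows : List (Row V)) (ys : List (SPTree V)) :
    matchParallel (row :: rows) ys = (do
      tick 1
      match ← matchFirst row ys with
      | none => pure none
      | some (π, rest) => do
        match ← matchParallel rows rest with
        | none => pure none
        | some π' => do
          let l ← append π π'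
          pure (some l)) := by
  cases ys <;> rfl

/-- The outcome of a successful comparison of the trees `as` with the trees `ys`, which have been
arranged in the order of `ps`; the second entries of `ps` are the partial vertex maps. -/
def Matched (as : List (SPTree V)) (ps : List (SPTree V × List (V × V))) (π : List (V × V)) :
    Prop :=
  List.Forall₂ (fun a x => (isoTest a x.1).val = some x.2) as ps ∧ ∀ q, q ∈ π ↔ ∃ x ∈ ps, q ∈ x.2

theorem Matched.cons {a : SPTree V} {as : List (SPTree V)} {y : SPTree V}
    {ps : List (SPTree V × List (V × V))} {π π' : List (V × V)}
    (ha : (isoTest a y).val = some π) (h : Matched as ps π') :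
    Matched (a :: as) ((y, π) :: ps) (π ++ π') :=
  ⟨List.Forall₂.cons ha h.1, by simp [h.2]⟩

theorem matched_of_matchSeries {as ys : List (SPTree V)} {π : List (V × V)}
    (h : (matchSeries (as.map isoTest) ys).val = some π) :
    ∃ ps, Matched as ps π ∧ ps.map Prod.fst = ys := by
  induction as generalizing ys π with
  | nil =>
    cases ys with
    | nil =>
      simp [matchSeries] at h
      subst h
      exact ⟨[], ⟨List.Forall₂.nil, by simp⟩, rfl⟩
    | cons y ys => simp [matchSeries] at h
  | cons a as ih =>
    cases ys with
    | nil => simp [matchSeries] at h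
    | cons y ys =>
      rw [List.map_cons, matchSeries_cons] at h
      simp only [bind_val] at h
      rcases h1 : (isoTest a y).val with _ | π₁
      · simp [h1] at h
      · simp only [h1, bind_val] at h
        rcases h2 : (matchSeries (as.map isoTest) ys).val with _ | π₂
        · simp [h2] at h
        · simp only [h2, bind_val, append_val, pure_val, Option.some.injEq] at h
          subst h
          obtain ⟨ps, h3, h4⟩ := ih h2
          exact ⟨_, h3.cons h1, by simp [h4]⟩

theorem matchFirst_eq_some {row : Row V} {ys rest : List (SPTree V)} {π : List (V × V)}
    (h : (matchFirst row ys).val = some (π, rest)) :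
    ∃ y, (row y).val = some π ∧ ys.Perm (y :: rest) := by
  induction ys generalizing rest with
  | nil => simp [matchFirst] at h
  | cons y ys ih =>
    simp only [matchFirst, bind_val] at h
    rcases h1 : (row y).val with _ | π₁
    · simp only [h1, bind_val] at h
      rcases h2 : (matchFirst row ys).val with _ | ⟨π₂, rest'⟩
      · simp [h2] at h
      · simp only [h2, pure_val, Option.some.injEq, Prod.mk.injEq] at h
        obtain ⟨rfl, rfl⟩ := h
        obtain ⟨z, h3, h4⟩ := ih h2
        exact ⟨z, h3, (h4.cons y).trans (List.Perm.swap z y rest')⟩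
    · simp only [h1, pure_val, Option.some.injEq, Prod.mk.injEq] at h
      obtain ⟨rfl, rfl⟩ := h
      exact ⟨y, h1, List.Perm.refl _⟩

theorem matchFirst_eq_none {row : Row V} {ys : List (SPTree V)}
    (h : (matchFirst row ys).val = none) : ∀ y ∈ ys, (row y).val = none := by
  induction ys with
  | nil => simp
  | cons y ys ih =>
    simp only [matchFirst, bind_val] at h
    rcases h1 : (row y).val with _ | π₁
    · simp only [h1, bind_val] at h
      rcases h2 : (matchFirst row ys).val with _ | ⟨π₂, rest'⟩
      · rintro z hz
        rcases List.mem_cons.1 hz with rfl | hz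
        · exact h1
        · exact ih h2 z hz
      · simp [h2] at h
    · simp [h1] at h

theorem matched_of_matchParallel {as ys : List (SPTree V)} {π : List (V × V)}
    (h : (matchParallel (as.map isoTest) ys).val = some π) :
    ∃ ps, Matched as ps π ∧ (ps.map Prod.fst).Perm ys := by
  induction as generalizing ys π with
  | nil =>
    cases ys with
    | nil =>
      simp [matchParallel] at h
      subst h
      exact ⟨[], ⟨List.Forall₂.nil, by simp⟩, List.Perm.refl _⟩
    | cons y ys => simp [matchParallel] at h
  | cons a as ih =>
    rw [List.map_cons, matchParallel_cons] at h
    simp only [bind_val] at h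
    rcases h1 : (matchFirst (isoTest a) ys).val with _ | ⟨π₁, rest⟩
    · simp [h1] at h
    · simp only [h1, bind_val] at h
      rcases h2 : (matchParallel (as.map isoTest) rest).val with _ | π₂
      · simp [h2] at h
      · simp only [h2, bind_val, append_val, pure_val, Option.some.injEq] at h
        subst h
        obtain ⟨ps, h3, h4⟩ := ih h2
        obtain ⟨y, h5, h6⟩ := matchFirst_eq_some h1
        exact ⟨_, h3.cons h5, (h4.cons y).trans h6.symm⟩

/-- The comparison of lists of trees succeeds whenever the shapes agree, if this holds for the
comparison of single trees. -/
theorem matchSeries_isSome {as ys : List (SPTree V)}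
    (ha : ∀ a ∈ as, ∀ y, shape a = shape y → (isoTest a y).val ≠ none)
    (h : as.map shape = ys.map shape) : (matchSeries (as.map isoTest) ys).val ≠ none := by
  induction as generalizing ys with
  | nil =>
    cases ys with
    | nil => simp [matchSeries]
    | cons y ys => simp at h
  | cons a as ih =>
    cases ys with
    | nil => simp at h
    | cons y ys =>
      rw [List.map_cons, List.map_cons, List.cons.injEq] at h
      rw [List.map_cons, matchSeries_cons]
      simp only [bind_val]
      have h1 := ha a (by simp) y h.1
      have h2 := ih (fun a' h' => ha a' (by simp [h'])) h.2
      rcases h3 : (isoTest a y).val with _ | π₁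
      · exact absurd h3 h1
      rcases h4 : (matchSeries (as.map isoTest) ys).val with _ | π₂
      · exact absurd h4 h2
      simp [h4]

/-- The greedy comparison in any order succeeds whenever the multisets of shapes agree, if the
comparison of single trees accepts exactly the trees of equal shape. -/
theorem matchParallel_isSome {as ys : List (SPTree V)}
    (ha : ∀ a ∈ as, ∀ y, (isoTest a y).val ≠ none ↔ shape a = shape y)
    (h : (as.map shape).Perm (ys.map shape)) :
    (matchParallel (as.map isoTest) ys).val ≠ none := by
  induction as generalizing ys with
  | nil =>
    cases ys with
    | nil => simp [matchParallel]
    | cons y ys => simp at h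
  | cons a as ih =>
    rw [List.map_cons, matchParallel_cons]
    simp only [bind_val]
    rcases h1 : (matchFirst (isoTest a) ys).val with _ | ⟨π₁, rest⟩
    · have h2 := h.subset (List.mem_cons_self)
      obtain ⟨y, hy, hya⟩ := List.mem_map.1 h2
      exact absurd (matchFirst_eq_none h1 y hy) ((ha a (by simp) y).2 hya.symm)
    · obtain ⟨y, h2, h3⟩ := matchFirst_eq_some h1
      have h4 : shape a = shape y := (ha a (by simp) y).1 (by simp [h2])
      have h5 : (as.map shape).Perm (rest.map shape) := by
        have h6 := h.trans (h3.map shape)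
        rw [List.map_cons, List.map_cons, ← h4] at h6
        exact h6.cons_inv
      have h7 := ih (fun a' h' => ha a' (by simp [h'])) h5
      rcases h8 : (matchParallel (as.map isoTest) rest).val with _ | π₂
      · exact absurd h8 h7
      simp [h8]

theorem isoTest_series {k k' : ℕ} (c : Fin k → SPTree V) (c' : Fin k' → SPTree V) :
    isoTest (series k c) (series k' c') = (do
      tick 1
      matchSeries ((List.ofFn c).map isoTest) (List.ofFn c')) := by
  rw [List.map_ofFn]
  rfl

theorem isoTest_parallel {k k' : ℕ} (c : Fin k → SPTree V) (c' : Fin k' → SPTree V) :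
    isoTest (parallel k c) (parallel k' c') = (do
      tick 1
      matchParallel ((List.ofFn c).map isoTest) (List.ofFn c')) := by
  rw [List.map_ofFn]
  rfl

theorem Matched.get {k : ℕ} {c : Fin k → SPTree V} {ps : List (SPTree V × List (V × V))}
    {π : List (V × V)} (h : Matched (List.ofFn c) ps π) :
    ∃ q : Fin k → SPTree V × List (V × V), ps = List.ofFn q ∧
      (∀ i, (isoTest (c i) (q i).1).val = some (q i).2) ∧ ∀ x, x ∈ π ↔ ∃ i, x ∈ (q i).2 := by
  obtain ⟨h1, h2⟩ := h
  have hl := h1.length_eq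
  rw [List.length_ofFn] at hl
  subst hl
  refine ⟨ps.get, (List.ofFn_get ps).symm, fun i => ?_, fun x => ?_⟩
  · have h3 := (List.forall₂_iff_get.1 h1).2 i (by simp) i.2
    simpa using h3
  · rw [h2]
    simp only [List.mem_iff_get]
    constructor
    · rintro ⟨_, ⟨i, rfl⟩, hx⟩
      exact ⟨i, hx⟩
    · rintro ⟨i, hx⟩
      exact ⟨_, ⟨i, rfl⟩, hx⟩

/-- What a successful test amounts to at an S-node. -/
theorem isoTest_series_eq_some {k k' : ℕ} {c : Fin k → SPTree V} {c' : Fin k' → SPTree V}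
    {π : List (V × V)} (h : (isoTest (series k c) (series k' c')).val = some π) :
    ∃ (e : Fin k ≃ Fin k') (πs : Fin k → List (V × V)), (∀ i, (e i : ℕ) = i) ∧
      (∀ i, (isoTest (c i) (c' (e i))).val = some (πs i)) ∧ ∀ x, x ∈ π ↔ ∃ i, x ∈ πs i := by
  rw [isoTest_series] at h
  obtain ⟨ps, h1, h2⟩ := matched_of_matchSeries h
  obtain ⟨q, rfl, h4, h5⟩ := h1.get
  have hk := congrArg List.length h2
  rw [List.length_map, List.length_ofFn, List.length_ofFn] at hk
  subst hk
  rw [List.map_ofFn, List.ofFn_inj] at h2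
  subst h2
  exact ⟨Equiv.refl _, _, fun _ => rfl, h4, h5⟩

/-- What a successful test amounts to at a P-node. -/
theorem isoTest_parallel_eq_some {k k' : ℕ} {c : Fin k → SPTree V} {c' : Fin k' → SPTree V}
    {π : List (V × V)} (h : (isoTest (parallel k c) (parallel k' c')).val = some π) :
    ∃ (e : Fin k ≃ Fin k') (πs : Fin k → List (V × V)),
      (∀ i, (isoTest (c i) (c' (e i))).val = some (πs i)) ∧ ∀ x, x ∈ π ↔ ∃ i, x ∈ πs i := by
  rw [isoTest_parallel] at h
  obtain ⟨ps, h1, h2⟩ := matched_of_matchParallel h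
  obtain ⟨q, rfl, h4, h5⟩ := h1.get
  rw [List.map_ofFn, ← Multiset.coe_eq_coe, ← Fin.univ_val_map, ← Fin.univ_val_map,
    ← exists_equiv_iff_map_univ_eq] at h2
  obtain ⟨e, he⟩ := h2
  refine ⟨e, _, fun i => ?_, h5⟩
  rw [← he i]
  exact h4 i

theorem isoTest_ne_none_iff {D D' : SPTree V} : (isoTest D D').val ≠ none ↔ shape D = shape D' := by
  induction D generalizing D' with
  | edge u v =>
    rw [shape_eq_shape]
    cases D' <;> simp [isoTest, Match]
  | series k c ih =>
    rw [shape_eq_shape]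
    cases D' with
    | edge u v => simp [isoTest, Match]
    | parallel _ _ => simp [isoTest, Match]
    | series k' c' =>
      constructor
      · intro h
        obtain ⟨π, hπ⟩ := Option.ne_none_iff_exists'.1 h
        obtain ⟨e, πs, he, h1, -⟩ := isoTest_series_eq_some hπ
        exact ⟨e, he, fun i => shape_eq_shape.1 ((ih i).1 (by simp [h1]))⟩
      · rintro ⟨e, he, h⟩
        have hk := Fin.equiv_iff_eq.1 ⟨e⟩
        subst hk
        rw [fin_equiv_eq_of_val he] at h
        rw [isoTest_series]
        refine matchSeries_isSome ?_ ?_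
        · intro a ha y hy
          obtain ⟨i, rfl⟩ := (List.mem_ofFn' _ _).1 ha
          exact (ih i).2 hy
        · rw [List.map_ofFn, List.map_ofFn]
          exact congrArg _ (funext fun i => shape_eq_shape.2 (h i))
  | parallel k c ih =>
    rw [shape_eq_shape]
    cases D' with
    | edge u v => simp [isoTest, Match]
    | series _ _ => simp [isoTest, Match]
    | parallel k' c' =>
      constructor
      · intro h
        obtain ⟨π, hπ⟩ := Option.ne_none_iff_exists'.1 h
        obtain ⟨e, πs, h1, -⟩ := isoTest_parallel_eq_some hπ
        exact ⟨e, fun i => shape_eq_shape.1 ((ih i).1 (by simp [h1]))⟩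
      · intro h
        rw [isoTest_parallel]
        refine matchParallel_isSome ?_ ?_
        · intro a ha y
          obtain ⟨i, rfl⟩ := (List.mem_ofFn' _ _).1 ha
          exact ih i
        · rw [List.map_ofFn, List.map_ofFn, ← Multiset.coe_eq_coe, ← Fin.univ_val_map,
            ← Fin.univ_val_map]
          exact shape_parallel_eq.1 (shape_eq_shape.2 h)

/-- The pairs returned by the test are the graph of an isomorphism. -/
theorem exists_isoVia_of_isoTest {D D' : SPTree V} {s t s' t' : V} {π : List (V × V)}
    (hD : D.IsSP s t) (hD' : D'.IsSP s' t') (h : (isoTest D D').val = some π) :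
    ∃ φ, IsoVia φ D D' ∧ (∀ x ∈ π, x.1 ∈ D.verts ∧ φ x.1 = x.2) ∧
      ∀ v ∈ D.verts, ∃ x ∈ π, x.1 = v := by
  classical
  induction D generalizing D' s t s' t' π with
  | edge u v =>
    cases D' with
    | series _ _ => simp [isoTest] at h
    | parallel _ _ => simp [isoTest] at h
    | edge u' v' =>
      simp [isoTest] at h
      subst h
      obtain ⟨rfl, rfl, huv⟩ := hD
      exact ⟨fun w => if w = u then u' else v', ⟨by simp, by simp [huv.symm]⟩,
        by simp [huv.symm, verts], by simp [verts]⟩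
  | series k c ih =>
    cases D' with
    | edge _ _ => simp [isoTest] at h
    | parallel _ _ => simp [isoTest] at h
    | series k' c' =>
      obtain ⟨e, πs, he, h1, h2⟩ := isoTest_series_eq_some h
      have hk := Fin.equiv_iff_eq.1 ⟨e⟩
      subst hk
      rw [fin_equiv_eq_of_val he] at h1
      obtain ⟨p, rfl, rfl, hc⟩ := isSP_series_iff.1 hD
      obtain ⟨p', rfl, rfl, hc'⟩ := isSP_series_iff.1 hD'
      choose φ hφ using fun i => ih i (hc.isSP i) (hc'.isSP i) (h1 i)
      obtain ⟨ψ, hψ⟩ := hc.exists_glue (φ := φ) (p' := p') fun i =>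
        (hφ i).1.terminals (hc.isSP i) (hc'.isSP i)
      refine ⟨ψ, ⟨Equiv.refl _, fun _ => rfl, fun i => (hφ i).1.congr (hψ i)⟩, ?_, ?_⟩
      · intro x hx
        obtain ⟨i, hi⟩ := (h2 x).1 hx
        obtain ⟨h3, h4⟩ := (hφ i).2.1 x hi
        exact ⟨mem_verts_node.1.2 ⟨i, h3⟩, (hψ i _ h3).trans h4⟩
      · intro v hv
        obtain ⟨i, hi⟩ := mem_verts_node.1.1 hv
        obtain ⟨x, hx, rfl⟩ := (hφ i).2.2 v hi
        exact ⟨x, (h2 x).2 ⟨i, hx⟩, rfl⟩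
  | parallel k c ih =>
    cases D' with
    | edge _ _ => simp [isoTest] at h
    | series _ _ => simp [isoTest] at h
    | parallel k' c' =>
      obtain ⟨e, πs, h1, h2⟩ := isoTest_parallel_eq_some h
      have hc := isSP_parallel_iff.1 hD
      have hc' := isSP_parallel_iff.1 hD'
      choose φ hφ using fun i => ih i (hc.isSP i) (hc'.isSP _) (h1 i)
      obtain ⟨ψ, hψ⟩ := hc.exists_glue (φ := φ) fun i =>
        (hφ i).1.terminals (hc.isSP i) (hc'.isSP _)
      refine ⟨ψ, ⟨e, fun i => (hφ i).1.congr (hψ i)⟩, ?_, ?_⟩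
      · intro x hx
        obtain ⟨i, hi⟩ := (h2 x).1 hx
        obtain ⟨h3, h4⟩ := (hφ i).2.1 x hi
        exact ⟨mem_verts_node.2.2 ⟨i, h3⟩, (hψ i _ h3).trans h4⟩
      · intro v hv
        obtain ⟨i, hi⟩ := mem_verts_node.2.1 hv
        obtain ⟨x, hx, rfl⟩ := (hφ i).2.2 v hi
        exact ⟨x, (h2 x).2 ⟨i, hx⟩, rfl⟩

theorem isoVia_toVertexMap [DecidableEq V] {D D' : SPTree V} {s t s' t' : V} {π : List (V × V)}
    (hD : D.IsSP s t) (hD' : D'.IsSP s' t') (h : (isoTest D D').val = some π) :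
    IsoVia (toVertexMap π).val D D' := by
  obtain ⟨φ, h1, h2, h3⟩ := exists_isoVia_of_isoTest hD hD' h
  refine h1.congr fun v hv => ?_
  change (π.lookup v).getD v = φ v
  have key : ∀ l : List (V × V), (∀ x ∈ l, φ x.1 = x.2) → (∃ x ∈ l, x.1 = v) →
      (l.lookup v).getD v = φ v := by
    intro l hl hex
    induction l with
    | nil => simp at hex
    | cons x l ih =>
      rcases x with ⟨a, b⟩
      by_cases hva : v = a
      · subst hva
        simpa [List.lookup] using (hl (v, b) (by simp)).symm
      · have hva' : (v == a) = false := by simpa using hva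
        simp only [List.lookup, hva']
        refine ih (fun x hx => hl x (by simp [hx])) ?_
        obtain ⟨x, hx, hxv⟩ := hex
        rcases List.mem_cons.1 hx with rfl | hx
        · exact absurd hxv.symm hva
        · exact ⟨x, hx, hxv⟩
  exact key π (fun x hx => (h2 x hx).2) (h3 v hv)

/-! ### The cost of the isomorphism test -/

theorem matchSeries_steps_le {as ys : List (SPTree V)}
    (ha : ∀ a ∈ as, ∀ y, (isoTest a y).steps + 1 ≤ 5 * a.nsize * y.nsize ∧
      ∀ π, (isoTest a y).val = some π → π.length ≤ 2 * a.nsize) :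
    (matchSeries (as.map isoTest) ys).steps ≤ 1 + 5 * (as.map nsize).sum +
        5 * (as.map nsize).sum * (ys.map nsize).sum ∧
      ∀ π, (matchSeries (as.map isoTest) ys).val = some π →
        π.length ≤ 2 * (as.map nsize).sum := by
  induction as generalizing ys with
  | nil =>
    cases ys with
    | nil => simp [matchSeries]
    | cons y ys => simp [matchSeries]
  | cons a as ih =>
    cases ys with
    | nil => simp [matchSeries]
    | cons y ys =>
      rw [List.map_cons, matchSeries_cons]
      obtain ⟨h1, h2⟩ := ha a (by simp) y
      obtain ⟨h3, h4⟩ := ih (ys := ys) fun a' h' => ha a' (by simp [h'])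
      have h5 := a.nsize_pos
      simp only [bind_val, bind_steps, tick_steps, List.map_cons, List.sum_cons]
      generalize (as.map nsize).sum = A at *
      generalize (ys.map nsize).sum = Y at *
      rcases h6 : (isoTest a y).val with _ | π₁
      · simp only [pure_val, pure_steps, reduceCtorEq, false_imp_iff, implies_true, and_true]
        nlinarith
      · have h7 := h2 _ h6
        simp only [bind_steps, bind_val]
        rcases h8 : (matchSeries (as.map isoTest) ys).val with _ | π₂
        · simp only [pure_val, pure_steps, reduceCtorEq, false_imp_iff, implies_true, and_true]
          nlinarith
        · have h9 := h4 _ h8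
          simp only [bind_val, bind_steps, append_val, append_steps, pure_val, pure_steps,
            Option.some.injEq]
          constructor
          · nlinarith
          · rintro _ rfl
            rw [List.length_append]
            omega

theorem matchFirst_steps_le {a : SPTree V} {ys : List (SPTree V)}
    (ha : ∀ y, (isoTest a y).steps + 1 ≤ 5 * a.nsize * y.nsize) :
    (matchFirst (isoTest a) ys).steps ≤ 1 + 5 * a.nsize * (ys.map nsize).sum := by
  induction ys with
  | nil => simp [matchFirst]
  | cons y ys ih =>
    simp only [matchFirst, bind_steps, tick_steps, List.map_cons, List.sum_cons]
    have h1 := ha y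
    rcases (isoTest a y).val with _ | π₁
    · simp only [bind_steps]
      rcases (matchFirst (isoTest a) ys).val with _ | ⟨π₂, rest⟩ <;>
      · simp only [pure_steps]
        nlinarith
    · simp only [pure_steps]
      nlinarith

theorem matchParallel_steps_le {as ys : List (SPTree V)}
    (ha : ∀ a ∈ as, ∀ y, (isoTest a y).steps + 1 ≤ 5 * a.nsize * y.nsize ∧
      ∀ π, (isoTest a y).val = some π → π.length ≤ 2 * a.nsize) :
    (matchParallel (as.map isoTest) ys).steps ≤ 1 + 5 * (as.map nsize).sum +
        5 * (as.map nsize).sum * (ys.map nsize).sum ∧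
      ∀ π, (matchParallel (as.map isoTest) ys).val = some π →
        π.length ≤ 2 * (as.map nsize).sum := by
  induction as generalizing ys with
  | nil =>
    cases ys with
    | nil => simp [matchParallel]
    | cons y ys => simp [matchParallel]
  | cons a as ih =>
    rw [List.map_cons, matchParallel_cons]
    have h1 := matchFirst_steps_le (ys := ys) fun y => (ha a (by simp) y).1
    have h5 := a.nsize_pos
    simp only [bind_val, bind_steps, tick_steps, List.map_cons, List.sum_cons]
    rcases h6 : (matchFirst (isoTest a) ys).val with _ | ⟨π₁, rest⟩
    · simp only [pure_val, pure_steps, reduceCtorEq, false_imp_iff, implies_true, and_true]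
      generalize (as.map nsize).sum = A at *
      generalize (ys.map nsize).sum = Y at *
      nlinarith [Nat.zero_le (A * Y)]
    · obtain ⟨y, h7, h8⟩ := matchFirst_eq_some h6
      have h9 := (ha a (by simp) y).2 _ h7
      obtain ⟨h3, h4⟩ := ih (ys := rest) fun a' h' => ha a' (by simp [h'])
      have h10 : (rest.map nsize).sum ≤ (ys.map nsize).sum := by
        rw [(h8.map nsize).sum_eq, List.map_cons, List.sum_cons]
        omega
      simp only [bind_steps, bind_val]
      generalize (as.map nsize).sum = A at *
      generalize (ys.map nsize).sum = Y at *
      generalize (rest.map nsize).sum = Z at *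
      have h11 : 5 * A * Z ≤ 5 * A * Y := Nat.mul_le_mul_left _ h10
      rcases h13 : (matchParallel (as.map isoTest) rest).val with _ | π₂
      · simp only [pure_val, pure_steps, reduceCtorEq, false_imp_iff, implies_true, and_true]
        nlinarith
      · have h14 := h4 _ h13
        simp only [bind_val, bind_steps, append_val, append_steps, pure_val, pure_steps,
          Option.some.injEq]
        constructor
        · nlinarith
        · rintro _ rfl
          rw [List.length_append]
          omega

/-- The test takes at most quadratic time, and returns a list of linear length. -/
theorem isoTest_steps_le (D D' : SPTree V) :
    (isoTest D D').steps + 1 ≤ 5 * D.nsize * D'.nsize ∧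
      ∀ π, (isoTest D D').val = some π → π.length ≤ 2 * D.nsize := by
  have hof : ∀ {k : ℕ} (c : Fin k → SPTree V), ((List.ofFn c).map nsize).sum = ∑ i, (c i).nsize :=
    fun c => by rw [List.map_ofFn, List.sum_ofFn]; rfl
  have hfail : ∀ D D' : SPTree V, 2 ≤ 5 * D.nsize * D'.nsize := fun D D' => by
    have := Nat.mul_pos D.nsize_pos D'.nsize_pos
    rw [mul_assoc]
    omega
  induction D generalizing D' with
  | edge u v =>
    cases D' with
    | edge _ _ => simp [isoTest, nsize]
    | series _ _ => exact ⟨hfail _ _, fun π h => by simp [isoTest] at h⟩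
    | parallel _ _ => exact ⟨hfail _ _, fun π h => by simp [isoTest] at h⟩
  | series k c ih =>
    cases D' with
    | edge _ _ => exact ⟨hfail _ _, fun π h => by simp [isoTest] at h⟩
    | parallel _ _ => exact ⟨hfail _ _, fun π h => by simp [isoTest] at h⟩
    | series k' c' =>
      rw [isoTest_series]
      obtain ⟨h1, h2⟩ := matchSeries_steps_le (as := List.ofFn c) (ys := List.ofFn c') fun a ha => by
        obtain ⟨i, rfl⟩ := (List.mem_ofFn' _ _).1 ha
        exact ih i
      rw [hof, hof] at h1
      rw [hof] at h2
      simp only [bind_steps, tick_steps, bind_val, nsize]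
      refine ⟨?_, fun π hπ => (h2 π hπ).trans (by omega)⟩
      clear h2
      generalize ∑ i, (c i).nsize = A at *
      generalize ∑ i, (c' i).nsize = Y at *
      nlinarith
  | parallel k c ih =>
    cases D' with
    | edge _ _ => exact ⟨hfail _ _, fun π h => by simp [isoTest] at h⟩
    | series _ _ => exact ⟨hfail _ _, fun π h => by simp [isoTest] at h⟩
    | parallel k' c' =>
      rw [isoTest_parallel]
      obtain ⟨h1, h2⟩ := matchParallel_steps_le (as := List.ofFn c) (ys := List.ofFn c')
        fun a ha => by
          obtain ⟨i, rfl⟩ := (List.mem_ofFn' _ _).1 ha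
          exact ih i
      rw [hof, hof] at h1
      rw [hof] at h2
      simp only [bind_steps, tick_steps, bind_val, nsize]
      refine ⟨?_, fun π hπ => (h2 π hπ).trans (by omega)⟩
      clear h2
      generalize ∑ i, (c i).nsize = A at *
      generalize ∑ i, (c' i).nsize = Y at *
      nlinarith

/-! ### The partition into isomorphism classes -/

section Classes

variable [DecidableEq V] {k : ℕ} {c : Fin k → SPTree V}

/-- The class `E` consists of the principal subgraphs with the indices `I`, the representative
first, and holds an isomorphism from the representative to each other member. -/
def IsClassOf (c : Fin k → SPTree V) (E : IsoClass k V) (I : List (Fin k)) : Prop :=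
  ∃ idx, I = E.rep :: idx ∧ List.Forall₂ (fun ρ i => IsoVia ρ (c E.rep) (c i)) E.others idx

theorem insertClass_spec (s t : Fin k → V) (hc : ∀ i, (c i).IsSP (s i) (t i)) (i : Fin k)
    {Es : List (IsoClass k V)} {Is : List (List (Fin k))}
    (h : List.Forall₂ (IsClassOf c) Es Is) :
    ∃ Is', List.Forall₂ (IsClassOf c) (insertClass c i Es).val Is' ∧
      Is'.flatten.Perm (i :: Is.flatten) ∧
      ((insertClass c i Es).val.map (fun E => shape (c E.rep)) =
          Es.map (fun E => shape (c E.rep)) ∨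
        (insertClass c i Es).val.map (fun E => shape (c E.rep)) =
          Es.map (fun E => shape (c E.rep)) ++ [shape (c i)] ∧
        shape (c i) ∉ Es.map (fun E => shape (c E.rep))) := by
  induction h with
  | nil =>
    refine ⟨[[i]], ?_, by simp, Or.inr ⟨rfl, by simp⟩⟩
    exact List.Forall₂.cons ⟨[], rfl, List.Forall₂.nil⟩ List.Forall₂.nil
  | @cons E I Es Is hE hEs ih =>
    simp only [insertClass, bind_val]
    rcases h1 : (isoTest (c E.rep) (c i)).val with _ | π
    · obtain ⟨Is', h2, h3, h4⟩ := ih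
      simp only [bind_val, pure_val]
      refine ⟨I :: Is', List.Forall₂.cons hE h2, ?_, ?_⟩
      · rw [List.flatten_cons, List.flatten_cons]
        exact (h3.append_left I).trans List.perm_middle
      · rcases h4 with h4 | ⟨h4, h5⟩
        · exact Or.inl (by simp [h4])
        · refine Or.inr ⟨by simp [h4], ?_⟩
          rw [List.map_cons, List.mem_cons, not_or]
          refine ⟨fun h6 => ?_, h5⟩
          exact isoTest_ne_none_iff.2 h6.symm h1
    · simp only [bind_val, pure_val]
      obtain ⟨idx, rfl, h2⟩ := hE
      refine ⟨(E.rep :: i :: idx) :: Is, List.Forall₂.cons ⟨_, rfl, ?_⟩ hEs, ?_, Or.inl rfl⟩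
      · exact List.Forall₂.cons (isoVia_toVertexMap (hc _) (hc _) h1) h2
      · simp only [List.flatten_cons, List.cons_append]
        exact List.Perm.swap _ _ _

theorem insertClasses_spec (s t : Fin k → V) (hc : ∀ i, (c i).IsSP (s i) (t i)) (is : List (Fin k))
    {Es : List (IsoClass k V)} {Is : List (List (Fin k))} (h : List.Forall₂ (IsClassOf c) Es Is)
    (hn : (Es.map fun E => shape (c E.rep)).Nodup) :
    ∃ Is', List.Forall₂ (IsClassOf c) (insertClasses c is Es).val Is' ∧
      Is'.flatten.Perm (is ++ Is.flatten) ∧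
      ((insertClasses c is Es).val.map fun E => shape (c E.rep)).Nodup := by
  induction is generalizing Es Is with
  | nil => exact ⟨Is, h, List.Perm.refl _, hn⟩
  | cons i is ih =>
    obtain ⟨Is', h1, h2, h3⟩ := insertClass_spec s t hc i h
    simp only [insertClasses, bind_val]
    obtain ⟨Is'', h4, h5, h6⟩ := ih h1 (by
      rcases h3 with h3 | ⟨h3, h4⟩
      · rwa [h3]
      · rw [h3, List.nodup_append']
        exact ⟨hn, by simp, by simpa using h4⟩)
    exact ⟨Is'', h4, (h5.trans (h2.append_left is)).trans List.perm_middle, h6⟩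

/-- The partition is correct: the classes are indexed by distinct shapes, and each principal
subgraph belongs to one of them. -/
theorem isoClasses_spec (s t : Fin k → V) (hc : ∀ i, (c i).IsSP (s i) (t i)) :
    ∃ I : Fin (isoClasses c).val.length → List (Fin k),
      (∀ j, IsClassOf c ((isoClasses c).val.get j) (I j)) ∧
      (List.ofFn I).flatten.Perm (List.finRange k) ∧
      Function.Injective fun j => shape (c ((isoClasses c).val.get j).rep) := by
  obtain ⟨Is, h1, h2, h3⟩ := insertClasses_spec s t hc (List.finRange k) (Es := []) (Is := [])
    List.Forall₂.nil (by simp)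
  change List.Forall₂ _ (isoClasses c).val Is at h1
  change ((isoClasses c).val.map _).Nodup at h3
  generalize (isoClasses c).val = Es at *
  have hl := h1.length_eq
  obtain ⟨I, rfl⟩ : ∃ I : Fin Es.length → List (Fin k), Is = List.ofFn I := by
    refine ⟨fun j => Is.get (j.cast hl), ?_⟩
    rw [← List.ofFn_congr hl.symm, List.ofFn_get]
  refine ⟨I, fun j => ?_, by simpa using h2, fun j j' hj => ?_⟩
  · have := (List.forall₂_iff_get.1 h1).2 j j.2 (by simp)
    simpa using this
  · rw [List.nodup_iff_injective_get] at h3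
    have h4 := @h3 (j.cast (by simp)) (j'.cast (by simp)) (by simpa using hj)
    simpa [Fin.ext_iff] using h4

theorem insertClass_steps_le (i : Fin k) (Es : List (IsoClass k V)) :
    (insertClass c i Es).steps ≤
        1 + 9 * (c i).nsize * (Es.map fun E => (c E.rep).nsize).sum ∧
      ((insertClass c i Es).val.map fun E => (c E.rep).nsize).sum ≤
        (c i).nsize + (Es.map fun E => (c E.rep).nsize).sum := by
  induction Es with
  | nil => simp [insertClass]
  | cons E Es ih =>
    simp only [insertClass, bind_val, bind_steps, tick_steps, List.map_cons, List.sum_cons]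
    obtain ⟨h1, h2⟩ := isoTest_steps_le (c E.rep) (c i)
    have h3 := (c E.rep).nsize_pos
    have h4 := (c i).nsize_pos
    obtain ⟨h5, h6⟩ := ih
    have h8 := Nat.mul_le_mul_left (c E.rep).nsize h4
    rcases h7 : (isoTest (c E.rep) (c i)).val with _ | π
    · simp only [bind_val, bind_steps, pure_val, pure_steps, List.map_cons, List.sum_cons]
      generalize (Es.map fun E => (c E.rep).nsize).sum = A at *
      exact ⟨by nlinarith, by omega⟩
    · have h9 := h2 π h7
      have h10 : (toVertexMap π).steps = π.length + 1 := rfl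
      simp only [bind_val, bind_steps, pure_val, pure_steps, List.map_cons, List.sum_cons, h10]
      generalize (Es.map fun E => (c E.rep).nsize).sum = A at *
      exact ⟨by nlinarith [Nat.zero_le ((c i).nsize * A)], by omega⟩

theorem insertClasses_steps_le (is : List (Fin k)) (Es : List (IsoClass k V)) :
    (insertClasses c is Es).steps ≤ 1 + 2 * is.length + 9 * (is.map fun i => (c i).nsize).sum *
      ((Es.map fun E => (c E.rep).nsize).sum + (is.map fun i => (c i).nsize).sum) := by
  induction is generalizing Es with
  | nil => simp [insertClasses]
  | cons i is ih =>
    obtain ⟨h1, h2⟩ := insertClass_steps_le (c := c) i Es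
    have h3 := ih (insertClass c i Es).val
    simp only [insertClasses, bind_steps, tick_steps, List.map_cons, List.sum_cons,
      List.length_cons]
    generalize (is.map fun i => (c i).nsize).sum = A at *
    generalize (Es.map fun E => (c E.rep).nsize).sum = B at *
    generalize ((insertClass c i Es).val.map fun E => (c E.rep).nsize).sum = B' at *
    have h4 : 9 * A * (B' + A) ≤ 9 * A * ((c i).nsize + B + A) :=
      Nat.mul_le_mul_left _ (by omega)
    nlinarith

/-- The partition takes at most quadratic time. -/
theorem isoClasses_steps_le {s t : V} (hc : IsBundle c s t) :
    (isoClasses c).steps ≤ 48 * (parallel k c).esize ^ 2 := by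
  have h1 := insertClasses_steps_le (c := c) (List.finRange k) []
  have h2 : ((List.finRange k).map fun i => (c i).nsize).sum = ∑ i, (c i).nsize := by
    rw [← List.ofFn_eq_map, List.sum_ofFn]
  have h3 := (isSP_parallel_iff.2 hc).nsize_lt
  have h4 : k ≤ ∑ i, (c i).nsize := by
    simpa using Finset.sum_le_sum (f := fun _ => 1) fun i (_ : i ∈ Finset.univ) =>
      Nat.succ_le_of_lt (c i).nsize_pos
  rw [h2] at h1
  simp only [List.map_nil, List.sum_nil, zero_add, List.length_finRange] at h1
  simp only [nsize] at h3
  have h5 := hc.two_le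
  change (insertClasses c (List.finRange k) []).steps ≤ _
  generalize (parallel k c).esize = m at *
  generalize ∑ i, (c i).nsize = A at *
  nlinarith

end Classes

end SPTree

/-! ### Spanning trees and near trees along a decomposition tree -/

theorem List.nodup_map_of_imp {α β γ : Type*} {L : List α} {f : α → β} {g : α → γ}
    (hf : (L.map f).Nodup) (h : ∀ x ∈ L, ∀ y ∈ L, g x = g y → f x = f y) : (L.map g).Nodup := by
  rw [List.Nodup, List.pairwise_map] at hf ⊢
  exact hf.imp_of_mem fun hx hy hne heq => hne (h _ hx _ hy heq)

namespace SPTree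

open Timed

universe u

variable {V : Type u}

/-- `D.IsTreeOn true F` and `D.IsTreeOn false F`: the edges of the graph of `D` that belong to `F`
form a spanning tree and a near tree, respectively, as described along the decomposition tree. -/
def IsTreeOn : SPTree V → Bool → Set (Sym2 V) → Prop
  | edge u v, b, F => s(u, v) ∈ F ↔ b = true
  | series _ c, true, F => ∀ i, (c i).IsTreeOn true F
  | series _ c, false, F => ∃ i, (c i).IsTreeOn false F ∧ ∀ j, j ≠ i → (c j).IsTreeOn true F
  | parallel _ c, true, F => ∃ i, (c i).IsTreeOn true F ∧ ∀ j, j ≠ i → (c j).IsTreeOn false F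
  | parallel _ c, false, F => ∀ i, (c i).IsTreeOn false F

theorem IsTreeOn.of_ty_eq {D D' : SPTree V} {F F' : Set (Sym2 V)} {b : Bool}
    (h : D.IsTreeOn b F) (hty : ty D F = ty D' F') : D'.IsTreeOn b F' := by
  rw [ty_eq_ty] at hty
  induction D generalizing D' b with
  | edge u v =>
    cases D' <;> try exact hty.elim
    exact Iff.trans (Iff.symm hty) h
  | series k c ih =>
    cases D' <;> try exact hty.elim
    obtain ⟨e, -, hty⟩ := hty
    cases b with
    | true =>
      intro i
      have := ih (e.symm i) (h _) (hty _)
      rwa [Equiv.apply_symm_apply] at this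
    | false =>
      obtain ⟨i, h1, h2⟩ := h
      refine ⟨e i, ih i h1 (hty i), fun j hj => ?_⟩
      have := ih (e.symm j) (h2 _ fun h => hj (by rw [← h, Equiv.apply_symm_apply])) (hty _)
      rwa [Equiv.apply_symm_apply] at this
  | parallel k c ih =>
    cases D' <;> try exact hty.elim
    obtain ⟨e, hty⟩ := hty
    cases b with
    | false =>
      intro i
      have := ih (e.symm i) (h _) (hty _)
      rwa [Equiv.apply_symm_apply] at this
    | true =>
      obtain ⟨i, h1, h2⟩ := h
      refine ⟨e i, ih i h1 (hty i), fun j hj => ?_⟩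
      have := ih (e.symm j) (h2 _ fun h => hj (by rw [← h, Equiv.apply_symm_apply])) (hty _)
      rwa [Equiv.apply_symm_apply] at this

theorem IsTreeOn.congr {D : SPTree V} {F F' : Set (Sym2 V)} {b : Bool} (h : D.IsTreeOn b F)
    (hF : ∀ e ∈ D.edges, e ∈ F ↔ e ∈ F') : D.IsTreeOn b F' :=
  h.of_ty_eq (ty_congr hF)

/-- No set of edges is both a spanning tree and a near tree. -/
theorem IsTreeOn.not_both {D : SPTree V} {s t : V} (hD : D.IsSP s t) {F : Set (Sym2 V)}
    (h : D.IsTreeOn true F) : ¬ D.IsTreeOn false F := by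
  induction D generalizing s t with
  | edge u v =>
    intro h'
    simp only [IsTreeOn, iff_true, Bool.false_eq_true, iff_false] at h h'
    exact h' h
  | series k c ih =>
    obtain ⟨p, rfl, rfl, hc⟩ := isSP_series_iff.1 hD
    rintro ⟨i, h1, -⟩
    exact ih i (hc.isSP i) (h i) h1
  | parallel k c ih =>
    have hc := isSP_parallel_iff.1 hD
    obtain ⟨i, h1, -⟩ := h
    exact fun h2 => ih i (hc.isSP i) h1 (h2 i)

/-- The set of edges of a listed forest. -/
abbrev toSet (F : Forest V) : Set (Sym2 V) := {e | e ∈ F}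

/-- The list `L` contains exactly one spanning tree (for `b = true`) or near tree (for `b = false`)
of each type, and all its entries are lists without superfluous edges. -/
structure Lists (D : SPTree V) (b : Bool) (L : List (Forest V)) : Prop where
  sub : ∀ F ∈ L, ∀ e ∈ F, e ∈ D.edges
  mem : ∀ F ∈ L, D.IsTreeOn b (toSet F)
  nodup : (L.map fun F => ty D (toSet F)).Nodup
  complete : ∀ F, D.IsTreeOn b F → ∃ T ∈ L, ty D (toSet T) = ty D F
  length : ∀ F ∈ L, F.length = D.inner + b.toNat

theorem lists_edge (u v : V) :
    Lists (edge u v) true [[s(u, v)]] ∧ Lists (edge u v) false [[]] := by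
  constructor
  · refine ⟨by simp [edges], by simp [IsTreeOn], by simp,
      fun F hF => ⟨[s(u, v)], by simp, ?_⟩, by simp [inner]⟩
    refine ty_congr fun e he => ?_
    obtain rfl : e = s(u, v) := he
    simpa [IsTreeOn] using hF
  · refine ⟨by simp, by simp [IsTreeOn], by simp, fun F hF => ⟨[], by simp, ?_⟩,
      by simp [inner]⟩
    refine ty_congr fun e he => ?_
    obtain rfl : e = s(u, v) := he
    simpa [IsTreeOn] using hF

/-! ### Unions with one special factor -/

/-- All unions of forests chosen from lists, one of them from a list `A i` and the others from the
lists `B j` with `j ≠ i`. -/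
def specialUnions {k : ℕ} (A B : Fin k → List (Forest V)) : List (Forest V) :=
  ((List.finRange k).map fun i =>
    (unions ((List.finRange k).map fun j => if j = i then A j else B j)).val).flatten

section Special

variable {k : ℕ} {A B : Fin k → List (Forest V)} {K : Type*} {E : Fin k → Set (Sym2 V)}
  {κ : Fin k → Set (Sym2 V) → K}

theorem mem_specialUnions {F : Forest V} : F ∈ specialUnions A B ↔
    ∃ i, F ∈ (unions ((List.finRange k).map fun j => if j = i then A j else B j)).val := by
  simp [specialUnions]

theorem eq_on_part_of_mem_specialUnions (hE : ∀ i j, i ≠ j → Disjoint (E i) (E j))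
    (hA : ∀ j, ∀ F ∈ A j, ∀ e ∈ F, e ∈ E j) (hB : ∀ j, ∀ F ∈ B j, ∀ e ∈ F, e ∈ E j)
    {F : Forest V} (hF : F ∈ specialUnions A B) :
    (∀ e ∈ F, ∃ j, e ∈ E j) ∧ ∃ i, (∃ T ∈ A i, ∀ e ∈ E i, e ∈ F ↔ e ∈ T) ∧
      ∀ j, j ≠ i → ∃ T ∈ B j, ∀ e ∈ E j, e ∈ F ↔ e ∈ T := by
  obtain ⟨i, hi⟩ := mem_specialUnions.1 hF
  have hL : ∀ j ∈ List.finRange k, ∀ F ∈ (if j = i then A j else B j), ∀ e ∈ F, e ∈ E j := by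
    intro j _
    split_ifs
    exacts [hA j, hB j]
  obtain ⟨h1, h2⟩ := eq_on_part_of_mem_unions (List.nodup_finRange k) hE hL hi
  refine ⟨fun e he => ?_, i, ?_, fun j hj => ?_⟩
  · obtain ⟨j, -, hj⟩ := h1 e he
    exact ⟨j, hj⟩
  · simpa using h2 i (List.mem_finRange i)
  · simpa [hj] using h2 j (List.mem_finRange j)

theorem length_of_mem_specialUnions {a b : Fin k → ℕ} (hA : ∀ j, ∀ F ∈ A j, F.length = a j)
    (hB : ∀ j, ∀ F ∈ B j, F.length = b j) {F : Forest V} (hF : F ∈ specialUnions A B) :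
    ∃ i, F.length + b i = ∑ j, b j + a i := by
  obtain ⟨i, hi⟩ := mem_specialUnions.1 hF
  refine ⟨i, ?_⟩
  rw [length_of_mem_unions (w := fun j => if j = i then a j else b j) ?_ hi, ← List.ofFn_eq_map,
    List.sum_ofFn, ← Finset.add_sum_erase _ _ (Finset.mem_univ i),
    ← Finset.add_sum_erase _ b (Finset.mem_univ i)]
  · have : ∑ x ∈ Finset.univ.erase i, (if x = i then a x else b x) =
        ∑ x ∈ Finset.univ.erase i, b x :=
      Finset.sum_congr rfl fun x hx => by simp [Finset.ne_of_mem_erase hx]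
    rw [this]
    simp only [if_true]
    omega
  · intro j _
    split_ifs
    exacts [hA j, hB j]

theorem exists_mem_specialUnions (hE : ∀ i j, i ≠ j → Disjoint (E i) (E j))
    (hA : ∀ j, ∀ F ∈ A j, ∀ e ∈ F, e ∈ E j) (hB : ∀ j, ∀ F ∈ B j, ∀ e ∈ F, e ∈ E j)
    (hκ : ∀ j F F', (∀ e ∈ E j, e ∈ F ↔ e ∈ F') → κ j F = κ j F') (q : Fin k → K) (i : Fin k)
    (hqA : ∃ F ∈ A i, κ i (toSet F) = q i) (hqB : ∀ j, j ≠ i → ∃ F ∈ B j, κ j (toSet F) = q j) :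
    ∃ F ∈ specialUnions A B, ∀ j, κ j (toSet F) = q j := by
  obtain ⟨F, hF, h⟩ := exists_mem_unions (L := fun j => if j = i then A j else B j) (κ := κ)
    (List.nodup_finRange k) hE (fun j _ => by split_ifs; exacts [hA j, hB j]) hκ q
    fun j _ => by
      by_cases hj : j = i
      · subst hj; simpa using hqA
      · simpa [hj] using hqB j hj
  exact ⟨F, mem_specialUnions.2 ⟨i, hF⟩, fun j => h j (List.mem_finRange j)⟩

theorem nodup_specialUnions (hE : ∀ i j, i ≠ j → Disjoint (E i) (E j))
    (hA : ∀ j, ∀ F ∈ A j, ∀ e ∈ F, e ∈ E j) (hB : ∀ j, ∀ F ∈ B j, ∀ e ∈ F, e ∈ E j)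
    (hκ : ∀ j F F', (∀ e ∈ E j, e ∈ F ↔ e ∈ F') → κ j F = κ j F')
    (hnA : ∀ j, ((A j).map fun F => κ j (toSet F)).Nodup)
    (hnB : ∀ j, ((B j).map fun F => κ j (toSet F)).Nodup)
    (hAB : ∀ j, ∀ F ∈ A j, ∀ F' ∈ B j, κ j (toSet F) ≠ κ j (toSet F')) :
    ((specialUnions A B).map fun F => (List.finRange k).map fun j => κ j (toSet F)).Nodup := by
  have hL : ∀ i, ∀ j ∈ List.finRange k, ∀ F ∈ (if j = i then A j else B j), ∀ e ∈ F, e ∈ E j := by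
    intro i j _
    split_ifs
    exacts [hA j, hB j]
  have hrow : ∀ i, _ := fun i => nodup_unions (L := fun j => if j = i then A j else B j) (κ := κ)
    (List.nodup_finRange k) hE (hL i) hκ fun j _ => by
      split_ifs
      exacts [hnA j, hnB j]
  rw [specialUnions, List.map_flatten, List.nodup_flatten]
  constructor
  · intro l hl
    simp only [List.mem_map, List.mem_finRange, true_and, exists_exists_eq_and] at hl
    obtain ⟨i, rfl⟩ := hl
    exact hrow i
  · rw [List.map_map, List.pairwise_map]
    refine (List.nodup_finRange k).imp fun {i i'} hii' => ?_
    rw [Function.comp_apply, Function.comp_apply, List.disjoint_left]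
    intro q h1 h2
    obtain ⟨F, hF, rfl⟩ := List.mem_map.1 h1
    obtain ⟨F', hF', heq⟩ := List.mem_map.1 h2
    obtain ⟨T, hT, hTF⟩ := (eq_on_part_of_mem_unions (List.nodup_finRange k) hE (hL i) hF).2 i
      (List.mem_finRange i)
    obtain ⟨T', hT', hTF'⟩ := (eq_on_part_of_mem_unions (List.nodup_finRange k) hE (hL i') hF').2 i
      (List.mem_finRange i)
    simp only [if_true, hii', if_false] at hT hT'
    refine hAB i T hT T' hT' ?_
    rw [← hκ i (toSet F) (toSet T) hTF, ← hκ i (toSet F') (toSet T') hTF']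
    exact (List.map_inj_left.1 heq i (List.mem_finRange i)).symm

end Special

/-! ### Correctness at S-nodes -/

theorem seriesSpan_val {k : ℕ} (span : Fin k → List (Forest V)) :
    (seriesSpan span).val = (unions ((List.finRange k).map span)).val := by
  simp [seriesSpan]

theorem seriesNear_val {k : ℕ} (span near : Fin k → List (Forest V)) :
    (seriesNear span near).val = specialUnions near span := by
  simp [seriesNear, specialUnions]

section Series

variable {k : ℕ} {c : Fin k → SPTree V} {p : Fin (k + 1) → V} {span near : Fin k → List (Forest V)}

theorem IsChain.lists_span (hc : IsChain c p) (hs : ∀ i, Lists (c i) true (span i)) :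
    Lists (series k c) true (seriesSpan span).val := by
  have hE : ∀ i j, i ≠ j → Disjoint (c i).edges (c j).edges := hc.disjoint_edges
  have hL : ∀ j ∈ List.finRange k, ∀ F ∈ span j, ∀ e ∈ F, e ∈ (c j).edges :=
    fun j _ => (hs j).sub
  have hpart : ∀ F ∈ (unions ((List.finRange k).map span)).val, _ := fun F hF =>
    eq_on_part_of_mem_unions (List.nodup_finRange k) hE hL hF
  rw [seriesSpan_val]
  refine ⟨fun F hF e he => ?_, fun F hF i => ?_, ?_, fun F hF => ?_, fun F hF => ?_⟩
  · obtain ⟨j, -, hj⟩ := (hpart F hF).1 e he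
    exact mem_edges_node.1.2 ⟨j, hj⟩
  · obtain ⟨T, hT, h⟩ := (hpart F hF).2 i (List.mem_finRange i)
    exact ((hs i).mem T hT).congr fun e he => (h e he).symm
  · refine List.nodup_map_of_imp (nodup_unions (κ := fun j F => ty (c j) F)
      (List.nodup_finRange k) hE hL (fun j F F' h => ty_congr h) fun j _ => (hs j).nodup) ?_
    intro F _ F' _ h
    exact List.map_congr_left fun j _ => ty_series_eq.1 h j
  · obtain ⟨T, hT, h⟩ := exists_mem_unions (κ := fun j F => ty (c j) F) (List.nodup_finRange k) hE
      hL (fun j F F' h => ty_congr h) (fun j => ty (c j) F) fun j _ => (hs j).complete F (hF j)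
    exact ⟨T, hT, ty_series_eq.2 fun j => h j (List.mem_finRange j)⟩
  · rw [length_of_mem_unions (fun j _ => (hs j).length) hF, ← List.ofFn_eq_map, List.sum_ofFn]
    have := hc.two_le
    simp only [Bool.toNat_true, Finset.sum_add_distrib, Finset.sum_const, Finset.card_univ,
      Fintype.card_fin, smul_eq_mul, mul_one, inner]
    omega

theorem IsChain.lists_near (hc : IsChain c p) (hs : ∀ i, Lists (c i) true (span i))
    (hn : ∀ i, Lists (c i) false (near i)) :
    Lists (series k c) false (seriesNear span near).val := by
  have hE : ∀ i j, i ≠ j → Disjoint (c i).edges (c j).edges := hc.disjoint_edges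
  have hpart : ∀ F ∈ specialUnions near span, _ := fun F hF =>
    eq_on_part_of_mem_specialUnions hE (fun j => (hn j).sub) (fun j => (hs j).sub) hF
  rw [seriesNear_val]
  refine ⟨fun F hF e he => ?_, fun F hF => ?_, ?_, fun F hF => ?_, fun F hF => ?_⟩
  · exact mem_edges_node.1.2 ((hpart F hF).1 e he)
  · obtain ⟨i, ⟨T, hT, h1⟩, h2⟩ := (hpart F hF).2
    refine ⟨i, ((hn i).mem T hT).congr fun e he => (h1 e he).symm, fun j hj => ?_⟩
    obtain ⟨T, hT, h3⟩ := h2 j hj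
    exact ((hs j).mem T hT).congr fun e he => (h3 e he).symm
  · refine List.nodup_map_of_imp (nodup_specialUnions (κ := fun j F => ty (c j) F) hE
      (fun j => (hn j).sub) (fun j => (hs j).sub) (fun j F F' h => ty_congr h)
      (fun j => (hn j).nodup) (fun j => (hs j).nodup) ?_) ?_
    · intro j F hF F' hF' h
      exact ((hs j).mem F' hF').not_both (hc.isSP j) (((hn j).mem F hF).of_ty_eq h)
    · intro F _ F' _ h
      exact List.map_congr_left fun j _ => ty_series_eq.1 h j
  · obtain ⟨i, h1, h2⟩ := hF
    obtain ⟨T, hT, h⟩ := exists_mem_specialUnions (κ := fun j F => ty (c j) F) hE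
      (fun j => (hn j).sub) (fun j => (hs j).sub) (fun j F F' h => ty_congr h)
      (fun j => ty (c j) F) i ((hn i).complete F h1) fun j hj => (hs j).complete F (h2 j hj)
    exact ⟨T, hT, ty_series_eq.2 h⟩
  · obtain ⟨i, hi⟩ := length_of_mem_specialUnions (fun j => (hn j).length)
      (fun j => (hs j).length) hF
    have := hc.two_le
    simp only [Bool.toNat_true, Bool.toNat_false, Finset.sum_add_distrib, Finset.sum_const,
      Finset.card_univ, Fintype.card_fin, smul_eq_mul, mul_one, inner] at hi ⊢
    omega

end Series

/-! ### Forests on an isomorphism class -/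

section Class

variable {k : ℕ} {c : Fin k → SPTree V} {s t : V}

theorem assign_cons_val (ρ : V → V) (ρs : List (V → V)) (F : Forest V) (Fs : List (Forest V)) :
    (assign (ρ :: ρs) (F :: Fs)).val = F.map (Sym2.map ρ) ++ (assign ρs Fs).val := by
  simp [assign]

theorem assign_cons_steps (ρ : V → V) (ρs : List (V → V)) (F : Forest V) (Fs : List (Forest V)) :
    (assign (ρ :: ρs) (F :: Fs)).steps = 3 * F.length + 2 + (assign ρs Fs).steps := by
  simp [assign]
  ring

/-- Forests assigned to the members of a class keep their types. -/
theorem assign_spec (hc : IsBundle c s t) {r : Fin k} {ρs : List (V → V)} {idx : List (Fin k)}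
    (h : List.Forall₂ (fun ρ i => IsoVia ρ (c r) (c i)) ρs idx) (hidx : idx.Nodup)
    {Fs : List (Forest V)} (hl : Fs.length = ρs.length)
    (hF : ∀ F ∈ Fs, ∀ e ∈ F, e ∈ (c r).edges) :
    (∀ e ∈ (assign ρs Fs).val, ∃ i ∈ idx, e ∈ (c i).edges) ∧
      idx.map (fun i => ty (c i) (toSet (assign ρs Fs).val)) =
        Fs.map (fun F => ty (c r) (toSet F)) ∧
      (assign ρs Fs).val.length = (Fs.map List.length).sum := by
  induction h generalizing Fs with
  | nil =>
    obtain rfl := List.length_eq_zero_iff.1 hl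
    simp [assign]
  | @cons ρ i ρs idx hρ h ih =>
    cases Fs with
    | nil => simp at hl
    | cons F Fs =>
      rw [List.nodup_cons] at hidx
      obtain ⟨h1, h2, h3⟩ := ih hidx.2 (Fs := Fs) (by simpa using hl)
        fun F' hF' => hF F' (List.mem_cons_of_mem _ hF')
      have hρF : ∀ e ∈ F.map (Sym2.map ρ), e ∈ (c i).edges := by
        intro e he
        obtain ⟨e', he', rfl⟩ := List.mem_map.1 he
        exact hρ.map_mem_edges (hF F (by simp) e' he')
      rw [assign_cons_val]
      refine ⟨fun e he => ?_, ?_, by simp [h3]⟩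
      · rcases List.mem_append.1 he with he | he
        · exact ⟨i, by simp, hρF e he⟩
        · obtain ⟨j, hj, hej⟩ := h1 e he
          exact ⟨j, List.mem_cons_of_mem _ hj, hej⟩
      · rw [List.map_cons, List.map_cons, ← h2]
        congr 1
        · rw [← hρ.ty_image (hc.isSP r) (hc.isSP i) (F := toSet F) (hF F (by simp))]
          refine ty_congr fun e he => ?_
          have h4 : e ∉ (assign ρs Fs).val := by
            intro h4
            obtain ⟨j, hj, hej⟩ := h1 e h4
            exact Set.disjoint_left.1 (hc.disjoint i j fun h => hidx.1 (h ▸ hj)) he hej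
          simp [h4]
        · refine List.map_congr_left fun j hj => ty_congr fun e he => ?_
          have h4 : e ∉ F.map (Sym2.map ρ) := fun h4 =>
            Set.disjoint_left.1 (hc.disjoint i j fun h => hidx.1 (h ▸ hj)) (hρF e h4) he
          simp only [Set.mem_ofPred_eq, List.mem_append, h4, false_or]

variable {E : IsoClass k V} {I : List (Fin k)}

theorem IsClassOf.forall₂ (hE : IsClassOf c E I) :
    List.Forall₂ (fun ρ i => IsoVia ρ (c E.rep) (c i)) (id :: E.others) I := by
  obtain ⟨idx, rfl, h⟩ := hE
  exact List.Forall₂.cons (Match.refl (fun _ _ => ⟨rfl, rfl⟩) _) h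

theorem IsClassOf.length_eq (hE : IsClassOf c E I) : E.others.length + 1 = I.length :=
  hE.forall₂.length_eq

theorem IsClassOf.exists_isoVia (hE : IsClassOf c E I) {i : Fin k} (hi : i ∈ I) :
    ∃ ρ, IsoVia ρ (c E.rep) (c i) := by
  obtain ⟨j, rfl⟩ := List.mem_iff_get.1 hi
  have h := hE.forall₂
  exact ⟨_, (List.forall₂_iff_get.1 h).2 j (by rw [h.length_eq]; exact j.2) j.2⟩

theorem IsClassOf.shape_eq (hE : IsClassOf c E I) {i : Fin k} (hi : i ∈ I) :
    shape (c i) = shape (c E.rep) := by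
  obtain ⟨ρ, hρ⟩ := hE.exists_isoVia hi
  exact hρ.shape_eq.symm

theorem IsClassOf.exists_ty_eq (hE : IsClassOf c E I) {i : Fin k} (hi : i ∈ I)
    (F : Set (Sym2 V)) : ∃ F', ty (c E.rep) F' = ty (c i) F := by
  obtain ⟨ρ, hρ⟩ := hE.exists_isoVia hi
  refine ⟨Sym2.map ρ ⁻¹' F, ty_eq_ty.2 (Match.imp hρ ?_)⟩
  rintro u v _ _ - - ⟨rfl, rfl⟩
  rfl

theorem IsClassOf.exists_mem_ty_eq (hE : IsClassOf c E I) {b : Bool} {L : List (Forest V)}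
    (hL : Lists (c E.rep) b L) {i : Fin k} (hi : i ∈ I) {F : Set (Sym2 V)}
    (hF : (c i).IsTreeOn b F) : ∃ T ∈ L, ty (c E.rep) (toSet T) = ty (c i) F := by
  obtain ⟨F', hF'⟩ := hE.exists_ty_eq hi F
  obtain ⟨T, hT, h⟩ := hL.complete F' (hF.of_ty_eq hF'.symm)
  exact ⟨T, hT, h.trans hF'⟩

/-- The multiset of the types of `F` on the principal subgraphs with the indices `I`. -/
def classKey (c : Fin k → SPTree V) (I : List (Fin k)) (F : Set (Sym2 V)) :
    Multiset (Quotient (markedSetoid V)) :=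
  I.map fun i => ty (c i) F

theorem classKey_congr {F F' : Set (Sym2 V)}
    (h : ∀ e ∈ ⋃ i ∈ I, (c i).edges, e ∈ F ↔ e ∈ F') : classKey c I F = classKey c I F' := by
  unfold classKey
  congr 1
  refine List.map_congr_left fun i hi => ty_congr fun e he => h e ?_
  exact Set.mem_iUnion₂.2 ⟨i, hi, he⟩

theorem classNear_val (near : List (Forest V)) : (classNear E near).val =
    (multisets (E.others.length + 1) near).val.map fun M => (assign (id :: E.others) M).val := by
  simp [classNear]

theorem classSpan_val (span near : List (Forest V)) : (classSpan E span near).val =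
    span.flatMap fun T => (multisets E.others.length near).val.map fun M =>
      (assign (id :: E.others) (T :: M)).val := by
  simp [classSpan, List.flatMap]

/-- A union of near trees for a class: near trees on all members. -/
theorem classNear_spec (hc : IsBundle c s t) (hE : IsClassOf c E I) (hI : I.Nodup)
    {near : List (Forest V)} (hn : Lists (c E.rep) false near) :
    (∀ F ∈ (classNear E near).val, (∀ e ∈ F, e ∈ ⋃ i ∈ I, (c i).edges) ∧
      (∀ i ∈ I, (c i).IsTreeOn false (toSet F)) ∧ F.length = (I.map fun i => (c i).inner).sum) ∧
    ((classNear E near).val.map fun F => classKey c I (toSet F)).Nodup ∧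
    ∀ F, (∀ i ∈ I, (c i).IsTreeOn false F) →
      ∃ T ∈ (classNear E near).val, classKey c I (toSet T) = classKey c I F := by
  have hspec : ∀ M ∈ (multisets (E.others.length + 1) near).val, _ := fun M hM =>
    assign_spec hc hE.forall₂ hI (Fs := M) (by simp [(mem_multisets hM).1])
      fun F hF => hn.sub F ((mem_multisets hM).2 F hF)
  rw [classNear_val]
  refine ⟨fun F hF => ?_, ?_, fun F hF => ?_⟩
  · obtain ⟨M, hM, rfl⟩ := List.mem_map.1 hF
    obtain ⟨h1, h2, h3⟩ := hspec M hM
    obtain ⟨h4, h5⟩ := mem_multisets hM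
    refine ⟨fun e he => ?_, fun i hi => ?_, ?_⟩
    · obtain ⟨i, hi, hei⟩ := h1 e he
      exact Set.mem_iUnion₂.2 ⟨i, hi, hei⟩
    · have h6 : ty (c i) (toSet (assign (id :: E.others) M).val) ∈
          M.map fun F => ty (c E.rep) (toSet F) := by
        rw [← h2]
        exact List.mem_map_of_mem (f := fun i => ty (c i) (toSet (assign (id :: E.others) M).val)) hi
      obtain ⟨T, hT, h7⟩ := List.mem_map.1 h6
      exact (hn.mem T (h5 T hT)).of_ty_eq h7
    · have h6 : M.map List.length = List.replicate M.length (c E.rep).inner :=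
        List.eq_replicate_iff.2 ⟨by simp, by
          intro x hx
          obtain ⟨T, hT, rfl⟩ := List.mem_map.1 hx
          simpa using hn.length T (h5 T hT)⟩
      have h7 : (I.map fun i => (c i).inner) = List.replicate I.length (c E.rep).inner :=
        List.eq_replicate_iff.2 ⟨by simp, by
          intro x hx
          obtain ⟨i, hi, rfl⟩ := List.mem_map.1 hx
          exact inner_eq_of_shape_eq (hE.shape_eq hi)⟩
      rw [h3, h6, h7, h4, hE.length_eq]
  · rw [List.map_map]
    have h1 := nodup_map_multisets (fun F => ty (c E.rep) (toSet F)) (E.others.length + 1) hn.nodup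
    refine List.nodup_map_of_imp h1 fun M hM M' hM' h => ?_
    have h2 := (hspec M hM).2.1
    have h3 := (hspec M' hM').2.1
    rw [← h2, ← h3]
    exact h
  · obtain ⟨M, hM, h⟩ := exists_mem_multisets (fun F => ty (c E.rep) (toSet F))
      (m := E.others.length + 1) (l := near) (q := classKey c I F)
      (by simp [classKey, hE.length_eq]) (by
        intro x hx
        rw [classKey, Multiset.mem_coe, List.mem_map] at hx
        obtain ⟨i, hi, rfl⟩ := hx
        obtain ⟨T, hT, h⟩ := hE.exists_mem_ty_eq hn hi (hF i hi)
        exact List.mem_map.2 ⟨T, hT, h⟩)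
    refine ⟨_, List.mem_map_of_mem hM, ?_⟩
    rw [← h, ← (hspec M hM).2.1]
    rfl

/-- A spanning union for a class: a spanning tree on one member and near trees on the others. -/
theorem classSpan_spec (hc : IsBundle c s t) (hE : IsClassOf c E I) (hI : I.Nodup)
    {span near : List (Forest V)} (hs : Lists (c E.rep) true span)
    (hn : Lists (c E.rep) false near) :
    (∀ F ∈ (classSpan E span near).val, (∀ e ∈ F, e ∈ ⋃ i ∈ I, (c i).edges) ∧
      (∃ i ∈ I, (c i).IsTreeOn true (toSet F) ∧ ∀ j ∈ I, j ≠ i → (c j).IsTreeOn false (toSet F)) ∧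
      F.length = (I.map fun i => (c i).inner).sum + 1) ∧
    ((classSpan E span near).val.map fun F => classKey c I (toSet F)).Nodup ∧
    ∀ F, (∃ i ∈ I, (c i).IsTreeOn true F ∧ ∀ j ∈ I, j ≠ i → (c j).IsTreeOn false F) →
      ∃ T ∈ (classSpan E span near).val, classKey c I (toSet T) = classKey c I F := by
  have hspec : ∀ T ∈ span, ∀ M ∈ (multisets E.others.length near).val, _ := fun T hT M hM =>
    assign_spec hc hE.forall₂ hI (Fs := T :: M) (by simp [(mem_multisets hM).1]) (by
      intro F hF
      rcases List.mem_cons.1 hF with rfl | hF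
      · exact hs.sub F hT
      · exact hn.sub F ((mem_multisets hM).2 F hF))
  rw [classSpan_val]
  refine ⟨fun F hF => ?_, ?_, fun F hF => ?_⟩
  · obtain ⟨T, hT, hF⟩ := List.mem_flatMap.1 hF
    obtain ⟨M, hM, rfl⟩ := List.mem_map.1 hF
    obtain ⟨h1, h2, h3⟩ := hspec T hT M hM
    obtain ⟨h4, h5⟩ := mem_multisets hM
    refine ⟨fun e he => ?_, ?_, ?_⟩
    · obtain ⟨i, hi, hei⟩ := h1 e he
      exact Set.mem_iUnion₂.2 ⟨i, hi, hei⟩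
    · obtain ⟨idx, rfl, -⟩ := hE
      rw [List.map_cons, List.map_cons, List.cons.injEq] at h2
      refine ⟨E.rep, by simp, (hs.mem T hT).of_ty_eq h2.1.symm, fun j hj hjr => ?_⟩
      have hj' : j ∈ idx := (List.mem_cons.1 hj).resolve_left hjr
      have h6 : ty (c j) (toSet (assign (id :: E.others) (T :: M)).val) ∈
          M.map fun F => ty (c E.rep) (toSet F) := by
        rw [← h2.2]
        exact List.mem_map_of_mem
          (f := fun i => ty (c i) (toSet (assign (id :: E.others) (T :: M)).val)) hj'
      obtain ⟨T', hT', h7⟩ := List.mem_map.1 h6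
      exact (hn.mem T' (h5 T' hT')).of_ty_eq h7
    · have h6 : M.map List.length = List.replicate M.length (c E.rep).inner :=
        List.eq_replicate_iff.2 ⟨by simp, by
          intro x hx
          obtain ⟨T, hT, rfl⟩ := List.mem_map.1 hx
          simpa using hn.length T (h5 T hT)⟩
      have h7 : (I.map fun i => (c i).inner) = List.replicate I.length (c E.rep).inner :=
        List.eq_replicate_iff.2 ⟨by simp, by
          intro x hx
          obtain ⟨i, hi, rfl⟩ := List.mem_map.1 hx
          exact inner_eq_of_shape_eq (hE.shape_eq hi)⟩
      have h8 := hs.length T hT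
      rw [h3, List.map_cons, List.sum_cons, h6, h7, h4, ← hE.length_eq, List.replicate_succ,
        List.sum_cons, h8, Bool.toNat_true]
      omega
  · -- the only spanning type in the key determines the spanning tree
    rw [List.map_flatMap, List.nodup_flatMap]
    have hsn : ∀ T ∈ span, ∀ T' ∈ near,
        ty (c E.rep) (toSet T) ≠ ty (c E.rep) (toSet T') := fun T hT T' hT' h =>
      (hs.mem T hT).not_both (hc.isSP _) ((hn.mem T' hT').of_ty_eq h.symm)
    have hkey : ∀ T ∈ span, ∀ M ∈ (multisets E.others.length near).val,
        classKey c I (toSet (assign (id :: E.others) (T :: M)).val) =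
          ty (c E.rep) (toSet T) ::ₘ ↑(M.map fun F => ty (c E.rep) (toSet F)) :=
      fun T hT M hM => congrArg _ (hspec T hT M hM).2.1
    constructor
    · intro T hT
      rw [List.map_map]
      refine List.nodup_map_of_imp (nodup_map_multisets (fun F => ty (c E.rep) (toSet F))
        E.others.length hn.nodup) fun M hM M' hM' h => ?_
      rw [Function.comp_apply, Function.comp_apply, hkey T hT M hM, hkey T hT M' hM'] at h
      exact (Multiset.cons_inj_right _).1 h
    · have h0 := hs.nodup
      rw [List.Nodup, List.pairwise_map] at h0
      refine h0.imp_of_mem fun {T T'} hT hT' hne => ?_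
      rw [Function.onFun, List.disjoint_left]
      intro q h1 h2
      rw [List.map_map] at h1 h2
      obtain ⟨M, hM, rfl⟩ := List.mem_map.1 h1
      obtain ⟨M', hM', h⟩ := List.mem_map.1 h2
      rw [Function.comp_apply, Function.comp_apply, hkey T hT M hM, hkey T' hT' M' hM'] at h
      have h3 : ty (c E.rep) (toSet T) ∈ ty (c E.rep) (toSet T') ::ₘ
          (↑(M'.map fun F => ty (c E.rep) (toSet F)) : Multiset _) := by
        rw [h]
        exact Multiset.mem_cons_self _ _
      rcases Multiset.mem_cons.1 h3 with h3 | h3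
      · exact hne h3
      · rw [Multiset.mem_coe, List.mem_map] at h3
        obtain ⟨T'', hT'', h4⟩ := h3
        exact hsn T hT T'' ((mem_multisets hM').2 T'' hT'') h4.symm
  · obtain ⟨i, hi, h1, h2⟩ := hF
    obtain ⟨T, hT, h3⟩ := hE.exists_mem_ty_eq hs hi h1
    have hperm := List.perm_cons_erase hi
    obtain ⟨M, hM, h⟩ := exists_mem_multisets (fun F => ty (c E.rep) (toSet F))
      (m := E.others.length) (l := near) (q := classKey c (I.erase i) F)
      (by
        have := hE.length_eq
        simp only [classKey, Multiset.coe_card, List.length_map, List.length_erase_of_mem hi]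
        omega) (by
        intro x hx
        rw [classKey, Multiset.mem_coe, List.mem_map] at hx
        obtain ⟨j, hj, rfl⟩ := hx
        obtain ⟨hji, hj⟩ := (hI.mem_erase_iff).1 hj
        obtain ⟨T, hT, h⟩ := hE.exists_mem_ty_eq hn hj (h2 j hj hji)
        exact List.mem_map.2 ⟨T, hT, h⟩)
    refine ⟨_, List.mem_flatMap.2 ⟨T, hT, List.mem_map_of_mem hM⟩, ?_⟩
    have h4 : classKey c I (toSet (assign (id :: E.others) (T :: M)).val) =
        ty (c E.rep) (toSet T) ::ₘ ↑(M.map fun F => ty (c E.rep) (toSet F)) :=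
      congrArg _ (hspec T hT M hM).2.1
    rw [h4, h, h3]
    exact (Multiset.coe_eq_coe.2 (hperm.map fun i => ty (c i) F)).symm

end Class

end SPTree

namespace SPTree

open Timed

universe u

variable {V : Type u}

/-! ### Correctness at P-nodes -/

section Parallel

variable {k l : ℕ} {c : Fin k → SPTree V} {s t : V} {E : Fin l → IsoClass k V}
  {I : Fin l → List (Fin k)}

/-- The classes `E j`, with the sets of members `I j`, are the isomorphism classes of the principal
subgraphs `c i`. -/
structure IsPartition (c : Fin k → SPTree V) (E : Fin l → IsoClass k V)
    (I : Fin l → List (Fin k)) : Prop where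
  isClassOf : ∀ j, IsClassOf c (E j) (I j)
  perm : (List.ofFn I).flatten.Perm (List.finRange k)
  injective : Function.Injective fun j => shape (c (E j).rep)

theorem IsPartition.nodup (hI : IsPartition c E I) (j : Fin l) : (I j).Nodup := by
  have h := (hI.perm.nodup_iff).2 (List.nodup_finRange k)
  rw [List.nodup_flatten] at h
  exact h.1 _ ((List.mem_ofFn' _ _).2 ⟨j, rfl⟩)

theorem IsPartition.exists_mem (hI : IsPartition c E I) (i : Fin k) : ∃ j, i ∈ I j := by
  have h := hI.perm.mem_iff.2 (List.mem_finRange i)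
  obtain ⟨L, hL, hi⟩ := List.mem_flatten.1 h
  obtain ⟨j, rfl⟩ := (List.mem_ofFn' _ _).1 hL
  exact ⟨j, hi⟩

theorem IsPartition.mem_iff (hI : IsPartition c E I) {i : Fin k} {j : Fin l} :
    i ∈ I j ↔ shape (c i) = shape (c (E j).rep) := by
  refine ⟨fun h => (hI.isClassOf j).shape_eq h, fun h => ?_⟩
  obtain ⟨j', hj'⟩ := hI.exists_mem i
  rwa [hI.injective (h.symm.trans ((hI.isClassOf j').shape_eq hj'))]

theorem IsPartition.eq_of_mem (hI : IsPartition c E I) {i : Fin k} {j j' : Fin l} (h : i ∈ I j)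
    (h' : i ∈ I j') : j = j' :=
  hI.injective ((hI.mem_iff.1 h).symm.trans (hI.mem_iff.1 h'))

theorem IsPartition.sum_eq (hI : IsPartition c E I) (f : Fin k → ℕ) :
    ∑ j, ((I j).map f).sum = ∑ i, f i := by
  have h := (hI.perm.map f).sum_eq
  rw [List.map_flatten, List.sum_flatten, List.map_ofFn, List.map_ofFn, List.sum_ofFn,
    ← List.ofFn_eq_map, List.sum_ofFn] at h
  exact h

/-- The edges of the members of a class. -/
def classEdges (c : Fin k → SPTree V) (I : List (Fin k)) : Set (Sym2 V) := ⋃ i ∈ I, (c i).edges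

theorem IsPartition.disjoint_edges (hI : IsPartition c E I) (hc : IsBundle c s t) (j j' : Fin l)
    (h : j ≠ j') : Disjoint (classEdges c (I j)) (classEdges c (I j')) := by
  rw [Set.disjoint_left]
  intro e he he'
  obtain ⟨i, hi, hei⟩ := Set.mem_iUnion₂.1 he
  obtain ⟨i', hi', hei'⟩ := Set.mem_iUnion₂.1 he'
  refine Set.disjoint_left.1 (hc.disjoint i i' ?_) hei hei'
  rintro rfl
  exact h (hI.eq_of_mem hi hi')

theorem mem_edges_of_mem_classEdges {L : List (Fin k)} {e : Sym2 V} (he : e ∈ classEdges c L) :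
    e ∈ (parallel k c).edges := by
  obtain ⟨i, -, hi⟩ := Set.mem_iUnion₂.1 he
  exact mem_edges_node.2.2 ⟨i, hi⟩

theorem mem_classEdges {L : List (Fin k)} {i : Fin k} (hi : i ∈ L) {e : Sym2 V}
    (he : e ∈ (c i).edges) : e ∈ classEdges c L :=
  Set.mem_iUnion₂.2 ⟨i, hi, he⟩

/-- Two sets of edges are equivalent in a P-node if and only if they have the same types, counted
with multiplicity, on each isomorphism class of principal subgraphs. -/
theorem IsPartition.ty_eq_iff (hI : IsPartition c E I) {F F' : Set (Sym2 V)} :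
    ty (parallel k c) F = ty (parallel k c) F' ↔
      ∀ j, classKey c (I j) F = classKey c (I j) F' := by
  classical
  rw [ty_parallel_eq]
  constructor
  · intro h j
    -- the class `I j` is cut out by the shape of its representative
    have key : ∀ F, classKey c (I j) F =
        (Finset.univ.val.map fun i => ty (c i) F).filter
          fun q => ∃ D F, q = ty D F ∧ shape D = shape (c (E j).rep) := by
      intro F
      have h1 : (↑(I j) : Multiset (Fin k)) =
          Finset.univ.val.filter fun i => shape (c i) = shape (c (E j).rep) := by
        refine (Multiset.Nodup.ext (Multiset.coe_nodup.2 (hI.nodup j))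
          (Finset.univ.nodup.filter _)).2 fun i => ?_
        simp [hI.mem_iff]
      rw [Multiset.filter_map, classKey, ← Multiset.map_coe, h1]
      congr 1
      refine Multiset.filter_congr fun i _ => ⟨fun h => ⟨_, _, rfl, h⟩, ?_⟩
      rintro ⟨D, F', h2, h3⟩
      exact (shape_eq_of_ty_eq h2).trans h3
    rw [key, key, h]
  · intro h
    have key : ∀ F, (Finset.univ.val.map fun i => ty (c i) F) = ∑ j, classKey c (I j) F := by
      intro F
      rw [Fin.univ_val_map, List.ofFn_eq_map,
        ← Multiset.coe_eq_coe.2 (hI.perm.map fun i => ty (c i) F), List.map_flatten, List.map_ofFn,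
        ← List.sum_ofFn]
      have h2 : ∀ L : List (List (Quotient (markedSetoid V))),
          Multiset.ofList L.flatten = (L.map Multiset.ofList).sum := by
        intro L
        induction L with
        | nil => rfl
        | cons a L ih => rw [List.flatten_cons, ← Multiset.coe_add, ih, List.map_cons, List.sum_cons]
      rw [h2, List.map_ofFn]
      rfl
    rw [key, key]
    exact Finset.sum_congr rfl fun j _ => h j

variable {span near : Fin l → List (Forest V)}

theorem parallelNear_val : (parallelNear E near).val =
    (unions ((List.finRange l).map fun j => (classNear (E j) (near j)).val)).val := by
  simp [parallelNear]

theorem parallelSpan_val : (parallelSpan E span near).val =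
    specialUnions (fun j => (classSpan (E j) (span j) (near j)).val)
      fun j => (classNear (E j) (near j)).val := by
  simp only [parallelSpan, specialUnions, bind_val, mapList_val, flatten_val]
  refine congrArg _ (List.map_congr_left fun i _ => ?_)
  refine congrArg (fun x => (unions x).val) (List.map_congr_left fun j _ => ?_)
  split_ifs <;> rfl

theorem IsPartition.lists_near (hI : IsPartition c E I) (hc : IsBundle c s t)
    (hn : ∀ j, Lists (c (E j).rep) false (near j)) :
    Lists (parallel k c) false (parallelNear E near).val := by
  have hcl := fun j => classNear_spec hc (hI.isClassOf j) (hI.nodup j) (hn j)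
  have hE := hI.disjoint_edges hc
  have hL : ∀ j ∈ List.finRange l, ∀ F ∈ (classNear (E j) (near j)).val, ∀ e ∈ F,
      e ∈ classEdges c (I j) := fun j _ F hF => ((hcl j).1 F hF).1
  have hpart : ∀ F ∈ (unions ((List.finRange l).map fun j =>
      (classNear (E j) (near j)).val)).val, _ := fun F hF =>
    eq_on_part_of_mem_unions (List.nodup_finRange l) hE hL hF
  rw [parallelNear_val]
  refine ⟨fun F hF e he => ?_, fun F hF i => ?_, ?_, fun F hF => ?_, fun F hF => ?_⟩
  · obtain ⟨j, -, hj⟩ := (hpart F hF).1 e he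
    exact mem_edges_of_mem_classEdges hj
  · obtain ⟨j, hj⟩ := hI.exists_mem i
    obtain ⟨T, hT, h⟩ := (hpart F hF).2 j (List.mem_finRange j)
    exact (((hcl j).1 T hT).2.1 i hj).congr fun e he => (h e (mem_classEdges hj he)).symm
  · refine List.nodup_map_of_imp (nodup_unions (κ := fun j F => classKey c (I j) F)
      (List.nodup_finRange l) hE hL (fun j F F' h => classKey_congr h)
      fun j _ => (hcl j).2.1) ?_
    intro F _ F' _ h
    exact List.map_congr_left fun j _ => hI.ty_eq_iff.1 h j
  · obtain ⟨T, hT, h⟩ := exists_mem_unions (κ := fun j F => classKey c (I j) F)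
      (List.nodup_finRange l) hE hL (fun j F F' h => classKey_congr h)
      (fun j => classKey c (I j) F) fun j _ => (hcl j).2.2 F fun i _ => hF i
    exact ⟨T, hT, hI.ty_eq_iff.2 fun j => h j (List.mem_finRange j)⟩
  · rw [length_of_mem_unions (fun j _ F hF => ((hcl j).1 F hF).2.2) hF, ← List.ofFn_eq_map,
      List.sum_ofFn, hI.sum_eq]
    simp [inner]

theorem IsPartition.lists_span (hI : IsPartition c E I) (hc : IsBundle c s t)
    (hs : ∀ j, Lists (c (E j).rep) true (span j)) (hn : ∀ j, Lists (c (E j).rep) false (near j)) :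
    Lists (parallel k c) true (parallelSpan E span near).val := by
  have hA := fun j => classSpan_spec hc (hI.isClassOf j) (hI.nodup j) (hs j) (hn j)
  have hB := fun j => classNear_spec hc (hI.isClassOf j) (hI.nodup j) (hn j)
  have hE := hI.disjoint_edges hc
  have hLA : ∀ j, ∀ F ∈ (classSpan (E j) (span j) (near j)).val, ∀ e ∈ F,
      e ∈ classEdges c (I j) := fun j F hF => ((hA j).1 F hF).1
  have hLB : ∀ j, ∀ F ∈ (classNear (E j) (near j)).val, ∀ e ∈ F,
      e ∈ classEdges c (I j) := fun j F hF => ((hB j).1 F hF).1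
  rw [parallelSpan_val]
  refine ⟨fun F hF e he => ?_, fun F hF => ?_, ?_, fun F hF => ?_, fun F hF => ?_⟩
  · obtain ⟨j, hj⟩ := (eq_on_part_of_mem_specialUnions hE hLA hLB hF).1 e he
    exact mem_edges_of_mem_classEdges hj
  · obtain ⟨j, ⟨T, hT, h1⟩, h2⟩ := (eq_on_part_of_mem_specialUnions hE hLA hLB hF).2
    obtain ⟨i, hi, h3, h4⟩ := ((hA j).1 T hT).2.1
    refine ⟨i, h3.congr fun e he => (h1 e (mem_classEdges hi he)).symm, fun i' hi' => ?_⟩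
    obtain ⟨j', hj'⟩ := hI.exists_mem i'
    by_cases hjj : j' = j
    · subst hjj
      exact (h4 i' hj' hi').congr fun e he => (h1 e (mem_classEdges hj' he)).symm
    · obtain ⟨T', hT', h5⟩ := h2 j' hjj
      exact (((hB j').1 T' hT').2.1 i' hj').congr fun e he =>
        (h5 e (mem_classEdges hj' he)).symm
  · refine List.nodup_map_of_imp (nodup_specialUnions (κ := fun j F => classKey c (I j) F) hE
      hLA hLB (fun j F F' h => classKey_congr h) (fun j => (hA j).2.1) (fun j => (hB j).2.1) ?_) ?_
    · intro j F hF F' hF' h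
      obtain ⟨i, hi, h1, -⟩ := ((hA j).1 F hF).2.1
      have h2 : ty (c i) (toSet F) ∈ classKey c (I j) (toSet F) := by
        rw [classKey, Multiset.mem_coe]
        exact List.mem_map_of_mem (f := fun i => ty (c i) (toSet F)) hi
      rw [h, classKey, Multiset.mem_coe, List.mem_map] at h2
      obtain ⟨i', hi', h3⟩ := h2
      exact h1.not_both (hc.isSP i) ((((hB j).1 F' hF').2.1 i' hi').of_ty_eq h3)
    · intro F _ F' _ h
      exact List.map_congr_left fun j _ => hI.ty_eq_iff.1 h j
  · obtain ⟨i, h1, h2⟩ := hF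
    obtain ⟨j, hj⟩ := hI.exists_mem i
    obtain ⟨T, hT, h⟩ := exists_mem_specialUnions (κ := fun j F => classKey c (I j) F) hE hLA hLB
      (fun j F F' h => classKey_congr h) (fun j => classKey c (I j) F) j
      ((hA j).2.2 F ⟨i, hj, h1, fun i' _ hi' => h2 i' hi'⟩) fun j' hj' =>
        (hB j').2.2 F fun i' hi' => h2 i' fun h => hj' (hI.eq_of_mem (h ▸ hi') hj)
    exact ⟨T, hT, hI.ty_eq_iff.2 h⟩
  · obtain ⟨j, hj⟩ := length_of_mem_specialUnions (fun j F hF => ((hA j).1 F hF).2.2)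
      (fun j F hF => ((hB j).1 F hF).2.2) hF
    rw [hI.sum_eq] at hj
    simp only [inner, Bool.toNat_true]
    omega

end Parallel

/-! ### Correctness of the generation algorithms -/

section Algorithms

variable [DecidableEq V]

theorem bothTrees_series_val {k : ℕ} (c : Fin k → SPTree V) :
    (bothTrees (series k c)).val = ((seriesSpan fun i => (bothTrees (c i)).val.1).val,
      (seriesNear (fun i => (bothTrees (c i)).val.1) fun i => (bothTrees (c i)).val.2).val) := rfl

theorem bothTrees_parallel_val {k : ℕ} (c : Fin k → SPTree V) :
    (bothTrees (parallel k c)).val =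
      ((parallelSpan (isoClasses c).val.get
          (fun j => (bothTrees (c ((isoClasses c).val.get j).rep)).val.1)
          fun j => (bothTrees (c ((isoClasses c).val.get j).rep)).val.2).val,
        (parallelNear (isoClasses c).val.get
          fun j => (bothTrees (c ((isoClasses c).val.get j).rep)).val.2).val) := rfl

theorem IsBundle.exists_isPartition {k : ℕ} {c : Fin k → SPTree V} {s t : V}
    (hc : IsBundle c s t) : ∃ I, IsPartition c (isoClasses c).val.get I := by
  obtain ⟨I, h1, h2, h3⟩ := isoClasses_spec (fun _ => s) (fun _ => t) hc.isSP
  exact ⟨I, h1, h2, h3⟩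

theorem IsSP.lists_bothTrees {D : SPTree V} {s t : V} (h : D.IsSP s t) :
    Lists D true D.bothTrees.val.1 ∧ Lists D false D.bothTrees.val.2 := by
  induction D generalizing s t with
  | edge u v => exact lists_edge u v
  | series k c ih =>
    obtain ⟨p, rfl, rfl, hc⟩ := isSP_series_iff.1 h
    rw [bothTrees_series_val]
    have hs := fun i => (ih i (hc.isSP i)).1
    have hn := fun i => (ih i (hc.isSP i)).2
    exact ⟨hc.lists_span hs, hc.lists_near hs hn⟩
  | parallel k c ih =>
    have hc := isSP_parallel_iff.1 h
    obtain ⟨I, hI⟩ := hc.exists_isPartition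
    rw [bothTrees_parallel_val]
    have hs := fun j => (ih ((isoClasses c).val.get j).rep (hc.isSP _)).1
    have hn := fun j => (ih ((isoClasses c).val.get j).rep (hc.isSP _)).2
    exact ⟨hI.lists_span hc hs hn, hI.lists_near hc hn⟩

theorem IsSP.lists_spanningTrees {D : SPTree V} {s t : V} (h : D.IsSP s t) :
    Lists D true D.spanningTrees.val := by
  induction D generalizing s t with
  | edge u v => exact (lists_edge u v).1
  | series k c ih =>
    obtain ⟨p, rfl, rfl, hc⟩ := isSP_series_iff.1 h
    exact hc.lists_span fun i => ih i (hc.isSP i)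
  | parallel k c ih => exact h.lists_bothTrees.1

end Algorithms

end SPTree

namespace SPTree

open Timed

universe u

variable {V : Type u}

/-! ### The numbers of listed forests -/

theorem sum_map_finRange {k : ℕ} (f : Fin k → ℕ) :
    ((List.finRange k).map f).sum = ∑ i, f i := by
  rw [← List.ofFn_eq_map, List.sum_ofFn]

theorem prod_map_finRange {k : ℕ} (f : Fin k → ℕ) :
    ((List.finRange k).map f).prod = ∏ i, f i := by
  rw [← List.ofFn_eq_map, List.prod_ofFn]

theorem length_unions_finRange {k : ℕ} (L : Fin k → List (Forest V)) :
    (unions ((List.finRange k).map L)).val.length = ∏ j, (L j).length := by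
  rw [length_unions, List.map_map, prod_map_finRange]
  rfl

theorem length_specialUnions {k : ℕ} (A B : Fin k → List (Forest V)) :
    (specialUnions A B).length = ∑ i, ∏ j, if j = i then (A j).length else (B j).length := by
  rw [specialUnions, List.length_flatten, List.map_map, sum_map_finRange]
  refine Finset.sum_congr rfl fun i _ => ?_
  rw [Function.comp_apply, length_unions_finRange]
  exact Finset.prod_congr rfl fun j _ => by split_ifs <;> rfl

theorem length_classNear {k : ℕ} (E : IsoClass k V) (near : List (Forest V)) :
    (classNear E near).val.length = Nat.multichoose near.length (E.others.length + 1) := by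
  rw [classNear_val, List.length_map, length_multisets]

theorem length_classSpan {k : ℕ} (E : IsoClass k V) (span near : List (Forest V)) :
    (classSpan E span near).val.length =
      span.length * Nat.multichoose near.length E.others.length := by
  simp [classSpan_val, List.length_flatMap, length_multisets]

section Numbers

variable {k : ℕ} {a b : Fin k → ℕ}

theorem le_prod_of_pos {f : Fin k → ℕ} (hf : ∀ i, 0 < f i) (i : Fin k) : f i ≤ ∏ j, f j :=
  Nat.le_of_dvd (Finset.prod_pos fun j _ => hf j) (Finset.dvd_prod_of_mem f (Finset.mem_univ i))

theorem le_prod_special (ha : ∀ i, 0 < a i) (hb : ∀ i, 0 < b i) (i : Fin k) :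
    a i ≤ (∏ j, if j = i then a j else b j) ∧
      ∀ j, j ≠ i → b j ≤ ∏ j, if j = i then a j else b j := by
  have hpos : ∀ j, 0 < if j = i then a j else b j := fun j => by split_ifs; exacts [ha j, hb j]
  refine ⟨by simpa using le_prod_of_pos hpos i, fun j hj => ?_⟩
  simpa [hj] using le_prod_of_pos hpos j

/-- Each term of the sum bounds one special factor, and each ordinary factor other than that. -/
theorem add_le_sum_special (ha : ∀ i, 0 < a i) (hb : ∀ i, 0 < b i) (hk : 2 ≤ k) (i : Fin k) :
    a i + b i ≤ ∑ i, ∏ j, if j = i then a j else b j := by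
  have : Nontrivial (Fin k) := Fin.nontrivial_iff_two_le.2 hk
  obtain ⟨i', hi'⟩ := exists_ne i
  have h1 := (le_prod_special ha hb i).1
  have h2 := (le_prod_special ha hb i').2 i hi'.symm
  refine (Nat.add_le_add h1 h2).trans ?_
  rw [← Finset.sum_pair (f := fun i => ∏ j, if j = i then a j else b j) hi'.symm]
  exact Finset.sum_le_sum_of_subset (Finset.subset_univ _)

theorem sum_le_sum_special (ha : ∀ i, 0 < a i) (hb : ∀ i, 0 < b i) (hk : 2 ≤ k) :
    ∑ i, b i ≤ ∑ i, ∏ j, if j = i then a j else b j := by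
  have hz : NeZero k := ⟨by omega⟩
  -- the term that bounds `b i` is the one with the next index, in cyclic order
  rw [← Equiv.sum_comp (Equiv.addRight (1 : Fin k))
    fun i => ∏ j, if j = i then a j else b j]
  refine Finset.sum_le_sum fun i _ => (le_prod_special ha hb _).2 i fun h => ?_
  have h1 : (1 : Fin k) = 0 := by simpa using h.symm
  have h2 := congrArg Fin.val h1
  rw [Fin.val_one', Fin.val_zero, Nat.mod_eq_of_lt (by omega)] at h2
  exact one_ne_zero h2

end Numbers

theorem le_multichoose_succ (n e : ℕ) : n ≤ Nat.multichoose n (e + 1) := by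
  induction n with
  | zero => simp
  | succ n ih =>
    rw [Nat.multichoose_succ_succ]
    have := multichoose_pos (n := n + 1) (by omega) e
    omega

theorem one_add_mul_le_multichoose (n e : ℕ) : 1 + n * e ≤ Nat.multichoose (n + 1) e := by
  induction e with
  | zero => simp
  | succ e ih =>
    rw [Nat.multichoose_succ_succ]
    have := le_multichoose_succ n e
    nlinarith

/-! ### The costs of the parts of the algorithms -/

theorem IsSP.inner_lt_esize {D : SPTree V} {s t : V} (h : D.IsSP s t) : D.inner < D.esize := by
  induction D generalizing s t with
  | edge u v => exact Nat.one_pos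
  | series k c ih =>
    obtain ⟨p, rfl, rfl, hc⟩ := isSP_series_iff.1 h
    have hk := hc.two_le
    have h1 : ∑ i, ((c i).inner + 1) ≤ ∑ i, (c i).esize :=
      Finset.sum_le_sum fun i _ => ih i (hc.isSP i)
    rw [Finset.sum_add_distrib] at h1
    simp only [Finset.sum_const, Finset.card_univ, Fintype.card_fin, smul_eq_mul, mul_one] at h1
    simp only [esize, inner]
    omega
  | parallel k c ih =>
    have hc := isSP_parallel_iff.1 h
    have hk := hc.two_le
    exact Finset.sum_lt_sum_of_nonempty ⟨⟨0, by omega⟩, by simp⟩ fun i _ => ih i (hc.isSP i)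

theorem unions_finRange_steps_le {k : ℕ} (L : Fin k → List (Forest V)) {w : Fin k → ℕ}
    (hL : ∀ j, L j ≠ []) (hw : ∀ j, ∀ F ∈ L j, F.length = w j) :
    (unions ((List.finRange k).map L)).steps ≤ (9 * k + ∑ j, w j + 4) * ∏ j, (L j).length := by
  have h := unions_steps_le (List.finRange k) L (fun j _ => hL j) fun j _ => hw j
  rwa [List.length_finRange, sum_map_finRange, prod_map_finRange] at h

section SeriesCost

variable {k m : ℕ} {span near : Fin k → List (Forest V)} {w : Fin k → ℕ}

theorem seriesSpan_steps (span : Fin k → List (Forest V)) : (seriesSpan span).steps =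
    2 * k + 1 + (unions ((List.finRange k).map span)).steps := by
  simp [seriesSpan]
  ring

theorem seriesSpan_steps_le (hk : 0 < k) (hkm : k ≤ m) (hwm : ∑ j, w j ≤ m)
    (hs : ∀ j, span j ≠ []) (hw : ∀ j, ∀ F ∈ span j, F.length = w j) :
    (seriesSpan span).steps ≤ 17 * m * ∏ j, (span j).length := by
  have h1 := unions_finRange_steps_le span hs hw
  have h2 : 0 < ∏ j, (span j).length :=
    Finset.prod_pos fun j _ => List.length_pos_iff.2 (hs j)
  rw [seriesSpan_steps]
  generalize ∏ j, (span j).length = S at *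
  have h3 : (9 * k + ∑ j, w j + 4) * S ≤ 14 * m * S := Nat.mul_le_mul_right _ (by omega)
  nlinarith

theorem seriesNear_steps (span near : Fin k → List (Forest V)) : (seriesNear span near).steps =
    ∑ i, (2 * k + 3 + (unions ((List.finRange k).map fun j =>
      if j = i then near j else span j)).steps +
        ∏ j, (if j = i then (near j).length else (span j).length)) + 2 := by
  have h : ∀ i, (unions ((List.finRange k).map fun j =>
      if j = i then near j else span j)).val.length =
        ∏ j, (if j = i then (near j).length else (span j).length) := fun i => by
    rw [length_unions_finRange]
    exact Finset.prod_congr rfl fun j _ => by split_ifs <;> rfl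
  simp only [seriesNear, bind_steps, mapList_steps, mapList_val, bind_val, pure_val, tick_steps,
    pure_steps, flatten_steps, List.map_map, Function.comp_def, h, sum_map_finRange]
  simp only [Finset.sum_add_distrib, Finset.sum_const, Finset.card_univ, Fintype.card_fin,
    smul_eq_mul]
  ring

theorem seriesNear_steps_le (hk : 2 ≤ k) (hkm : k ≤ m) (hwm : ∑ j, (w j + 1) ≤ m)
    (hs : ∀ j, span j ≠ []) (hn : ∀ j, near j ≠ []) (hws : ∀ j, ∀ F ∈ span j, F.length = w j + 1)
    (hwn : ∀ j, ∀ F ∈ near j, F.length = w j) :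
    (seriesNear span near).steps ≤
      22 * m * ∑ i, ∏ j, if j = i then (near j).length else (span j).length := by
  have hn' := fun j => List.length_pos_iff.2 (hn j)
  have hs' := fun j => List.length_pos_iff.2 (hs j)
  have h1 : ∀ i, (unions ((List.finRange k).map fun j => if j = i then near j else span j)).steps ≤
      14 * m * ∏ j, if j = i then (near j).length else (span j).length := by
    intro i
    have h2 := unions_finRange_steps_le (fun j => if j = i then near j else span j)
      (w := fun j => if j = i then w j else w j + 1)
      (fun j => by split_ifs; exacts [hn j, hs j]) (fun j => by split_ifs; exacts [hwn j, hws j])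
    have h3 : ∑ j, (if j = i then w j else w j + 1) ≤ m :=
      (Finset.sum_le_sum fun j _ => by split_ifs <;> omega).trans hwm
    refine h2.trans (Nat.mul_le_mul (by omega) (le_of_eq ?_))
    exact Finset.prod_congr rfl fun j _ => by split_ifs <;> rfl
  have h4 : k ≤ ∑ i, ∏ j, if j = i then (near j).length else (span j).length := by
    have h5 := Finset.sum_le_sum (f := fun _ => 1) fun i (_ : i ∈ Finset.univ) =>
      Nat.succ_le_of_lt (hs' i)
    have h6 := sum_le_sum_special hn' hs' hk
    simp only [Finset.sum_const, Finset.card_univ, Fintype.card_fin, smul_eq_mul, mul_one] at h5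
    exact h5.trans h6
  have h7 := Finset.sum_le_sum fun i (_ : i ∈ Finset.univ) => h1 i
  rw [← Finset.mul_sum] at h7
  rw [seriesNear_steps]
  simp only [Finset.sum_add_distrib, Finset.sum_const, Finset.card_univ, Fintype.card_fin,
    smul_eq_mul]
  generalize (∑ i, ∏ j, if j = i then (near j).length else (span j).length) = N at *
  have h8 : k * k ≤ m * N := Nat.mul_le_mul hkm h4
  have h9 : N ≤ m * N := Nat.le_mul_of_pos_left _ (by omega)
  nlinarith

end SeriesCost

section ParallelCost

variable {k l m : ℕ}

theorem assign_steps_le (ρs : List (V → V)) (Fs : List (Forest V)) (hl : Fs.length = ρs.length)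
    {w : ℕ} (hw : ∀ F ∈ Fs, F.length ≤ w) :
    (assign ρs Fs).steps ≤ Fs.length * (3 * w + 2) + 1 := by
  induction Fs generalizing ρs with
  | nil =>
    obtain rfl := List.length_eq_zero_iff.1 hl.symm
    simp [assign]
  | cons F Fs ih =>
    cases ρs with
    | nil => simp at hl
    | cons ρ ρs =>
      rw [assign_cons_steps, List.length_cons]
      have h1 := ih ρs (by simpa using hl) fun F' hF' => hw F' (List.mem_cons_of_mem _ hF')
      have h2 := hw F (by simp)
      nlinarith

theorem classNear_steps_le (E : IsoClass k V) {near : List (Forest V)} (hn : near ≠ []) {w : ℕ}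
    (hw : ∀ F ∈ near, F.length = w) : (classNear E near).steps ≤
      25 * ((E.others.length + 1) * (w + 1)) * (classNear E near).val.length := by
  have h1 : (classNear E near).steps = E.others.length + 1 +
      ((multisets (E.others.length + 1) near).steps +
        (((multisets (E.others.length + 1) near).val.map fun M =>
          (assign (id :: E.others) M).steps + 1).sum + 1)) := by
    simp [classNear]
  have h2 : ∀ x ∈ (multisets (E.others.length + 1) near).val.map
      (fun M => (assign (id :: E.others) M).steps + 1),
      x ≤ (E.others.length + 1) * (3 * w + 2) + 2 := by
    intro x hx
    obtain ⟨M, hM, rfl⟩ := List.mem_map.1 hx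
    obtain ⟨h3, h4⟩ := mem_multisets hM
    have h5 := assign_steps_le (id :: E.others) M (by simp [h3])
      fun F hF => (hw F (h4 F hF)).le
    rw [h3] at h5
    omega
  have h3 := List.sum_le_card_nsmul _ _ h2
  have h4 := multisets_steps_le (E.others.length + 1) near hn
  have h5 := multichoose_pos (List.length_pos_iff.2 hn) (E.others.length + 1)
  rw [List.length_map, length_multisets, smul_eq_mul] at h3
  rw [h1, length_classNear]
  generalize Nat.multichoose near.length (E.others.length + 1) = M at *
  generalize he : E.others.length + 1 = e at *
  have h6 : 1 ≤ e := by omega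
  have h7 : e ≤ e * M := Nat.le_mul_of_pos_right _ h5
  have h8 : M ≤ e * M := Nat.le_mul_of_pos_left _ h6
  have h9 : 25 * (e * (w + 1)) * M = 25 * (e * M * w) + 25 * (e * M) := by ring
  have h10 : M * (e * (3 * w + 2) + 2) = 3 * (e * M * w) + 2 * (e * M) + 2 * M := by ring
  have h11 : 7 * (e + 1) * M = 7 * (e * M) + 7 * M := by ring
  have h12 : 0 ≤ e * M * w := Nat.zero_le _
  rw [h10] at h3
  rw [h11] at h4
  rw [h9]
  omega

theorem classSpan_steps_le (E : IsoClass k V) {span near : List (Forest V)} (hs : span ≠ [])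
    (hn : near ≠ []) {w : ℕ} (hws : ∀ F ∈ span, F.length = w + 1)
    (hwn : ∀ F ∈ near, F.length = w) : (classSpan E span near).steps ≤
      25 * ((E.others.length + 1) * (w + 1)) * (classSpan E span near).val.length := by
  have h1 : (classSpan E span near).steps = E.others.length + 1 +
      ((multisets E.others.length near).steps +
        ((span.map fun T => (((multisets E.others.length near).val.map fun M =>
          (assign (id :: E.others) (T :: M)).steps + 1).sum + 1) + 1).sum + 1 +
            (span.length * (Nat.multichoose near.length E.others.length + 1) + 1))) := by
    simp [classSpan, Function.comp_def, length_multisets]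
  have h2 : ∀ x ∈ span.map (fun T => (((multisets E.others.length near).val.map fun M =>
      (assign (id :: E.others) (T :: M)).steps + 1).sum + 1) + 1),
      x ≤ Nat.multichoose near.length E.others.length *
        ((E.others.length + 1) * (3 * (w + 1) + 2) + 2) + 2 := by
    intro x hx
    obtain ⟨T, hT, rfl⟩ := List.mem_map.1 hx
    have h3 : ∀ x ∈ (multisets E.others.length near).val.map
        (fun M => (assign (id :: E.others) (T :: M)).steps + 1),
        x ≤ (E.others.length + 1) * (3 * (w + 1) + 2) + 2 := by
      intro x hx
      obtain ⟨M, hM, rfl⟩ := List.mem_map.1 hx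
      obtain ⟨h3, h4⟩ := mem_multisets hM
      have h5 := assign_steps_le (id :: E.others) (T :: M) (by simp [h3]) (w := w + 1) (by
        intro F hF
        rcases List.mem_cons.1 hF with rfl | hF
        · exact (hws F hT).le
        · exact (hwn F (h4 F hF)).le.trans (Nat.le_succ _))
      rw [List.length_cons, h3] at h5
      omega
    have h4 := List.sum_le_card_nsmul _ _ h3
    rw [List.length_map, length_multisets, smul_eq_mul] at h4
    omega
  have h3 := List.sum_le_card_nsmul _ _ h2
  have h4 := multisets_steps_le E.others.length near hn
  have h5 := multichoose_pos (List.length_pos_iff.2 hn) E.others.length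
  have h6 := List.length_pos_iff.2 hs
  rw [List.length_map, smul_eq_mul] at h3
  rw [h1, length_classSpan]
  generalize Nat.multichoose near.length E.others.length = M at *
  generalize he : E.others.length + 1 = e at *
  generalize span.length = s at *
  have h7 : 1 ≤ e := by omega
  have hsM : 1 ≤ s * M := Nat.mul_pos h6 h5
  have h8 : s ≤ s * M := Nat.le_mul_of_pos_right _ h5
  have h9 : M ≤ s * M := Nat.le_mul_of_pos_left _ h6
  have h10 : s * M ≤ e * (s * M) := Nat.le_mul_of_pos_left _ h7
  have h11 : e ≤ e * (s * M) := Nat.le_mul_of_pos_right _ hsM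
  have h12 : e * M ≤ e * (s * M) := Nat.mul_le_mul_left _ h9
  have h13 : 25 * (e * (w + 1)) * (s * M) = 25 * (e * (s * M) * w) + 25 * (e * (s * M)) := by ring
  have h14 : s * (M * (e * (3 * (w + 1) + 2) + 2) + 2) =
      3 * (e * (s * M) * w) + 5 * (e * (s * M)) + 2 * (s * M) + 2 * s := by ring
  have h15 : 7 * e * M = 7 * (e * M) := by ring
  have h16 : s * (M + 1) = s * M + s := by ring
  have h17 : 0 ≤ e * (s * M) * w := Nat.zero_le _
  rw [h14] at h3
  rw [h15] at h4
  rw [h13, h16]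
  omega

variable {E : Fin l → IsoClass k V} {span near : Fin l → List (Forest V)} {w : Fin l → ℕ}

theorem parallelNear_steps (E : Fin l → IsoClass k V) (near : Fin l → List (Forest V)) :
    (parallelNear E near).steps = ∑ j, ((classNear (E j) (near j)).steps + 1) + 1 +
      (unions ((List.finRange l).map fun j => (classNear (E j) (near j)).val)).steps := by
  simp only [parallelNear, bind_steps, mapList_steps, mapList_val, sum_map_finRange,
    add_assoc]

theorem parallelSpan_steps (E : Fin l → IsoClass k V) (span near : Fin l → List (Forest V)) :
    (parallelSpan E span near).steps =
      ∑ i, (∑ j, ((if j = i then (classSpan (E j) (span j) (near j)).steps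
          else (classNear (E j) (near j)).steps) + 1) + 3 +
        (unions ((List.finRange l).map fun j => if j = i then
          (classSpan (E j) (span j) (near j)).val else (classNear (E j) (near j)).val)).steps +
        ∏ j, if j = i then (classSpan (E j) (span j) (near j)).val.length
          else (classNear (E j) (near j)).val.length) + 2 := by
  have h1 : ∀ i j, (if j = i then classSpan (E j) (span j) (near j)
      else classNear (E j) (near j)).steps = if j = i then (classSpan (E j) (span j) (near j)).steps
          else (classNear (E j) (near j)).steps := fun i j => by split_ifs <;> rfl
  have h2 : ∀ i j, (if j = i then classSpan (E j) (span j) (near j)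
      else classNear (E j) (near j)).val = if j = i then (classSpan (E j) (span j) (near j)).val
          else (classNear (E j) (near j)).val := fun i j => by split_ifs <;> rfl
  have h3 : ∀ i, (unions ((List.finRange l).map fun j => if j = i then
      (classSpan (E j) (span j) (near j)).val else (classNear (E j) (near j)).val)).val.length =
        ∏ j, if j = i then (classSpan (E j) (span j) (near j)).val.length
          else (classNear (E j) (near j)).val.length := fun i => by
    rw [length_unions_finRange]
    exact Finset.prod_congr rfl fun j _ => by split_ifs <;> rfl
  simp only [parallelSpan, bind_steps, mapList_steps, mapList_val, bind_val, flatten_steps,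
    List.map_map, Function.comp_def, h1, h2, h3, sum_map_finRange]
  simp only [Finset.sum_add_distrib, Finset.sum_const, Finset.card_univ, Fintype.card_fin,
    smul_eq_mul]
  ring

variable {c : Fin k → SPTree V} {s t : V} {I : Fin l → List (Fin k)}

/-- The number of edges of the graph of a P-node, summed up over the classes. -/
theorem IsPartition.sum_esize (hI : IsPartition c E I) :
    ∑ j, ((E j).others.length + 1) * (c (E j).rep).esize = (parallel k c).esize := by
  change _ = ∑ i, (c i).esize
  rw [← hI.sum_eq]
  refine Finset.sum_congr rfl fun j _ => ?_
  have h : ((I j).map fun i => (c i).esize) =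
      List.replicate (I j).length (c (E j).rep).esize :=
    List.eq_replicate_iff.2 ⟨by simp, by
      intro x hx
      obtain ⟨i, hi, rfl⟩ := List.mem_map.1 hx
      exact esize_eq_of_shape_eq ((hI.isClassOf j).shape_eq hi)⟩
  rw [h, List.sum_replicate, smul_eq_mul, (hI.isClassOf j).length_eq]

theorem IsPartition.sum_inner (hI : IsPartition c E I) :
    ∑ j, ((I j).map fun i => (c i).inner).sum = (parallel k c).inner :=
  hI.sum_eq _

theorem IsPartition.classes_pos (hI : IsPartition c E I) (hc : IsBundle c s t) : 0 < l := by
  have := hc.two_le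
  obtain ⟨j, -⟩ := hI.exists_mem ⟨0, by omega⟩
  exact j.pos

theorem IsPartition.le_esize (hI : IsPartition c E I) (hc : IsBundle c s t) :
    l ≤ (parallel k c).esize := by
  rw [← hI.sum_esize]
  have h := Finset.sum_le_sum (f := fun _ => 1) fun j (_ : j ∈ Finset.univ) =>
    Nat.succ_le_of_lt (Nat.mul_pos (Nat.succ_pos (E j).others.length)
      (hc.isSP (E j).rep).esize_pos)
  simpa using h

theorem IsPartition.classNear_cost (hc : IsBundle c s t)
    (hn : ∀ j, Lists (c (E j).rep) false (near j)) (hn0 : ∀ j, near j ≠ []) (j : Fin l) :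
    (classNear (E j) (near j)).steps ≤ 25 * (((E j).others.length + 1) * (c (E j).rep).esize) *
      (classNear (E j) (near j)).val.length := by
  refine (classNear_steps_le (E j) (hn0 j) (w := (c (E j).rep).inner) (hn j).length).trans ?_
  have := (hc.isSP (E j).rep).inner_lt_esize
  gcongr
  omega

theorem IsPartition.classSpan_cost (hc : IsBundle c s t)
    (hs : ∀ j, Lists (c (E j).rep) true (span j)) (hs0 : ∀ j, span j ≠ [])
    (hn : ∀ j, Lists (c (E j).rep) false (near j)) (hn0 : ∀ j, near j ≠ []) (j : Fin l) :
    (classSpan (E j) (span j) (near j)).steps ≤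
      25 * (((E j).others.length + 1) * (c (E j).rep).esize) *
        (classSpan (E j) (span j) (near j)).val.length := by
  refine (classSpan_steps_le (E j) (hs0 j) (hn0 j) (w := (c (E j).rep).inner) (hs j).length
    (hn j).length).trans ?_
  have := (hc.isSP (E j).rep).inner_lt_esize
  gcongr
  omega

theorem classNear_length_pos (E : IsoClass k V) {near : List (Forest V)} (hn : near ≠ []) :
    0 < (classNear E near).val.length := by
  rw [length_classNear]
  exact multichoose_pos (List.length_pos_iff.2 hn) _

theorem classSpan_length_pos (E : IsoClass k V) {span near : List (Forest V)} (hs : span ≠ [])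
    (hn : near ≠ []) : 0 < (classSpan E span near).val.length := by
  rw [length_classSpan]
  exact Nat.mul_pos (List.length_pos_iff.2 hs) (multichoose_pos (List.length_pos_iff.2 hn) _)

theorem IsPartition.parallelNear_steps_le (hI : IsPartition c E I) (hc : IsBundle c s t)
    (hn : ∀ j, Lists (c (E j).rep) false (near j)) (hn0 : ∀ j, near j ≠ []) :
    (parallelNear E near).steps ≤ 41 * (parallel k c).esize *
      ∏ j, (classNear (E j) (near j)).val.length := by
  have hpos := fun j => classNear_length_pos (E j) (hn0 j)
  have h1 : ∑ j, (classNear (E j) (near j)).steps ≤ 25 * (parallel k c).esize *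
      ∏ j, (classNear (E j) (near j)).val.length := by
    rw [← hI.sum_esize, Finset.mul_sum, Finset.sum_mul]
    refine Finset.sum_le_sum fun j _ => (classNear_cost hc hn hn0 j).trans ?_
    exact Nat.mul_le_mul_left _ (le_prod_of_pos hpos j)
  have h2 := unions_finRange_steps_le (fun j => (classNear (E j) (near j)).val)
    (w := fun j => ((I j).map fun i => (c i).inner).sum)
    (fun j => List.length_pos_iff.1 (hpos j)) fun j F hF =>
      ((classNear_spec hc (hI.isClassOf j) (hI.nodup j) (hn j)).1 F hF).2.2
  have h3 := (isSP_parallel_iff.2 hc).inner_lt_esize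
  have h4 := hI.le_esize hc
  have h5 : 0 < ∏ j, (classNear (E j) (near j)).val.length :=
    Finset.prod_pos fun j _ => hpos j
  rw [hI.sum_inner] at h2
  rw [parallelNear_steps]
  simp only [Finset.sum_add_distrib, Finset.sum_const, Finset.card_univ, Fintype.card_fin,
    smul_eq_mul, mul_one]
  generalize (parallel k c).esize = m at *
  generalize ∏ j, (classNear (E j) (near j)).val.length = N at *
  have h6 : (9 * l + (parallel k c).inner + 4) * N ≤ 14 * m * N :=
    Nat.mul_le_mul_right _ (by omega)
  have h7 : m ≤ m * N := Nat.le_mul_of_pos_right _ h5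
  nlinarith

theorem IsPartition.parallelSpan_steps_le (hI : IsPartition c E I) (hc : IsBundle c s t)
    (hs : ∀ j, Lists (c (E j).rep) true (span j)) (hs0 : ∀ j, span j ≠ [])
    (hn : ∀ j, Lists (c (E j).rep) false (near j)) (hn0 : ∀ j, near j ≠ []) :
    (parallelSpan E span near).steps ≤ 46 * (parallel k c).esize *
      ∑ i, ∏ j, if j = i then (classSpan (E j) (span j) (near j)).val.length
        else (classNear (E j) (near j)).val.length := by
  have hB := fun j => classNear_length_pos (E j) (hn0 j)
  have hA := fun j => classSpan_length_pos (E j) (hs0 j) (hn0 j)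
  have h3 := (isSP_parallel_iff.2 hc).inner_lt_esize
  have h4 := hI.le_esize hc
  have h5 := hI.classes_pos hc
  rw [parallelSpan_steps]
  have hrow : ∀ i, (∑ j, ((if j = i then (classSpan (E j) (span j) (near j)).steps
          else (classNear (E j) (near j)).steps) + 1) + 3 +
        (unions ((List.finRange l).map fun j => if j = i then
          (classSpan (E j) (span j) (near j)).val else (classNear (E j) (near j)).val)).steps +
        ∏ j, if j = i then (classSpan (E j) (span j) (near j)).val.length
          else (classNear (E j) (near j)).val.length) + 2 ≤ 46 * (parallel k c).esize *
        ∏ j, if j = i then (classSpan (E j) (span j) (near j)).val.length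
          else (classNear (E j) (near j)).val.length := by
    intro i
    obtain ⟨h6, h7⟩ := le_prod_special hA hB i
    have h8 : ∑ j, (if j = i then (classSpan (E j) (span j) (near j)).steps
        else (classNear (E j) (near j)).steps) ≤ 25 * (parallel k c).esize *
          ∏ j, if j = i then (classSpan (E j) (span j) (near j)).val.length
            else (classNear (E j) (near j)).val.length := by
      rw [← hI.sum_esize, Finset.mul_sum, Finset.sum_mul]
      refine Finset.sum_le_sum fun j _ => ?_
      split_ifs with hj
      · subst hj
        exact (classSpan_cost hc hs hs0 hn hn0 j).trans (Nat.mul_le_mul_left _ h6)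
      · exact (classNear_cost hc hn hn0 j).trans (Nat.mul_le_mul_left _ (h7 j hj))
    have h9 := unions_finRange_steps_le (fun j => if j = i then
        (classSpan (E j) (span j) (near j)).val else (classNear (E j) (near j)).val)
      (w := fun j => ((I j).map fun i => (c i).inner).sum + if j = i then 1 else 0)
      (fun j => by
        split_ifs
        exacts [List.length_pos_iff.1 (hA j), List.length_pos_iff.1 (hB j)])
      fun j F hF => by
        split_ifs at hF ⊢
        · exact ((classSpan_spec hc (hI.isClassOf j) (hI.nodup j) (hs j) (hn j)).1 F hF).2.2
        · exact ((classNear_spec hc (hI.isClassOf j) (hI.nodup j) (hn j)).1 F hF).2.2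
    have h10 : ∀ j, (if j = i then (classSpan (E j) (span j) (near j)).val
        else (classNear (E j) (near j)).val).length =
        if j = i then (classSpan (E j) (span j) (near j)).val.length
          else (classNear (E j) (near j)).val.length := fun j => by split_ifs <;> rfl
    simp only [h10] at h9
    rw [Finset.sum_add_distrib, hI.sum_inner, Finset.sum_ite_eq' Finset.univ i,
      if_pos (Finset.mem_univ i)] at h9
    have h11 : 0 < ∏ j, if j = i then (classSpan (E j) (span j) (near j)).val.length
        else (classNear (E j) (near j)).val.length := lt_of_lt_of_le (hA i) h6
    simp only [Finset.sum_add_distrib, Finset.sum_const, Finset.card_univ, Fintype.card_fin,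
      smul_eq_mul, mul_one]
    generalize (parallel k c).esize = m at *
    generalize (∏ j, if j = i then (classSpan (E j) (span j) (near j)).val.length
        else (classNear (E j) (near j)).val.length) = P at *
    have h12 : (9 * l + ((parallel k c).inner + 1) + 4) * P ≤ 14 * m * P :=
      Nat.mul_le_mul_right _ (by omega)
    have h13 : m ≤ m * P := Nat.le_mul_of_pos_right _ h11
    have h14 : P ≤ m * P := Nat.le_mul_of_pos_left _ (by omega)
    nlinarith
  have h6 := Finset.sum_le_sum fun i (_ : i ∈ Finset.univ) => hrow i
  rw [Finset.sum_add_distrib, ← Finset.mul_sum] at h6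
  refine le_trans (Nat.add_le_add_left ?_ _) h6
  simp only [Finset.sum_const, Finset.card_univ, Fintype.card_fin, smul_eq_mul]
  omega

end ParallelCost

end SPTree

namespace SPTree

open Timed

universe u

variable {V : Type u}

/-! ### The running time in terms of the numbers of listed forests -/

/-- The bounds that are proved by induction along the tree `D`, for an algorithm that takes `B`
steps to list `S` spanning trees and `N` near trees. The number of near trees of an S-node and the
number of spanning trees of a P-node are at least linear in the size of the graph, which pays for
the isomorphism tests. The weights of `S` and `N` at S-nodes and at other nodes differ in such a way
that the bounds for the children add up to less than the bound for the parent, by a surplus of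
`300 * D.esize * (S + N)`, which pays for the work at the parent. -/
structure Bounds (D : SPTree V) (B S N : ℕ) : Prop where
  span_pos : 0 < S
  near_pos : 0 < N
  growth_series : D.IsSeries → D.esize + 4 ≤ 4 * N ∧ (S = 1 → D.esize + 2 ≤ 2 * N)
  growth : ¬ D.IsSeries → D.esize + 3 ≤ 4 * S ∧ (S = 1 → D.esize = 1)
  cost_series : D.IsSeries → B ≤ 300 * D.esize * (2 * S + 3 * N)
  cost : ¬ D.IsSeries → B ≤ 300 * D.esize * (3 * S + 2 * N)
  cost_edge : ¬ D.IsSeries → ¬ D.IsParallel → B ≤ 1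

theorem bounds_edge (u v : V) : Bounds (edge u v) 1 1 1 :=
  ⟨one_pos, one_pos, fun h => h.elim, fun _ => ⟨le_rfl, fun _ => rfl⟩, fun h => h.elim,
    fun _ => by simp [esize], fun _ _ => le_rfl⟩

/-- The bounds at an S-node, where `B'` is the sum of the costs of the children and of the cost of
forming the unions. -/
theorem bounds_series {k : ℕ} {c : Fin k → SPTree V} (hk : 2 ≤ k) {B S N : Fin k → ℕ}
    (hb : ∀ i, Bounds (c i) (B i) (S i) (N i)) (hc : ∀ i, ¬ (c i).IsSeries) {B' : ℕ}
    (hB' : B' ≤ ∑ i, B i + 300 * (series k c).esize *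
      (∏ i, S i + ∑ i, ∏ j, if j = i then N j else S j)) :
    Bounds (series k c) B' (∏ i, S i) (∑ i, ∏ j, if j = i then N j else S j) := by
  have hS := fun i => (hb i).span_pos
  have hN := fun i => (hb i).near_pos
  have hsum := sum_le_sum_special hN hS hk
  have h1 : ∀ i, S i ≤ ∏ i, S i := le_prod_of_pos hS
  have h2 := add_le_sum_special hN hS hk
  have h3 : ∑ i, B i ≤ 300 * (series k c).esize *
      (∏ i, S i + 2 * ∑ i, ∏ j, if j = i then N j else S j) := by
    simp only [esize]
    rw [Finset.mul_sum, Finset.sum_mul]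
    refine Finset.sum_le_sum fun i _ => ((hb i).cost (hc i)).trans (Nat.mul_le_mul_left _ ?_)
    have h4 := h1 i
    have h5 := h2 i
    omega
  have h4 : (series k c).esize + 3 * k ≤ 4 * ∑ i, S i := by
    have h5 := Finset.sum_le_sum fun i (_ : i ∈ Finset.univ) => ((hb i).growth (hc i)).1
    rw [Finset.sum_add_distrib, ← Finset.mul_sum] at h5
    simp only [Finset.sum_const, Finset.card_univ, Fintype.card_fin, smul_eq_mul] at h5
    simp only [esize]
    omega
  refine ⟨Finset.prod_pos fun i _ => hS i, ?_, fun _ => ⟨by omega, fun h5 => ?_⟩,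
    fun h => absurd trivial h, fun _ => ?_, fun h => absurd trivial h,
    fun h => absurd trivial h⟩
  · exact lt_of_lt_of_le (hN ⟨0, by omega⟩) (le_trans (by omega) (h2 ⟨0, by omega⟩))
  · -- a chain with only one spanning tree is a path
    have h6 : ∀ i, S i = 1 := fun i => le_antisymm (h5 ▸ h1 i) (hS i)
    have h7 : (series k c).esize = k := by
      simp only [esize, fun i => ((hb i).growth (hc i)).2 (h6 i)]
      simp
    simp only [h6, Finset.sum_const, Finset.card_univ, Fintype.card_fin, smul_eq_mul,
      mul_one] at hsum h4
    simp only [h6] at *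
    omega
  · generalize (∑ i, ∏ j, if j = i then N j else S j) = n at *
    generalize ∏ i, S i = s at *
    nlinarith

section Parallel

variable {k l : ℕ} {c : Fin k → SPTree V} {s t : V} {E : Fin l → IsoClass k V}
  {I : Fin l → List (Fin k)}

theorem IsPartition.eq_zero_of_edge (hI : IsPartition c E I) (hc : IsBundle c s t) {j : Fin l}
    {u v : V} (hj : c (E j).rep = edge u v) : (E j).others.length = 0 := by
  obtain ⟨idx, h1, h2⟩ := hI.isClassOf j
  rw [h2.length_eq, List.length_eq_zero_iff]
  cases idx with
  | nil => rfl
  | cons i idx =>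
    exfalso
    have h3 := (hI.isClassOf j).shape_eq (i := i) (by simp [h1])
    have h4 : ∃ u' v', c i = edge u' v' := by
      rw [hj, shape_eq_shape] at h3
      generalize c i = D at *
      cases D with
      | edge u' v' => exact ⟨_, _, rfl⟩
      | series _ _ => exact h3.elim
      | parallel _ _ => exact h3.elim
    obtain ⟨u', v', h4⟩ := h4
    have h5 := hI.nodup j
    rw [h1, hc.eq_of_edge hj h4] at h5
    simp at h5

theorem isEdge_of_not {D : SPTree V} (h1 : ¬ D.IsSeries) (h2 : ¬ D.IsParallel) :
    ∃ u v, D = edge u v := by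
  cases D with
  | edge u v => exact ⟨u, v, rfl⟩
  | series _ _ => exact absurd trivial h1
  | parallel _ _ => exact absurd trivial h2

/-- The bounds at a P-node, where `B'` is the sum of the costs of the representatives, of the
isomorphism tests and of forming the unions. The second part bounds the costs of the representatives
by the number of spanning trees alone, as is needed when only those are listed. -/
theorem IsPartition.bounds (hI : IsPartition c E I) (hc : IsBundle c s t) {B S N : Fin l → ℕ}
    (hb : ∀ j, Bounds (c (E j).rep) (B j) (S j) (N j)) (hp : ∀ i, ¬ (c i).IsParallel) {B' : ℕ}
    (hB' : B' ≤ ∑ j, B j + 48 * (parallel k c).esize ^ 2 + l + 46 * (parallel k c).esize *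
        (∑ i, ∏ j, if j = i then S j * Nat.multichoose (N j) (E j).others.length
          else Nat.multichoose (N j) ((E j).others.length + 1)) +
      41 * (parallel k c).esize * ∏ j, Nat.multichoose (N j) ((E j).others.length + 1)) :
    Bounds (parallel k c) B' (∑ i, ∏ j, if j = i then S j * Nat.multichoose (N j)
        (E j).others.length else Nat.multichoose (N j) ((E j).others.length + 1))
      (∏ j, Nat.multichoose (N j) ((E j).others.length + 1)) ∧
    ∑ j, B j ≤ 1800 * (parallel k c).esize * (∑ i, ∏ j, if j = i then S j * Nat.multichoose (N j)
        (E j).others.length else Nat.multichoose (N j) ((E j).others.length + 1)) := by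
  have hS := fun j => (hb j).span_pos
  have hN := fun j => (hb j).near_pos
  have hB0 : ∀ j, 0 < Nat.multichoose (N j) ((E j).others.length + 1) :=
    fun j => multichoose_pos (hN j) _
  have hA0 : ∀ j, 0 < S j * Nat.multichoose (N j) (E j).others.length :=
    fun j => Nat.mul_pos (hS j) (multichoose_pos (hN j) _)
  have hmN : ∀ j, N j ≤ Nat.multichoose (N j) ((E j).others.length + 1) :=
    fun j => le_multichoose_succ _ _
  have hmS : ∀ j, S j ≤ S j * Nat.multichoose (N j) (E j).others.length :=
    fun j => Nat.le_mul_of_pos_right _ (multichoose_pos (hN j) _)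
  have hsize := hI.sum_esize
  have hl0 := hI.classes_pos hc
  have hl1 := hI.le_esize hc
  have hm0 := (isSP_parallel_iff.2 hc).esize_pos
  -- the cost of a representative, whether it is an edge or an S-node
  have hBj : ∀ j, B j ≤ 300 * (c (E j).rep).esize * (2 * S j + 3 * N j) := by
    intro j
    by_cases h1 : (c (E j).rep).IsSeries
    · exact (hb j).cost_series h1
    · refine ((hb j).cost_edge h1 (hp _)).trans ?_
      have h2 := (hc.isSP (E j).rep).esize_pos
      have h3 := hS j
      exact Nat.mul_pos (by omega) (by omega)
  suffices h : (parallel k c).esize + 4 ≤ 4 * (∑ i, ∏ j, if j = i then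
      S j * Nat.multichoose (N j) (E j).others.length
        else Nat.multichoose (N j) ((E j).others.length + 1)) ∧
      ∑ j, B j ≤ 300 * (parallel k c).esize * (2 * (∑ i, ∏ j, if j = i then
        S j * Nat.multichoose (N j) (E j).others.length
          else Nat.multichoose (N j) ((E j).others.length + 1)) +
            ∏ j, Nat.multichoose (N j) ((E j).others.length + 1)) ∧
      ∑ j, B j ≤ 1800 * (parallel k c).esize * (∑ i, ∏ j, if j = i then
        S j * Nat.multichoose (N j) (E j).others.length
          else Nat.multichoose (N j) ((E j).others.length + 1)) by
    obtain ⟨h1, h2, h3⟩ := h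
    refine ⟨⟨?_, Finset.prod_pos fun j _ => hB0 j, fun h => h.elim,
      fun _ => ⟨by omega, fun h4 => by omega⟩, fun h => h.elim, fun _ => ?_,
      fun _ h => absurd trivial h⟩, h3⟩
    · omega
    · generalize (∑ i, ∏ j, if j = i then S j * Nat.multichoose (N j)
        (E j).others.length else Nat.multichoose (N j) ((E j).others.length + 1)) = x at *
      generalize ∏ j, Nat.multichoose (N j) ((E j).others.length + 1) = y at *
      generalize (parallel k c).esize = m at *
      have h4 : m * m ≤ m * (4 * x) := Nat.mul_le_mul_left _ (by omega)
      have h5 : m ≤ m * x := Nat.le_mul_of_pos_right _ (by omega)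
      nlinarith
  rcases Nat.lt_or_ge 1 l with hl | hl
  · -- at least two classes
    have hsp := add_le_sum_special hA0 hB0 hl
    have hpr := le_prod_of_pos hB0
    have hsum := sum_le_sum_special hA0 hB0 hl
    refine ⟨?_, ?_, ?_⟩
    · have h1 : ∀ j, ((E j).others.length + 1) * (c (E j).rep).esize + 3 ≤
          4 * Nat.multichoose (N j) ((E j).others.length + 1) := by
        intro j
        by_cases h1 : (c (E j).rep).IsSeries
        · have h2 := ((hb j).growth_series h1).1
          obtain ⟨n, hn⟩ : ∃ n, N j = n + 1 := ⟨N j - 1, by have := hN j; omega⟩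
          rw [hn] at h2 ⊢
          have h3 := one_add_mul_le_multichoose n ((E j).others.length + 1)
          nlinarith
        · obtain ⟨u, v, h2⟩ := isEdge_of_not h1 (hp _)
          have h3 := hB0 j
          rw [hI.eq_zero_of_edge hc h2] at h3 ⊢
          rw [h2]
          simp only [esize]
          omega
      have h2 := Finset.sum_le_sum fun j (_ : j ∈ Finset.univ) => h1 j
      rw [Finset.sum_add_distrib, ← Finset.mul_sum, hsize] at h2
      simp only [Finset.sum_const, Finset.card_univ, Fintype.card_fin, smul_eq_mul] at h2
      omega
    · rw [← hsize, Finset.mul_sum, Finset.sum_mul]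
      refine Finset.sum_le_sum fun j _ => (hBj j).trans (Nat.mul_le_mul ?_ ?_)
      · exact Nat.mul_le_mul_left _ (Nat.le_mul_of_pos_left _ (Nat.succ_pos _))
      · have h1 := hsp j
        have h2 := hpr j
        have h3 := hmN j
        have h4 := hmS j
        omega
    · generalize (∑ i, ∏ j, if j = i then S j * Nat.multichoose (N j)
        (E j).others.length else Nat.multichoose (N j) ((E j).others.length + 1)) = x at *
      rw [← hsize, Finset.mul_sum, Finset.sum_mul]
      refine Finset.sum_le_sum fun j _ => (hBj j).trans ?_
      have h1 : 2 * S j + 3 * N j ≤ 3 * x := by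
        have h1 := hsp j
        have h3 := hmN j
        have h4 := hmS j
        omega
      refine (Nat.mul_le_mul_left _ h1).trans ?_
      have h2 : (c (E j).rep).esize ≤ ((E j).others.length + 1) * (c (E j).rep).esize :=
        Nat.le_mul_of_pos_left _ (Nat.succ_pos _)
      have h3 := Nat.mul_le_mul_right x h2
      nlinarith
  · -- only one class, which has at least two members
    obtain rfl : l = 1 := by omega
    have hj : 1 ≤ (E 0).others.length := by
      have h1 : (I 0).Perm (List.finRange k) := by
        have := hI.perm
        simpa using this
      have h2 := (hI.isClassOf 0).length_eq
      rw [h1.length_eq, List.length_finRange] at h2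
      have := hc.two_le
      omega
    simp only [Finset.univ_unique, Fin.default_eq_zero, Fin.isValue, Finset.sum_singleton,
      Finset.prod_singleton, if_true] at *
    have h1 : (c (E 0).rep).IsSeries := by
      by_contra h1
      obtain ⟨u, v, h2⟩ := isEdge_of_not h1 (hp _)
      have := hI.eq_zero_of_edge hc h2
      omega
    obtain ⟨h2, h3⟩ := (hb 0).growth_series h1
    have h4 := hBj 0
    have h5 := hS 0
    have h6 := hmN 0
    rw [← hsize]
    obtain ⟨e, he⟩ : ∃ e, (E 0).others.length = e + 1 := ⟨_, (Nat.sub_add_cancel hj).symm⟩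
    rw [he] at h6 ⊢
    have h7 := le_multichoose_succ (N 0) e
    obtain ⟨n, hn⟩ : ∃ n, N 0 = n + 1 := ⟨N 0 - 1, by have := hN 0; omega⟩
    have h8 := one_add_mul_le_multichoose n (e + 1)
    rw [← hn] at h8
    generalize Nat.multichoose (N 0) (e + 1) = M at *
    generalize Nat.multichoose (N 0) (e + 1 + 1) = M' at *
    generalize (c (E 0).rep).esize = r at *
    generalize S 0 = x at *
    have h9 : N 0 ≤ x * M := h7.trans (Nat.le_mul_of_pos_left _ h5)
    have h10 : x ≤ x * M := Nat.le_mul_of_pos_right _ (by omega)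
    have h11 : 2 * r ≤ (e + 1 + 1) * r := Nat.mul_le_mul_right _ (by omega)
    have h13 : 300 * r * (2 * x + 3 * N 0) ≤ 300 * r * (2 * (2 * (x * M) + M')) :=
      Nat.mul_le_mul_left _ (by omega)
    have h14 : 300 * r * (2 * x + 3 * N 0) ≤ 300 * r * (5 * (x * M)) :=
      Nat.mul_le_mul_left _ (by omega)
    refine ⟨?_, ?_, ?_⟩
    · rcases Nat.lt_or_ge 1 x with hx | hx
      · have h12 : 2 * M ≤ x * M := Nat.mul_le_mul_right _ hx
        nlinarith [Nat.zero_le (e * r), Nat.zero_le (n * e)]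
      · obtain rfl : x = 1 := by omega
        have h12 := h3 rfl
        nlinarith [Nat.zero_le (e * r), Nat.zero_le (n * e)]
    · have h12 := Nat.mul_le_mul_right (300 * (2 * (x * M) + M')) h11
      nlinarith
    · have h12 := Nat.mul_le_mul_right (300 * (5 * (x * M))) h11
      nlinarith

end Parallel

/-! ### The running times of the generation algorithms -/

theorem IsChain.le_esize {k : ℕ} {c : Fin k → SPTree V} {p : Fin (k + 1) → V}
    (hc : IsChain c p) : k ≤ (series k c).esize := by
  have h := Finset.sum_le_sum (f := fun _ => 1) fun i (_ : i ∈ Finset.univ) =>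
    Nat.succ_le_of_lt (hc.isSP i).esize_pos
  simpa [esize] using h

theorem IsChain.sum_inner_le {k : ℕ} {c : Fin k → SPTree V} {p : Fin (k + 1) → V}
    (hc : IsChain c p) : ∑ i, ((c i).inner + 1) ≤ (series k c).esize :=
  Finset.sum_le_sum fun i _ => (hc.isSP i).inner_lt_esize

section Algorithms

variable [DecidableEq V]

theorem bothTrees_series_steps {k : ℕ} (c : Fin k → SPTree V) :
    (bothTrees (series k c)).steps = ∑ i, ((bothTrees (c i)).steps + 1) +
      ((seriesSpan fun i => (bothTrees (c i)).val.1).steps +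
      (seriesNear (fun i => (bothTrees (c i)).val.1) fun i => (bothTrees (c i)).val.2).steps) := rfl

theorem bothTrees_parallel_steps {k : ℕ} (c : Fin k → SPTree V) :
    (bothTrees (parallel k c)).steps = (isoClasses c).steps +
      (∑ j, ((bothTrees (c ((isoClasses c).val.get j).rep)).steps + 1) +
      ((parallelSpan (isoClasses c).val.get
          (fun j => (bothTrees (c ((isoClasses c).val.get j).rep)).val.1)
          fun j => (bothTrees (c ((isoClasses c).val.get j).rep)).val.2).steps +
        (parallelNear (isoClasses c).val.get
          fun j => (bothTrees (c ((isoClasses c).val.get j).rep)).val.2).steps)) := rfl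

theorem spanningTrees_series_steps {k : ℕ} (c : Fin k → SPTree V) :
    (spanningTrees (series k c)).steps = ∑ i, ((spanningTrees (c i)).steps + 1) +
      (seriesSpan fun i => (spanningTrees (c i)).val).steps := rfl

theorem spanningTrees_parallel_steps {k : ℕ} (c : Fin k → SPTree V) :
    (spanningTrees (parallel k c)).steps = (isoClasses c).steps +
      (∑ j, ((bothTrees (c ((isoClasses c).val.get j).rep)).steps + 1) +
      (parallelSpan (isoClasses c).val.get
          (fun j => (bothTrees (c ((isoClasses c).val.get j).rep)).val.1)
          fun j => (bothTrees (c ((isoClasses c).val.get j).rep)).val.2).steps) := rfl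

theorem spanningTrees_val (D : SPTree V) : D.spanningTrees.val = D.bothTrees.val.1 := by
  induction D with
  | edge u v => rfl
  | series k c ih =>
    change (seriesSpan fun i => (spanningTrees (c i)).val).val = _
    simp only [ih]
    rfl
  | parallel k c ih => rfl

theorem IsSP.bounds_bothTrees {D : SPTree V} {s t : V} (h : D.IsSP s t) (ha : D.Alternating) :
    Bounds D D.bothTrees.steps D.bothTrees.val.1.length D.bothTrees.val.2.length := by
  induction D generalizing s t with
  | edge u v => exact bounds_edge u v
  | series k c ih =>
    obtain ⟨p, rfl, rfl, hc⟩ := isSP_series_iff.1 h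
    have hb := fun i => ih i (hc.isSP i) (ha i).2
    have hL := fun i => (hc.isSP i).lists_bothTrees
    have hs0 := fun i => List.length_pos_iff.1 (hb i).span_pos
    have hn0 := fun i => List.length_pos_iff.1 (hb i).near_pos
    have hk := hc.le_esize
    have hw := hc.sum_inner_le
    have h1 := seriesSpan_steps_le (w := fun i => (c i).inner + 1) (by have := hc.two_le; omega)
      hk hw hs0 fun j => (hL j).1.length
    have h2 := seriesNear_steps_le hc.two_le hk hw hs0 hn0 (fun j => (hL j).1.length)
      fun j => (hL j).2.length
    have hb' := bounds_series (B' := (bothTrees (series k c)).steps) hc.two_le hb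
      (fun i => (ha i).1) (by
        have h3 : 0 < ∏ i, (bothTrees (c i)).val.1.length :=
          Finset.prod_pos fun i _ => (hb i).span_pos
        rw [bothTrees_series_steps, Finset.sum_add_distrib]
        simp only [Finset.sum_const, Finset.card_univ, Fintype.card_fin, smul_eq_mul, mul_one]
        generalize (∑ i, ∏ j, if j = i then (bothTrees (c j)).val.2.length
          else (bothTrees (c j)).val.1.length) = x at *
        generalize ∏ i, (bothTrees (c i)).val.1.length = y at *
        generalize (series k c).esize = m at *
        have h4 : m ≤ m * y := Nat.le_mul_of_pos_right _ h3
        nlinarith [Nat.zero_le (m * x)])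
    rw [bothTrees_series_val, seriesSpan_val, length_unions_finRange, seriesNear_val,
      length_specialUnions]
    exact hb'
  | parallel k c ih =>
    have hc := isSP_parallel_iff.1 h
    obtain ⟨I, hI⟩ := hc.exists_isPartition
    have hb := fun j => ih ((isoClasses c).val.get j).rep (hc.isSP _) (ha _).2
    have hL := fun j => (hc.isSP ((isoClasses c).val.get j).rep).lists_bothTrees
    have hs0 := fun j => List.length_pos_iff.1 (hb j).span_pos
    have hn0 := fun j => List.length_pos_iff.1 (hb j).near_pos
    have h1 := hI.parallelSpan_steps_le hc (fun j => (hL j).1) hs0 (fun j => (hL j).2) hn0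
    have h2 := hI.parallelNear_steps_le hc (fun j => (hL j).2) hn0
    have h3 := isoClasses_steps_le hc
    simp only [length_classNear, length_classSpan] at h1 h2
    have hb' := (hI.bounds (B' := (bothTrees (parallel k c)).steps) hc hb (fun i => (ha i).1) (by
      rw [bothTrees_parallel_steps, Finset.sum_add_distrib]
      simp only [Finset.sum_const, Finset.card_univ, Fintype.card_fin, smul_eq_mul, mul_one]
      omega)).1
    rw [bothTrees_parallel_val, parallelSpan_val, length_specialUnions, parallelNear_val,
      length_unions_finRange]
    simp only [length_classNear, length_classSpan]
    exact hb'

end Algorithms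

end SPTree

namespace SPTree

open Timed

universe u

variable {V : Type u}

theorem Lists.mul_length_le {D : SPTree V} {b : Bool} {L : List (Forest V)} (h : Lists D b L) :
    (D.inner + 1) * L.length ≤ (L.map fun F => F.length + 1).sum := by
  have h1 : ∀ x ∈ L.map (fun F => F.length + 1), D.inner + 1 ≤ x := by
    intro x hx
    obtain ⟨F, hF, rfl⟩ := List.mem_map.1 hx
    have := h.length F hF
    omega
  have h2 := List.card_nsmul_le_sum _ _ h1
  rwa [List.length_map, smul_eq_mul, mul_comm] at h2

theorem sum_length_specialUnions {k : ℕ} (A B : Fin k → List (Forest V)) :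
    ((specialUnions A B).map fun F => F.length + 1).sum ≤
      ∑ i, (unions ((List.finRange k).map fun j => if j = i then A j else B j)).steps := by
  rw [specialUnions, List.map_flatten, List.sum_flatten, List.map_map, List.map_map,
    sum_map_finRange]
  exact Finset.sum_le_sum fun i _ => sum_length_le_unions_steps _

section Algorithms

variable [DecidableEq V]

/-- Below a P-node both kinds of trees are generated, and the number of spanning trees of the P-node
pays for this. Below an S-node there are only edges and P-nodes, hence the better constant for
these makes up for the work at the S-node. -/
theorem IsSP.spanningTrees_steps_le {D : SPTree V} {s t : V} (h : D.IsSP s t)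
    (ha : D.Alternating) :
    D.spanningTrees.steps ≤ 2200 * D.esize * D.spanningTrees.val.length ∧
      (¬ D.IsSeries → D.spanningTrees.steps ≤ 2100 * D.esize * D.spanningTrees.val.length) := by
  induction D generalizing s t with
  | edge u v => simp [spanningTrees, esize]
  | series k c ih =>
    refine ⟨?_, fun h => absurd trivial h⟩
    obtain ⟨p, rfl, rfl, hc⟩ := isSP_series_iff.1 h
    have hpos : ∀ i, 0 < (spanningTrees (c i)).val.length := fun i => by
      rw [spanningTrees_val]
      exact ((hc.isSP i).bounds_bothTrees (ha i).2).span_pos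
    have hk := hc.le_esize
    have h1 := seriesSpan_steps_le (w := fun i => (c i).inner + 1) (by have := hc.two_le; omega)
      hk hc.sum_inner_le (fun i => List.length_pos_iff.1 (hpos i))
      fun j => (hc.isSP j).lists_spanningTrees.length
    have h2 : ∑ i, (spanningTrees (c i)).steps ≤
        2100 * (series k c).esize * ∏ i, (spanningTrees (c i)).val.length := by
      simp only [esize]
      rw [Finset.mul_sum, Finset.sum_mul]
      refine Finset.sum_le_sum fun i _ => ((ih i (hc.isSP i) (ha i).2).2 (ha i).1).trans ?_
      exact Nat.mul_le_mul_left _ (le_prod_of_pos hpos i)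
    have h3 : 0 < ∏ i, (spanningTrees (c i)).val.length := Finset.prod_pos fun i _ => hpos i
    have h4 : (spanningTrees (series k c)).val =
        (seriesSpan fun i => (spanningTrees (c i)).val).val := rfl
    rw [h4, seriesSpan_val, length_unions_finRange, spanningTrees_series_steps,
      Finset.sum_add_distrib]
    simp only [Finset.sum_const, Finset.card_univ, Fintype.card_fin, smul_eq_mul, mul_one]
    generalize ∏ i, (spanningTrees (c i)).val.length = y at *
    generalize (series k c).esize = m at *
    have h5 : m ≤ m * y := Nat.le_mul_of_pos_right _ h3
    nlinarith
  | parallel k c ih =>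
    suffices hmain : (spanningTrees (parallel k c)).steps ≤
        2100 * (parallel k c).esize * (spanningTrees (parallel k c)).val.length from
      ⟨hmain.trans (Nat.mul_le_mul_right _ (Nat.mul_le_mul_right _ (by omega))), fun _ => hmain⟩
    have hc := isSP_parallel_iff.1 h
    obtain ⟨I, hI⟩ := hc.exists_isPartition
    have hb := fun j => (hc.isSP ((isoClasses c).val.get j).rep).bounds_bothTrees (ha _).2
    have hL := fun j => (hc.isSP ((isoClasses c).val.get j).rep).lists_bothTrees
    have hs0 := fun j => List.length_pos_iff.1 (hb j).span_pos
    have hn0 := fun j => List.length_pos_iff.1 (hb j).near_pos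
    have h1 := hI.parallelSpan_steps_le hc (fun j => (hL j).1) hs0 (fun j => (hL j).2) hn0
    have h2 := (hI.bounds (B' := 0) hc hb (fun i => (ha i).1) (Nat.zero_le _)).2
    have h3 := isoClasses_steps_le hc
    have h4 := (h.bounds_bothTrees ha).growth id
    have h5 := (h.bounds_bothTrees ha).span_pos
    have h6 := hI.le_esize hc
    rw [bothTrees_parallel_val, parallelSpan_val, length_specialUnions] at h4 h5
    rw [spanningTrees_val, bothTrees_parallel_val, parallelSpan_val, length_specialUnions,
      spanningTrees_parallel_steps, Finset.sum_add_distrib]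
    simp only [length_classNear, length_classSpan] at h1 h4 h5 ⊢
    simp only [Finset.sum_const, Finset.card_univ, Fintype.card_fin, smul_eq_mul, mul_one]
    generalize (∑ i, ∏ j, if j = i then
      (bothTrees (c ((isoClasses c).val.get j).rep)).val.1.length *
        Nat.multichoose (bothTrees (c ((isoClasses c).val.get j).rep)).val.2.length
          ((isoClasses c).val.get j).others.length
      else Nat.multichoose (bothTrees (c ((isoClasses c).val.get j).rep)).val.2.length
        (((isoClasses c).val.get j).others.length + 1)) = x at *
    generalize (parallel k c).esize = m at *
    have h7 : m ≤ m * x := Nat.le_mul_of_pos_right _ h5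
    have h8 : m * m ≤ m * (4 * x) := Nat.mul_le_mul_left _ (by omega)
    nlinarith

/-- The running time is at least the total length of the output. -/
theorem IsSP.le_steps {D : SPTree V} {s t : V} (h : D.IsSP s t) :
    (D.inner + 1) * (D.bothTrees.val.1.length + D.bothTrees.val.2.length) ≤
        2 * D.bothTrees.steps ∧
      (D.inner + 1) * D.spanningTrees.val.length ≤ D.spanningTrees.steps := by
  obtain ⟨hs, hn⟩ := h.lists_bothTrees
  have hst := h.lists_spanningTrees
  cases D with
  | edge u v => exact ⟨le_rfl, le_rfl⟩
  | series k c =>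
    have h1 := hs.mul_length_le
    have h2 := hn.mul_length_le
    have h3 := hst.mul_length_le
    have h4 : ∀ span : Fin k → List (Forest V),
        ((seriesSpan span).val.map fun F => F.length + 1).sum ≤ (seriesSpan span).steps := by
      intro span
      rw [seriesSpan_val, seriesSpan_steps]
      have := sum_length_le_unions_steps ((List.finRange k).map span)
      omega
    have h5 : ∀ span near : Fin k → List (Forest V),
        ((seriesNear span near).val.map fun F => F.length + 1).sum ≤
          (seriesNear span near).steps := by
      intro span near
      rw [seriesNear_val, seriesNear_steps]
      refine (sum_length_specialUnions _ _).trans (le_trans ?_ (Nat.le_add_right _ _))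
      exact Finset.sum_le_sum fun i _ => by omega
    rw [bothTrees_series_steps, spanningTrees_series_steps, mul_add]
    refine ⟨?_, h3.trans ((h4 _).trans (Nat.le_add_left _ _))⟩
    have h6 := h1.trans (h4 fun i => (bothTrees (c i)).val.1)
    have h7 := h2.trans (h5 (fun i => (bothTrees (c i)).val.1) fun i => (bothTrees (c i)).val.2)
    omega
  | parallel k c =>
    have h1 := hs.mul_length_le
    have h2 := hn.mul_length_le
    have h3 := hst.mul_length_le
    have h4 : ∀ {l : ℕ} (E : Fin l → IsoClass k V) (near : Fin l → List (Forest V)),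
        ((parallelNear E near).val.map fun F => F.length + 1).sum ≤
          (parallelNear E near).steps := by
      intro l E near
      rw [parallelNear_val, parallelNear_steps]
      exact (sum_length_le_unions_steps _).trans (Nat.le_add_left _ _)
    have h5 : ∀ {l : ℕ} (E : Fin l → IsoClass k V) (span near : Fin l → List (Forest V)),
        ((parallelSpan E span near).val.map fun F => F.length + 1).sum ≤
          (parallelSpan E span near).steps := by
      intro l E span near
      rw [parallelSpan_val, parallelSpan_steps]
      refine (sum_length_specialUnions _ _).trans (le_trans ?_ (Nat.le_add_right _ _))
      exact Finset.sum_le_sum fun i _ => by omega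
    rw [bothTrees_parallel_steps, spanningTrees_parallel_steps, mul_add]
    have h6 := h1.trans (h5 (isoClasses c).val.get
      (fun j => (bothTrees (c ((isoClasses c).val.get j).rep)).val.1)
      fun j => (bothTrees (c ((isoClasses c).val.get j).rep)).val.2)
    have h7 := h2.trans (h4 (isoClasses c).val.get
      fun j => (bothTrees (c ((isoClasses c).val.get j).rep)).val.2)
    have h8 := h3.trans (h5 (isoClasses c).val.get
      (fun j => (bothTrees (c ((isoClasses c).val.get j).rep)).val.1)
      fun j => (bothTrees (c ((isoClasses c).val.get j).rep)).val.2)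
    exact ⟨by omega, by omega⟩

end Algorithms

end SPTree

/-! ### Cuts and connectivity -/

/-- The cut `f` of the vertices is not crossed by any edge of `E`. -/
def Flat {V : Type*} (f : V → Bool) (E : Set (Sym2 V)) : Prop := ∀ a b, s(a, b) ∈ E → f a = f b

theorem Flat.mono {V : Type*} {f : V → Bool} {E E' : Set (Sym2 V)} (h : Flat f E) (hE : E' ⊆ E) :
    Flat f E' :=
  fun a b hab => h a b (hE hab)

theorem Flat.xor {V : Type*} {f g : V → Bool} {E : Set (Sym2 V)} (hf : Flat f E) (hg : Flat g E) :
    Flat (fun v => f v ^^ g v) E :=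
  fun a b hab => by simp only [hf a b hab, hg a b hab]

namespace SPTree

universe u

variable {V : Type u}

/-- The edges of `F` connect the graph of `D` (for `b = true`), or connect every vertex of `D` with
one of the terminals `s` and `t` (for `b = false`). Connectivity is expressed by cuts: a cut that no
edge of `F` crosses, and for `b = false` does not separate `s` from `t`, is trivial. -/
def Connects (D : SPTree V) (s t : V) (b : Bool) (F : Set (Sym2 V)) : Prop :=
  ∀ f : V → Bool, Flat f (D.edges ∩ F) → (b = false → f s = f t) → ∀ v ∈ D.verts, f v = f s

theorem Connects.mono {D : SPTree V} {s t : V} {b : Bool} {F F' : Set (Sym2 V)}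
    (h : D.Connects s t b F) (hF : F ⊆ F') : D.Connects s t b F' :=
  fun f hf => h f (hf.mono fun _ he => ⟨he.1, hF he.2⟩)

theorem Connects.weaken {D : SPTree V} {s t : V} {F : Set (Sym2 V)} (h : D.Connects s t true F)
    (b : Bool) : D.Connects s t b F :=
  fun f hf _ => h f hf fun h => nomatch h

/-- If the terminals are not connected, then they are separated by a cut. -/
theorem Connects.exists_cut {D : SPTree V} {s t : V} {F : Set (Sym2 V)}
    (h : D.Connects s t false F) (h' : ¬ D.Connects s t true F) (x : Bool) :
    ∃ f : V → Bool, Flat f (D.edges ∩ F) ∧ f s = x ∧ f t = !x := by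
  obtain ⟨f, hf, -, v, hv, hne⟩ : ∃ f : V → Bool, Flat f (D.edges ∩ F) ∧
      (true = false → f s = f t) ∧ ∃ v ∈ D.verts, f v ≠ f s := by
    simpa [Connects] using h'
  have hst : f s ≠ f t := fun hst => hne (h f hf (fun _ => hst) v hv)
  refine ⟨fun v => f v ^^ (f s ^^ x), fun a b hab => by simp only [hf a b hab], by simp, ?_⟩
  change (f t ^^ (f s ^^ x)) = !x
  revert hst
  cases f s <;> cases f t <;> cases x <;> simp

theorem flat_series {k : ℕ} {c : Fin k → SPTree V} {F : Set (Sym2 V)} {f : V → Bool} :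
    Flat f ((series k c).edges ∩ F) ↔ ∀ i, Flat f ((c i).edges ∩ F) := by
  simp only [Flat, Set.mem_inter_iff, mem_edges_node.1]
  exact ⟨fun h i a b hab => h a b ⟨⟨i, hab.1⟩, hab.2⟩,
    fun h a b ⟨⟨i, hi⟩, hF⟩ => h i a b ⟨hi, hF⟩⟩

theorem flat_parallel {k : ℕ} {c : Fin k → SPTree V} {F : Set (Sym2 V)} {f : V → Bool} :
    Flat f ((parallel k c).edges ∩ F) ↔ ∀ i, Flat f ((c i).edges ∩ F) :=
  flat_series

theorem _root_.Flat.congr_verts {D : SPTree V} {F : Set (Sym2 V)} {f g : V → Bool}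
    (h : Flat f (D.edges ∩ F)) (hg : ∀ v ∈ D.verts, g v = f v) : Flat g (D.edges ∩ F) := by
  intro a b hab
  obtain ⟨ha, hb⟩ := mem_verts_of_mem_edges hab.1
  rw [hg a ha, hg b hb, h a b hab]

theorem flat_const (D : SPTree V) (F : Set (Sym2 V)) (x : Bool) :
    Flat (fun _ => x) (D.edges ∩ F) :=
  fun _ _ _ => rfl

section Chain

variable {k : ℕ} {c : Fin k → SPTree V} {p : Fin (k + 1) → V}

/-- A cut of a child of an S-node extends to a cut of the whole graph. -/
theorem IsChain.exists_flat (hc : IsChain c p) {F : Set (Sym2 V)} (i : Fin k) {f : V → Bool}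
    (hf : Flat f ((c i).edges ∩ F)) :
    ∃ g : V → Bool, Flat g ((series k c).edges ∩ F) ∧ (∀ v ∈ (c i).verts, g v = f v) ∧
      g (p 0) = f (p i.castSucc) ∧ g (p (Fin.last k)) = f (p i.succ) := by
  have hk := hc.two_le
  obtain ⟨g, hg⟩ := hc.exists_glue (φ := fun j => if j = i then f else
      fun _ => if j < i then f (p i.castSucc) else f (p i.succ))
    (p' := fun m => if m ≤ i.castSucc then f (p i.castSucc) else f (p i.succ)) (by
      intro j
      rcases lt_trichotomy j i with h | rfl | h
      · have h1 : j.castSucc ≤ i.castSucc := by simpa using h.le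
        have h2 : j.succ ≤ i.castSucc := Fin.succ_le_castSucc_iff.2 h
        simp [h, h.ne, h1, h2]
      · simp
      · have h1 : ¬ j.castSucc ≤ i.castSucc := by simpa using h
        have h2 : ¬ j.succ ≤ i.castSucc := by simpa using h.le
        simp [h.not_gt, h.ne', h1, h2])
  refine ⟨g, flat_series.2 fun j => ?_, fun v hv => by simpa using hg i v hv, ?_, ?_⟩
  · refine Flat.congr_verts ?_ (hg j)
    split_ifs with h
    · exact h ▸ hf
    · exact flat_const _ _ _
    · exact flat_const _ _ _
  · have h0 := hg ⟨0, by omega⟩ _ (hc.left_mem _)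
    have e0 : Fin.castSucc (⟨0, by omega⟩ : Fin k) = 0 := rfl
    rw [e0] at h0
    rw [h0]
    by_cases h1 : (⟨0, by omega⟩ : Fin k) = i
    · simp only [h1, if_true]
      rw [← h1, e0]
    · have h2 : (⟨0, by omega⟩ : Fin k) < i := by
        simp only [Fin.ext_iff, Fin.lt_def] at h1 ⊢; omega
      simp [h1, h2]
  · have h0 := hg ⟨k - 1, by omega⟩ _ (hc.right_mem _)
    have e1 : Fin.succ (⟨k - 1, by omega⟩ : Fin k) = Fin.last k := by
      simp only [Fin.ext_iff, Fin.val_last, Fin.val_succ]; omega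
    rw [e1] at h0
    rw [h0]
    by_cases h1 : (⟨k - 1, by omega⟩ : Fin k) = i
    · simp only [h1, if_true]
      rw [← h1, e1]
    · have h2 : ¬ (⟨k - 1, by omega⟩ : Fin k) < i := by
        simp only [Fin.lt_def]; omega
      simp [h1, h2]

/-- A function that has the same value at the ends of every child has the same value at all
junctions. -/
theorem eq_zero_of_step {α : Type*} {q : Fin (k + 1) → α} {m : Fin (k + 1)}
    (h : ∀ i : Fin k, i.succ ≤ m → q i.castSucc = q i.succ) : q m = q 0 := by
  induction m using Fin.induction with
  | zero => rfl
  | succ i ih =>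
    rw [← h i le_rfl, ih fun j hj => h j (hj.trans (Fin.castSucc_le_succ i))]

theorem eq_last_of_step {α : Type*} {q : Fin (k + 1) → α} {m : Fin (k + 1)}
    (h : ∀ i : Fin k, m ≤ i.castSucc → q i.castSucc = q i.succ) : q m = q (Fin.last k) := by
  induction m using Fin.reverseInduction with
  | last => rfl
  | cast i ih =>
    rw [h i le_rfl, ih fun j hj => h j ((Fin.castSucc_le_succ i).trans hj)]

theorem IsChain.connects_true_iff (hc : IsChain c p) {F : Set (Sym2 V)} :
    (series k c).Connects (p 0) (p (Fin.last k)) true F ↔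
      ∀ i, (c i).Connects (p i.castSucc) (p i.succ) true F := by
  constructor
  · intro h i f hf _ v hv
    obtain ⟨g, hg, h1, -, -⟩ := hc.exists_flat i hf
    have h2 := fun v hv => h g hg (fun h => nomatch h) v (mem_verts_node.1.2 ⟨i, hv⟩)
    rw [← h1 v hv, ← h1 _ (hc.left_mem i), h2 _ hv, h2 _ (hc.left_mem i)]
  · intro h f hf _ v hv
    rw [flat_series] at hf
    have h1 := fun i => h i f (hf i) fun h => nomatch h
    obtain ⟨i, hi⟩ := mem_verts_node.1.1 hv
    rw [h1 i v hi]
    exact eq_zero_of_step (q := fun m => f (p m)) fun i _ => (h1 i _ (hc.right_mem i)).symm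

/-- Cuts of two different children of an S-node that separate the terminals of these children
can be combined. -/
theorem IsChain.exists_flat_pair (hc : IsChain c p) {F : Set (Sym2 V)} {i j : Fin k} (hij : i < j)
    {f g : V → Bool} (hf : Flat f ((c i).edges ∩ F)) (hg : Flat g ((c j).edges ∩ F))
    {x y : Bool} (hf0 : f (p i.castSucc) = x) (hf1 : f (p i.succ) = y)
    (hg0 : g (p j.castSucc) = y) (hg1 : g (p j.succ) = x) :
    ∃ h : V → Bool, Flat h ((series k c).edges ∩ F) ∧ h (p 0) = x ∧ h (p (Fin.last k)) = x ∧
      h (p i.succ) = y := by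
  have hk := hc.two_le
  obtain ⟨q, hq⟩ : ∃ q : Fin (k + 1) → Bool, q = fun m =>
      if m ≤ i.castSucc then x else if m ≤ j.castSucc then y else x := ⟨_, rfl⟩
  obtain ⟨φ, hφ⟩ : ∃ φ : Fin k → V → Bool, φ = fun l => if l = i then f else
      if l = j then g else fun _ => q l.succ := ⟨_, rfl⟩
  have hends : ∀ l, φ l (p l.castSucc) = q l.castSucc ∧ φ l (p l.succ) = q l.succ := by
    intro l
    simp only [hφ, hq]
    by_cases h1 : l = i
    · subst h1
      have h2 : l.succ ≤ j.castSucc := Fin.succ_le_castSucc_iff.2 hij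
      have h3 : ¬ l.succ ≤ l.castSucc := by simp
      simp only [if_true, hf0, hf1, h2, h3, le_refl, if_false, and_self]
    by_cases h2 : l = j
    · subst h2
      have h3 : ¬ l.castSucc ≤ i.castSucc := by simpa using hij
      have h4 : ¬ l.succ ≤ i.castSucc := by simpa using hij.le
      have h5 : ¬ l.succ ≤ l.castSucc := by simp
      simp only [h1, if_false, if_true, hg0, hg1, h3, h4, h5, le_refl, and_self]
    have h3 : l.castSucc ≤ i.castSucc ↔ l.succ ≤ i.castSucc := by
      rw [Fin.succ_le_castSucc_iff, Fin.castSucc_le_castSucc_iff]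
      exact ⟨fun h => lt_of_le_of_ne h h1, le_of_lt⟩
    have h4 : l.castSucc ≤ j.castSucc ↔ l.succ ≤ j.castSucc := by
      rw [Fin.succ_le_castSucc_iff, Fin.castSucc_le_castSucc_iff]
      exact ⟨fun h => lt_of_le_of_ne h h2, le_of_lt⟩
    simp only [h1, h2, h3, h4, if_false, and_self]
  obtain ⟨h, hh⟩ := hc.exists_glue hends
  have hL : ∀ l : Fin k, h (p l.castSucc) = q l.castSucc := fun l =>
    (hh l _ (hc.left_mem l)).trans (hends l).1
  have hR : ∀ l : Fin k, h (p l.succ) = q l.succ := fun l =>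
    (hh l _ (hc.right_mem l)).trans (hends l).2
  refine ⟨h, flat_series.2 fun l => ?_, ?_, ?_, ?_⟩
  · refine Flat.congr_verts ?_ (hh l)
    simp only [hφ]
    split_ifs with h1 h2
    · exact h1 ▸ hf
    · exact h2 ▸ hg
    · exact flat_const _ _ _
  · have := hL ⟨0, by omega⟩
    have e0 : Fin.castSucc (⟨0, by omega⟩ : Fin k) = 0 := rfl
    rw [e0] at this
    simp [this, hq]
  · have := hR ⟨k - 1, by omega⟩
    have e1 : Fin.succ (⟨k - 1, by omega⟩ : Fin k) = Fin.last k := by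
      simp only [Fin.ext_iff, Fin.val_last, Fin.val_succ]; omega
    rw [e1] at this
    have h1 : ¬ Fin.last k ≤ i.castSucc := by simp
    have h2 : ¬ Fin.last k ≤ j.castSucc := by simp
    simp [this, hq, h1, h2]
  · rw [hR i, hq]
    have h1 : ¬ i.succ ≤ i.castSucc := by simp
    have h2 : i.succ ≤ j.castSucc := Fin.succ_le_castSucc_iff.2 hij
    simp [h1, h2]

/-- If two children both failed to connect their terminals, then the vertices between them would
be connected with neither terminal of the chain. -/
theorem IsChain.connects_false_iff (hc : IsChain c p) {F : Set (Sym2 V)} :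
    (series k c).Connects (p 0) (p (Fin.last k)) false F ↔
      ∃ i, (c i).Connects (p i.castSucc) (p i.succ) false F ∧
        ∀ j, j ≠ i → (c j).Connects (p j.castSucc) (p j.succ) true F := by
  constructor
  · intro h
    have h1 : ∀ i, (c i).Connects (p i.castSucc) (p i.succ) false F := by
      intro i f hf hst v hv
      obtain ⟨g, hg, h1, h2, h3⟩ := hc.exists_flat i hf
      have h4 := fun v hv => h g hg (fun _ => by rw [h2, h3, hst rfl]) v
        (mem_verts_node.1.2 ⟨i, hv⟩)
      rw [← h1 v hv, ← h1 _ (hc.left_mem i), h4 _ hv, h4 _ (hc.left_mem i)]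
    have h2 : ∀ i j, i < j → ¬ (c i).Connects (p i.castSucc) (p i.succ) true F →
        (c j).Connects (p j.castSucc) (p j.succ) true F := by
      intro i j hij hi
      by_contra hj
      obtain ⟨f, hf, hf0, hf1⟩ := (h1 i).exists_cut hi true
      obtain ⟨g, hg, hg0, hg1⟩ := (h1 j).exists_cut hj false
      obtain ⟨g', hg', h3, h4, h5⟩ := hc.exists_flat_pair hij hf hg hf0 hf1 hg0 hg1
      have := h g' hg' (fun _ => h3.trans h4.symm) _ (mem_verts_node.1.2 ⟨i, hc.right_mem i⟩)
      rw [h3, h5] at this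
      exact absurd this (by simp)
    by_cases hall : ∀ i, (c i).Connects (p i.castSucc) (p i.succ) true F
    · have hk := hc.two_le
      exact ⟨⟨0, by omega⟩, h1 _, fun j _ => hall j⟩
    · obtain ⟨i, hi⟩ := not_forall.1 hall
      refine ⟨i, h1 i, fun j hj => ?_⟩
      rcases lt_or_gt_of_ne hj with hlt | hlt
      · by_contra hj'
        exact hi (h2 j i hlt hj')
      · exact h2 i j hlt hi
  · rintro ⟨i, hi, hother⟩ f hf hst
    rw [flat_series] at hf
    have h1 := fun j hj => hother j hj f (hf j) fun h => nomatch h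
    have h2 : f (p i.castSucc) = f (p 0) :=
      eq_zero_of_step (q := fun m => f (p m)) fun j hj => by
        refine (h1 j ?_ _ (hc.right_mem j)).symm
        rintro rfl
        simp at hj
    have h3 : f (p i.succ) = f (p (Fin.last k)) :=
      eq_last_of_step (q := fun m => f (p m)) fun j hj => by
        refine (h1 j ?_ _ (hc.right_mem j)).symm
        rintro rfl
        simp at hj
    have h4 : f (p i.castSucc) = f (p i.succ) := by rw [h2, h3, hst rfl]
    have h5 : ∀ j, ∀ v ∈ (c j).verts, f v = f (p j.castSucc) := by
      intro j v hv
      by_cases hj : j = i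
      · subst hj
        exact hi f (hf j) (fun _ => h4) v hv
      · exact h1 j hj v hv
    intro v hv
    obtain ⟨j, hj⟩ := mem_verts_node.1.1 hv
    rw [h5 j v hj]
    exact eq_zero_of_step (q := fun m => f (p m)) fun i _ => (h5 i _ (hc.right_mem i)).symm

end Chain

section Bundle

variable {k : ℕ} {c : Fin k → SPTree V} {s t : V}

theorem IsBundle.connects_child (hc : IsBundle c s t) {F : Set (Sym2 V)}
    (h : (parallel k c).Connects s t false F) (i : Fin k) : (c i).Connects s t false F := by
  intro f hf hst v hv
  have hst := hst rfl
  obtain ⟨g, hg⟩ := hc.exists_glue (φ := fun j => if j = i then f else fun _ => f s)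
    (s' := f s) (t' := f s) fun j => by
      split_ifs <;> simp [hst]
  have hi : ∀ v ∈ (c i).verts, g v = f v := by simpa using hg i
  have ht := (hc.isSP i).terminals_mem
  have hg' : Flat g ((parallel k c).edges ∩ F) := flat_parallel.2 fun j => by
    refine Flat.congr_verts ?_ (hg j)
    split_ifs with h
    · exact h ▸ hf
    · exact flat_const _ _ _
  have h1 := h g hg' (fun _ => by rw [hi s ht.1, hi t ht.2, hst]) v (mem_verts_node.2.2 ⟨i, hv⟩)
  rwa [hi v hv, hi s ht.1] at h1

theorem IsBundle.connects_false_iff (hc : IsBundle c s t) {F : Set (Sym2 V)} :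
    (parallel k c).Connects s t false F ↔ ∀ i, (c i).Connects s t false F := by
  refine ⟨hc.connects_child, fun h f hf hst v hv => ?_⟩
  rw [flat_parallel] at hf
  obtain ⟨i, hi⟩ := mem_verts_node.2.1 hv
  exact h i f (hf i) hst v hi

theorem IsBundle.connects_true_iff (hc : IsBundle c s t) {F : Set (Sym2 V)} :
    (parallel k c).Connects s t true F ↔
      ∃ i, (c i).Connects s t true F ∧ ∀ j, j ≠ i → (c j).Connects s t false F := by
  constructor
  · intro h
    have h1 := hc.connects_child (h.weaken false)
    by_contra hno
    have h2 : ∀ i, ¬ (c i).Connects s t true F := fun i hi => hno ⟨i, hi, fun j _ => h1 j⟩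
    choose φ hφ hs ht using fun i => (h1 i).exists_cut (h2 i) true
    obtain ⟨g, hg⟩ := hc.exists_glue (φ := φ) fun i => ⟨hs i, ht i⟩
    have hg' : Flat g ((parallel k c).edges ∩ F) :=
      flat_parallel.2 fun j => (hφ j).congr_verts (hg j)
    have hk := hc.two_le
    have hm := (hc.isSP ⟨0, by omega⟩).terminals_mem
    have h3 := h g hg' (fun h => nomatch h) t (mem_verts_node.2.2 ⟨_, hm.2⟩)
    rw [hg _ _ hm.1, hg _ _ hm.2, hs, ht] at h3
    exact absurd h3 (by simp)
  · rintro ⟨i, hi, hother⟩ f hf _ v hv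
    rw [flat_parallel] at hf
    have h1 := hi f (hf i) fun h => nomatch h
    have h2 := (h1 t (hc.isSP i).terminals_mem.2).symm
    obtain ⟨j, hj⟩ := mem_verts_node.2.1 hv
    by_cases hji : j = i
    · subst hji
      exact h1 v hj
    · exact hother j hji f (hf j) (fun _ => h2) v hj

end Bundle

/-! ### Trees are minimal connecting sets -/

theorem IsSP.connects_univ {D : SPTree V} {s t : V} (h : D.IsSP s t) :
    D.Connects s t true Set.univ := by
  induction D generalizing s t with
  | edge u v =>
    obtain ⟨rfl, rfl, -⟩ := h
    rintro f hf - w (rfl | rfl)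
    · rfl
    · exact (hf _ _ ⟨rfl, trivial⟩).symm
  | series k c ih =>
    obtain ⟨p, rfl, rfl, hc⟩ := isSP_series_iff.1 h
    exact hc.connects_true_iff.2 fun i => ih i (hc.isSP i)
  | parallel k c ih =>
    have hc := isSP_parallel_iff.1 h
    have hk := hc.two_le
    exact hc.connects_true_iff.2 ⟨⟨0, by omega⟩, ih _ (hc.isSP _),
      fun j _ => (ih j (hc.isSP j)).weaken false⟩

theorem IsTreeOn.connects {D : SPTree V} {s t : V} (h : D.IsSP s t) {b : Bool}
    {F : Set (Sym2 V)} (hF : D.IsTreeOn b F) : D.Connects s t b F := by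
  induction D generalizing s t b with
  | edge u v =>
    obtain ⟨rfl, rfl, -⟩ := h
    rintro f hf hst w (rfl | rfl)
    · rfl
    · cases b with
      | false => exact (hst rfl).symm
      | true => exact (hf _ _ ⟨rfl, hF.2 rfl⟩).symm
  | series k c ih =>
    obtain ⟨p, rfl, rfl, hc⟩ := isSP_series_iff.1 h
    cases b with
    | true => exact hc.connects_true_iff.2 fun i => ih i (hc.isSP i) (hF i)
    | false =>
      obtain ⟨i, h1, h2⟩ := hF
      exact hc.connects_false_iff.2
        ⟨i, ih i (hc.isSP i) h1, fun j hj => ih j (hc.isSP j) (h2 j hj)⟩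
  | parallel k c ih =>
    have hc := isSP_parallel_iff.1 h
    cases b with
    | true =>
      obtain ⟨i, h1, h2⟩ := hF
      exact hc.connects_true_iff.2
        ⟨i, ih i (hc.isSP i) h1, fun j hj => ih j (hc.isSP j) (h2 j hj)⟩
    | false => exact hc.connects_false_iff.2 fun i => ih i (hc.isSP i) (hF i)

/-- A near tree does not connect the terminals. -/
theorem IsTreeOn.not_connects {D : SPTree V} {s t : V} (h : D.IsSP s t) {F : Set (Sym2 V)}
    (hF : D.IsTreeOn false F) : ¬ D.Connects s t true F := by
  induction D generalizing s t with
  | edge u v =>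
    classical
    obtain ⟨rfl, rfl, hne⟩ := h
    intro h
    have h1 := h (fun w => decide (w = u)) ?_ (fun h => nomatch h) v (by simp [verts])
    · simp [hne.symm] at h1
    · rintro a b ⟨hab, hab'⟩
      rw [show s(a, b) = s(u, v) from hab] at hab'
      exact absurd (hF.1 hab') (by simp)
  | series k c ih =>
    obtain ⟨p, rfl, rfl, hc⟩ := isSP_series_iff.1 h
    obtain ⟨i, h1, -⟩ := hF
    exact fun h => ih i (hc.isSP i) h1 (hc.connects_true_iff.1 h i)
  | parallel k c ih =>
    have hc := isSP_parallel_iff.1 h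
    intro h
    obtain ⟨i, h1, -⟩ := hc.connects_true_iff.1 h
    exact ih i (hc.isSP i) (hF i) h1

/-- Sets of edges of the children can be glued. -/
theorem exists_glue_edges {k : ℕ} {c : Fin k → SPTree V}
    (hdis : ∀ i j, i ≠ j → Disjoint (c i).edges (c j).edges) {F : Set (Sym2 V)} {b : Fin k → Bool}
    (h : ∀ i, ∃ F' ⊆ F, (c i).IsTreeOn (b i) F') :
    ∃ F' ⊆ F, ∀ i, (c i).IsTreeOn (b i) F' := by
  choose F' h1 h2 using h
  refine ⟨⋃ i, F' i ∩ (c i).edges, Set.iUnion_subset fun i => Set.inter_subset_left.trans (h1 i),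
    fun i => (h2 i).congr fun e he => ?_⟩
  simp only [Set.mem_iUnion, Set.mem_inter_iff]
  refine ⟨fun h => ⟨i, h, he⟩, ?_⟩
  rintro ⟨j, h3, h4⟩
  by_cases hij : i = j
  · exact hij ▸ h3
  · exact absurd h4 (Set.disjoint_left.1 (hdis i j hij) he)

theorem Connects.exists_isTreeOn {D : SPTree V} {s t : V} (h : D.IsSP s t) {b : Bool}
    {F : Set (Sym2 V)} (hF : D.Connects s t b F) : ∃ F' ⊆ F, D.IsTreeOn b F' := by
  classical
  induction D generalizing s t b with
  | edge u v =>
    obtain ⟨rfl, rfl, hne⟩ := h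
    cases b with
    | false => exact ⟨∅, Set.empty_subset _, by simp [IsTreeOn]⟩
    | true =>
      by_cases hmem : s(u, v) ∈ F
      · exact ⟨F, subset_rfl, by simpa [IsTreeOn] using hmem⟩
      · exact absurd hF (IsTreeOn.not_connects (D := edge u v) ⟨rfl, rfl, hne⟩
          (by simpa [IsTreeOn] using hmem))
  | series k c ih =>
    obtain ⟨p, rfl, rfl, hc⟩ := isSP_series_iff.1 h
    cases b with
    | true =>
      rw [hc.connects_true_iff] at hF
      exact exists_glue_edges (b := fun _ => true) hc.disjoint_edges
        fun i => ih i (hc.isSP i) (hF i)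
    | false =>
      obtain ⟨i, h1, h2⟩ := hc.connects_false_iff.1 hF
      obtain ⟨F', h3, h4⟩ := exists_glue_edges (b := fun j => decide (j ≠ i)) hc.disjoint_edges
        (F := F) fun j => by
          by_cases hj : j = i
          · subst hj
            simpa using ih j (hc.isSP j) h1
          · simpa [hj] using ih j (hc.isSP j) (h2 j hj)
      exact ⟨F', h3, i, by simpa using h4 i, fun j hj => by simpa [hj] using h4 j⟩
  | parallel k c ih =>
    have hc := isSP_parallel_iff.1 h
    cases b with
    | false =>
      rw [hc.connects_false_iff] at hF
      exact exists_glue_edges (b := fun _ => false) hc.disjoint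
        fun i => ih i (hc.isSP i) (hF i)
    | true =>
      obtain ⟨i, h1, h2⟩ := hc.connects_true_iff.1 hF
      obtain ⟨F', h3, h4⟩ := exists_glue_edges (b := fun j => decide (j = i)) hc.disjoint
        (F := F) fun j => by
          by_cases hj : j = i
          · subst hj
            simpa using ih j (hc.isSP j) h1
          · simpa [hj] using ih j (hc.isSP j) (h2 j hj)
      exact ⟨F', h3, i, by simpa using h4 i, fun j hj => by simpa [hj] using h4 j⟩

/-- Spanning trees and near trees are minimal: a special part of the smaller set `F'` must be the
special part of `F`, since a near tree on a part does not connect its terminals. -/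
theorem IsTreeOn.mem_of_connects {D : SPTree V} {s t : V} (h : D.IsSP s t) {b : Bool}
    {F F' : Set (Sym2 V)} (hF : D.IsTreeOn b F) (hsub : F' ⊆ F) (hF' : D.Connects s t b F') :
    ∀ e ∈ D.edges, e ∈ F → e ∈ F' := by
  induction D generalizing s t b with
  | edge u v =>
    rintro _ rfl he
    obtain rfl := hF.1 he
    by_contra hno
    exact absurd hF' (IsTreeOn.not_connects h (by simpa [IsTreeOn] using hno))
  | series k c ih =>
    obtain ⟨p, rfl, rfl, hc⟩ := isSP_series_iff.1 h
    intro e he heF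
    obtain ⟨j, hj⟩ := mem_edges_node.1.1 he
    cases b with
    | true => exact ih j (hc.isSP j) (hF j) (hc.connects_true_iff.1 hF' j) e hj heF
    | false =>
      obtain ⟨i, h1, h2⟩ := hF
      obtain ⟨i', h3, h4⟩ := hc.connects_false_iff.1 hF'
      obtain rfl : i = i' := by
        by_contra hne
        exact h1.not_connects (hc.isSP i) ((h4 i hne).mono hsub)
      by_cases hji : j = i
      · subst hji
        exact ih j (hc.isSP j) h1 h3 e hj heF
      · exact ih j (hc.isSP j) (h2 j hji) (h4 j hji) e hj heF
  | parallel k c ih =>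
    have hc := isSP_parallel_iff.1 h
    intro e he heF
    obtain ⟨j, hj⟩ := mem_edges_node.2.1 he
    cases b with
    | false => exact ih j (hc.isSP j) (hF j) (hc.connects_false_iff.1 hF' j) e hj heF
    | true =>
      obtain ⟨i, h1, h2⟩ := hF
      obtain ⟨i', h3, h4⟩ := hc.connects_true_iff.1 hF'
      obtain rfl : i' = i := by
        by_contra hne
        exact (h2 i' hne).not_connects (hc.isSP i') (h3.mono hsub)
      by_cases hji : j = i'
      · subst hji
        exact ih j (hc.isSP j) h1 h3 e hj heF
      · exact ih j (hc.isSP j) (h2 j hji) (h4 j hji) e hj heF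

/-! ### Near trees arise from spanning trees -/

section Insert

variable {D : SPTree V} {s t : V} {F : Set (Sym2 V)} {g : V → Bool} {a b : V}

/-- Deleting an edge from a connected graph leaves every vertex connected with one of two vertices
that get disconnected: a cut `f` that does not separate `s` from `t` and is crossed by the deleted
edge only would, combined with the cut `g`, contradict the connectivity. -/
theorem Connects.of_insert (h : D.Connects s t true (insert s(a, b) F)) (ht : t ∈ D.verts)
    (hg : Flat g (D.edges ∩ F)) (hst : g s ≠ g t) : D.Connects s t false F := by
  have hins : ∀ f : V → Bool, Flat f (D.edges ∩ F) → f a = f b →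
      Flat f (D.edges ∩ insert s(a, b) F) := by
    rintro f hf hab x y ⟨h1, h2 | h2⟩
    · rcases Sym2.eq_iff.1 h2 with ⟨rfl, rfl⟩ | ⟨rfl, rfl⟩
      exacts [hab, hab.symm]
    · exact hf x y ⟨h1, h2⟩
  have hab : g a ≠ g b := fun hab => hst (h g (hins g hg hab) (fun h => nomatch h) t ht).symm
  intro f hf hfst
  have hfst := hfst rfl
  by_cases hfab : f a = f b
  · exact h f (hins f hf hfab) fun h => nomatch h
  · have h1 := h _ (hins _ (hf.xor hg) (by
      revert hab hfab
      cases f a <;> cases f b <;> cases g a <;> cases g b <;> simp)) (fun h => nomatch h) t ht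
    revert h1 hst hfst
    cases f s <;> cases f t <;> cases g s <;> cases g t <;> simp

/-- Conversely, an edge across the cut `g` between the two components reconnects the graph. -/
theorem Connects.insert (h : D.Connects s t false F) (hab : s(a, b) ∈ D.edges)
    (hg : Flat g (D.edges ∩ F)) (hst : g s ≠ g t) (hgab : g a ≠ g b) :
    D.Connects s t true (insert s(a, b) F) := by
  intro f hf _
  have hf' : Flat f (D.edges ∩ F) := hf.mono fun e he => ⟨he.1, Or.inr he.2⟩
  have hfab : f a = f b := hf a b ⟨hab, Or.inl rfl⟩
  refine h f hf' fun _ => ?_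
  by_contra hne
  have hm := mem_verts_of_mem_edges hab
  have h1 := h _ (hf'.xor hg) fun _ => by
    revert hne hst
    cases f s <;> cases f t <;> cases g s <;> cases g t <;> simp
  have h2 := (h1 a hm.1).trans (h1 b hm.2).symm
  revert h2 hfab hgab
  cases f a <;> cases f b <;> cases g a <;> cases g b <;> simp

end Insert

/-- The near trees are the spanning trees minus an edge such that the terminals get separated. -/
theorem isTreeOn_false_iff {D : SPTree V} {s t : V} (h : D.IsSP s t) {N : Set (Sym2 V)} :
    D.IsTreeOn false N ↔ ∃ e ∈ D.edges, e ∉ N ∧ D.IsTreeOn true (insert e N) ∧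
      ∃ g : V → Bool, Flat g (D.edges ∩ N) ∧ g s ≠ g t := by
  have ht := h.terminals_mem.2
  constructor
  · intro hN
    obtain ⟨g, hg, h0, h1⟩ := (hN.connects h).exists_cut (hN.not_connects h) true
    have hst : g s ≠ g t := by simp [h0, h1]
    obtain ⟨a, b, hab, hgab⟩ : ∃ a b, s(a, b) ∈ D.edges ∧ g a ≠ g b := by
      by_contra! hno
      exact hst (h.connects_univ g (fun a b hab => hno a b hab.1) (fun h => nomatch h) t ht).symm
    have habN : s(a, b) ∉ N := fun hmem => hgab (hg a b ⟨hab, hmem⟩)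
    refine ⟨s(a, b), hab, habN, ?_, g, hg, hst⟩
    obtain ⟨T, hT, hT'⟩ := ((hN.connects h).insert hab hg hst hgab).exists_isTreeOn h
    have habT : s(a, b) ∈ T := by
      by_contra hno
      refine hst (hT'.connects h g (hg.mono ?_) (fun h => nomatch h) t ht).symm
      rintro e ⟨he, heT⟩
      rcases hT heT with rfl | heN
      exacts [absurd heT hno, ⟨he, heN⟩]
    have hTN : T \ {s(a, b)} ⊆ N := by
      rintro e ⟨heT, hne⟩
      exact (hT heT).resolve_left hne
    have hcon : D.Connects s t false (T \ {s(a, b)}) := by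
      refine Connects.of_insert (a := a) (b := b) (g := g) ?_ ht
        (hg.mono fun e he => ⟨he.1, hTN he.2⟩) hst
      rw [Set.insert_sdiff_singleton, Set.insert_eq_of_mem habT]
      exact hT'.connects h
    have hNT := hN.mem_of_connects h hTN hcon
    refine hT'.congr fun e he => ⟨fun heT => hT heT, ?_⟩
    rintro (rfl | heN)
    exacts [habT, (hNT e he heN).1]
  · rintro ⟨e, he, heN, hT, g, hg, hst⟩
    induction e using Sym2.ind with
    | _ a b =>
      have hgab : g a ≠ g b := by
        intro hgab
        refine hst (hT.connects h g ?_ (fun h => nomatch h) t ht).symm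
        rintro x y ⟨h1, h2 | h2⟩
        · rcases Sym2.eq_iff.1 h2 with ⟨rfl, rfl⟩ | ⟨rfl, rfl⟩
          exacts [hgab, hgab.symm]
        · exact hg x y ⟨h1, h2⟩
      obtain ⟨F, hF, hF'⟩ := ((hT.connects h).of_insert ht hg hst).exists_isTreeOn h
      have hcon := (hF'.connects h).insert he (hg.mono fun e he => ⟨he.1, hF he.2⟩) hst hgab
      have hsub := hT.mem_of_connects h (Set.insert_subset_insert hF) hcon
      refine hF'.congr fun e' he' => ⟨fun h => hF h, fun heN' => ?_⟩
      refine (hsub e' he' (Or.inr heN')).resolve_left ?_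
      rintro rfl
      exact heN heN'

end SPTree

/-! ### Separating vertices -/

namespace SPTree

universe u

variable {V : Type u}

/-- The cut `f` is crossed only by edges of `D` that contain `x`. -/
def FlatOff (f : V → Bool) (D : SPTree V) (x : V) : Prop := Flat f {e ∈ D.edges | x ∉ e}

/-- The vertex `x` separates the terminals `s` and `t` in the graph of `D`. -/
def Separates (D : SPTree V) (s t x : V) : Prop :=
  x ≠ s ∧ x ≠ t ∧ ∃ f : V → Bool, FlatOff f D x ∧ f s ≠ f t

theorem FlatOff.child {k : ℕ} {c : Fin k → SPTree V} {f : V → Bool} {x : V} :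
    (FlatOff f (series k c) x → ∀ i, FlatOff f (c i) x) ∧
      (FlatOff f (parallel k c) x → ∀ i, FlatOff f (c i) x) :=
  ⟨fun h i => h.mono fun _ he => ⟨mem_edges_node.1.2 ⟨i, he.1⟩, he.2⟩,
    fun h i => h.mono fun _ he => ⟨mem_edges_node.2.2 ⟨i, he.1⟩, he.2⟩⟩

theorem IsSP.eq_of_flat {D : SPTree V} {s t : V} (h : D.IsSP s t) {f : V → Bool}
    (hf : Flat f D.edges) {v : V} (hv : v ∈ D.verts) : f v = f s :=
  h.connects_univ f (hf.mono Set.inter_subset_left) (fun h => nomatch h) v hv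

theorem FlatOff.flat {D : SPTree V} {f : V → Bool} {x : V} (h : FlatOff f D x)
    (hx : x ∉ D.verts) : Flat f D.edges :=
  h.mono fun _ he => ⟨he, fun hxe => hx (mem_verts_iff.2 ⟨_, he, hxe⟩)⟩

theorem IsSP.eq_of_flatOff {D : SPTree V} {s t : V} (h : D.IsSP s t) {f : V → Bool} {x : V}
    (hf : FlatOff f D x) (hx : x ∉ D.verts) : f s = f t :=
  (h.eq_of_flat (hf.flat hx) h.terminals_mem.2).symm

theorem IsChain.mem_verts_iff {k : ℕ} {c : Fin k → SPTree V} {p : Fin (k + 1) → V}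
    (hc : IsChain c p) {m : Fin (k + 1)} {i : Fin k} :
    p m ∈ (c i).verts ↔ m = i.castSucc ∨ m = i.succ := by
  constructor
  · intro h
    rcases lt_trichotomy m i.castSucc with hm | hm | hm
    · obtain ⟨j, rfl⟩ : ∃ j : Fin k, m = j.castSucc :=
        ⟨⟨m, hm.trans_le (Fin.le_last _)⟩, rfl⟩
      have h1 := (hc.overlap j i hm _ (hc.left_mem j) h).2
      have h2 := hc.junction_injective h1
      simp [Fin.ext_iff] at h2
    · exact Or.inl hm
    · obtain ⟨j, rfl⟩ := Fin.exists_succ_eq.2 (Fin.ne_zero_of_lt hm)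
      have hij : i ≤ j := by
        simp only [Fin.lt_def, Fin.le_def, Fin.val_succ, Fin.val_castSucc] at hm ⊢
        omega
      rcases hij.lt_or_eq with h1 | rfl
      · have h2 := hc.junction_injective (hc.overlap i j h1 _ h (hc.right_mem j)).2
        exact Or.inr h2
      · exact Or.inr rfl
  · rintro (rfl | rfl)
    exacts [hc.left_mem i, hc.right_mem i]

/-- A series-parallel graph remains connected when a terminal is deleted. -/
theorem IsSP.eq_of_flatOff_terminal {D : SPTree V} {s t : V} (h : D.IsSP s t) {f : V → Bool} :
    (FlatOff f D t → ∀ v ∈ D.verts, v ≠ t → f v = f s) ∧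
      (FlatOff f D s → ∀ v ∈ D.verts, v ≠ s → f v = f t) := by
  induction D generalizing s t with
  | edge a b =>
    obtain ⟨rfl, rfl, -⟩ := h
    constructor
    · rintro - v (rfl | rfl) hv
      exacts [rfl, absurd rfl hv]
    · rintro - v (rfl | rfl) hv
      exacts [absurd rfl hv, rfl]
  | series k c ih =>
    obtain ⟨p, rfl, rfl, hc⟩ := isSP_series_iff.1 h
    have ih := fun i => ih i (hc.isSP i)
    constructor
    · intro hf v hv hvt
      have hf := FlatOff.child.1 hf
      have h1 : ∀ i, ∀ v ∈ (c i).verts, v ≠ p (Fin.last k) → f v = f (p i.castSucc) := by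
        intro i v hv hvt
        by_cases hi : i.succ = Fin.last k
        · exact (ih i).1 (hi ▸ hf i) v hv (hi ▸ hvt)
        · refine (hc.isSP i).eq_of_flat ((hf i).flat fun h => ?_) hv
          rcases hc.mem_verts_iff.1 h with h | h
          · simp [Fin.ext_iff] at h
            omega
          · exact hi h.symm
      obtain ⟨i, hi⟩ := mem_verts_node.1.1 hv
      rw [h1 i v hi hvt]
      refine eq_zero_of_step (q := fun m => f (p m)) fun j hj => ?_
      refine (h1 j _ (hc.right_mem j) fun heq => ?_).symm
      have h2 := hc.junction_injective heq
      rw [h2] at hj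
      simp [Fin.le_def] at hj
      omega
    · intro hf v hv hvs
      have hf := FlatOff.child.1 hf
      have h1 : ∀ i, ∀ v ∈ (c i).verts, v ≠ p 0 → f v = f (p i.succ) := by
        intro i v hv hvs
        by_cases hi : i.castSucc = 0
        · exact (ih i).2 (hi ▸ hf i) v hv (hi ▸ hvs)
        · have h2 : Flat f (c i).edges := (hf i).flat fun h => by
            rcases hc.mem_verts_iff.1 h with h | h
            · exact hi h.symm
            · simp [Fin.ext_iff] at h
          rw [(hc.isSP i).eq_of_flat h2 hv, (hc.isSP i).eq_of_flat h2 (hc.right_mem i)]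
      obtain ⟨i, hi⟩ := mem_verts_node.1.1 hv
      rw [h1 i v hi hvs]
      refine eq_last_of_step (q := fun m => f (p m)) fun j hj => ?_
      refine h1 j _ (hc.left_mem j) fun heq => ?_
      have h2 := hc.junction_injective heq
      rw [h2] at hj
      simp at hj
  | parallel k c ih =>
    have hc := isSP_parallel_iff.1 h
    constructor
    · intro hf v hv hvt
      obtain ⟨i, hi⟩ := mem_verts_node.2.1 hv
      exact (ih i (hc.isSP i)).1 (FlatOff.child.2 hf i) v hi hvt
    · intro hf v hv hvs
      obtain ⟨i, hi⟩ := mem_verts_node.2.1 hv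
      exact (ih i (hc.isSP i)).2 (FlatOff.child.2 hf i) v hi hvs

/-- Unless the root is an S-node, no vertex separates the terminals. -/
theorem IsSP.not_separates {D : SPTree V} {s t : V} (h : D.IsSP s t) (hD : ¬ D.IsSeries) (x : V) :
    ¬ D.Separates s t x := by
  rintro ⟨hxs, hxt, f, hf, hne⟩
  cases D with
  | edge a b =>
    obtain ⟨rfl, rfl, -⟩ := h
    exact hne (hf _ _ ⟨rfl, by simp [hxs, hxt]⟩)
  | series k c => exact hD trivial
  | parallel k c =>
    have hc := isSP_parallel_iff.1 h
    have hk := hc.two_le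
    have hf := FlatOff.child.2 hf
    obtain ⟨i, hi⟩ : ∃ i, x ∉ (c i).verts := by
      by_contra! hall
      rcases hc.overlap ⟨0, by omega⟩ ⟨1, by omega⟩ (by simp) x (hall _) (hall _) with h | h
      exacts [hxs h, hxt h]
    exact hne ((hc.isSP i).eq_of_flatOff (hf i) hi)

section Chain

variable {k : ℕ} {c : Fin k → SPTree V} {p : Fin (k + 1) → V}

/-- The cut that separates the children before a junction from the children after it. -/
theorem IsChain.exists_cut (hc : IsChain c p) (m : Fin (k + 1)) :
    ∃ f : V → Bool, FlatOff f (series k c) (p m) ∧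
      (∀ i : Fin k, i.castSucc < m → ∀ v ∈ (c i).verts, f v = true) ∧
      ∀ i : Fin k, m ≤ i.castSucc → ∀ v ∈ (c i).verts, v ≠ p m → f v = false := by
  classical
  obtain ⟨f, hf⟩ : ∃ f : V → Bool, f = fun v =>
    decide (∃ i : Fin k, i.castSucc < m ∧ v ∈ (c i).verts) := ⟨_, rfl⟩
  have h1 : ∀ i : Fin k, i.castSucc < m → ∀ v ∈ (c i).verts, f v = true := by
    intro i hi v hv
    rw [hf]
    exact decide_eq_true ⟨i, hi, hv⟩
  have h2 : ∀ i : Fin k, m ≤ i.castSucc → ∀ v ∈ (c i).verts, v ≠ p m → f v = false := by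
    intro i hi v hv hvm
    rw [hf]
    refine decide_eq_false ?_
    rintro ⟨j, hj, hvj⟩
    have h3 := hc.overlap j i (by simpa using hj.trans_le hi) v hvj hv
    refine hvm (h3.2.trans (congrArg p ?_))
    simp only [Fin.ext_iff, Fin.lt_def, Fin.le_def, Fin.val_succ, Fin.val_castSucc] at *
    omega
  refine ⟨f, ?_, h1, h2⟩
  rintro a b ⟨hab, hx⟩
  obtain ⟨i, hi⟩ := mem_edges_node.1.1 hab
  obtain ⟨ha, hb⟩ := mem_verts_of_mem_edges hi
  rw [Sym2.mem_iff, not_or] at hx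
  rcases lt_or_ge i.castSucc m with h | h
  · rw [h1 i h a ha, h1 i h b hb]
  · rw [h2 i h a ha (Ne.symm hx.1), h2 i h b hb (Ne.symm hx.2)]

/-- The inner junctions of an S-node are the vertices that separate its terminals. -/
theorem IsChain.separates_iff (hc : IsChain c p) (hns : ∀ i, ¬ (c i).IsSeries) {x : V} :
    (series k c).Separates (p 0) (p (Fin.last k)) x ↔
      ∃ m : Fin (k + 1), m ≠ 0 ∧ m ≠ Fin.last k ∧ x = p m := by
  have hk := hc.two_le
  constructor
  · rintro ⟨hx0, hx1, f, hf, hne⟩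
    by_contra! hno
    refine hne (eq_last_of_step (q := fun m => f (p m)) fun i _ => ?_)
    by_contra hi
    refine (hc.isSP i).not_separates (hns i) x ⟨?_, ?_, f, FlatOff.child.1 hf i, hi⟩
    all_goals
      rintro rfl
      exact hno _ (fun h => hx0 (congrArg p h)) (fun h => hx1 (congrArg p h)) rfl
  · rintro ⟨m, h0, h1, rfl⟩
    have hinj := hc.junction_injective
    obtain ⟨f, hf, h2, h3⟩ := hc.exists_cut m
    refine ⟨hinj.ne h0, hinj.ne h1, f, hf, ?_⟩
    have e0 : Fin.castSucc (⟨0, by omega⟩ : Fin k) = 0 := rfl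
    have e1 : Fin.succ (⟨k - 1, by omega⟩ : Fin k) = Fin.last k := by
      simp only [Fin.ext_iff, Fin.val_last, Fin.val_succ]; omega
    have h4 := h2 ⟨0, by omega⟩ (by rw [e0]; exact Fin.pos_of_ne_zero h0) _ (hc.left_mem _)
    have h5 := h3 ⟨k - 1, by omega⟩ (by
      have := Fin.lt_last_iff_ne_last.2 h1
      simp only [Fin.lt_def, Fin.le_def, Fin.val_last, Fin.val_castSucc] at this ⊢
      omega) _ (hc.right_mem _) (hinj.ne (by rw [e1]; exact h1.symm))
    rw [e0] at h4
    rw [e1] at h5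
    simp [h4, h5]

end Chain

/-! ### The decomposition tree is determined by the graph -/

/-- The vertices that separate `s` and `t`, in such a way that the edge `e` is on the side
of `t`. -/
def before (D : SPTree V) (s t : V) (e : Sym2 V) : Set V :=
  {x | x ≠ s ∧ x ≠ t ∧ ∃ f : V → Bool, FlatOff f D x ∧ f s ≠ f t ∧ ∃ y ∈ e, y ≠ x ∧ f y ≠ f s}

theorem before_congr {D D' : SPTree V} (h : D.edges = D'.edges) (s t : V) (e : Sym2 V) :
    D.before s t e = D'.before s t e := by
  simp only [before, FlatOff, h]

theorem separates_congr {D D' : SPTree V} (h : D.edges = D'.edges) (s t x : V) :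
    D.Separates s t x ↔ D'.Separates s t x := by
  simp only [Separates, FlatOff, h]

/-- The position of the child of an S-node that contains an edge is determined by the graph. -/
theorem IsChain.ncard_before {k : ℕ} {c : Fin k → SPTree V} {p : Fin (k + 1) → V}
    (hc : IsChain c p) (hns : ∀ i, ¬ (c i).IsSeries) {i : Fin k} {e : Sym2 V}
    (he : e ∈ (c i).edges) : ((series k c).before (p 0) (p (Fin.last k)) e).ncard = i := by
  have hinj := hc.junction_injective
  have hk := hc.two_le
  have h1 : (series k c).before (p 0) (p (Fin.last k)) e =
      p '' (Finset.Ioc 0 i.castSucc : Finset (Fin (k + 1))) := by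
    ext x
    simp only [Set.mem_image, Finset.coe_Ioc, Set.mem_Ioc]
    constructor
    · rintro ⟨hx0, hx1, f, hf, hst, y, hy, hyx, hne⟩
      obtain ⟨m, hm0, hm1, rfl⟩ := (hc.separates_iff hns).1 ⟨hx0, hx1, f, hf, hst⟩
      refine ⟨m, ⟨Fin.pos_of_ne_zero hm0, ?_⟩, rfl⟩
      by_contra! hlt
      have hf := FlatOff.child.1 hf
      have h2 : ∀ j : Fin k, j.castSucc < m → ∀ v ∈ (c j).verts, v ≠ p m →
          f v = f (p j.castSucc) := by
        intro j hj v hv hvm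
        by_cases hjm : j.succ = m
        · subst hjm
          exact ((hc.isSP j).eq_of_flatOff_terminal.1 (hf j)) v hv hvm
        · refine (hc.isSP j).eq_of_flat ((hf j).flat fun h => ?_) hv
          rcases hc.mem_verts_iff.1 h with h | h
          exacts [hj.ne h.symm, hjm h.symm]
      refine hne ((h2 i hlt y (SPTree.mem_verts_iff.2 ⟨e, he, hy⟩) hyx).trans ?_)
      refine eq_zero_of_step (q := fun m => f (p m)) fun j hj => ?_
      have h3 : j.succ < m := hj.trans_lt hlt
      exact (h2 j ((Fin.castSucc_lt_succ (i := j)).trans h3) _ (hc.right_mem j)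
        (hinj.ne h3.ne)).symm
    · rintro ⟨m, ⟨hm0, hmi⟩, rfl⟩
      have hml : m ≠ Fin.last k := fun h => by
        rw [h] at hmi
        simp only [Fin.le_def, Fin.val_last, Fin.val_castSucc] at hmi
        omega
      obtain ⟨f, hf, h2, h3⟩ := hc.exists_cut m
      have e0 : Fin.castSucc (⟨0, by omega⟩ : Fin k) = 0 := rfl
      have e1 : Fin.succ (⟨k - 1, by omega⟩ : Fin k) = Fin.last k := by
        simp only [Fin.ext_iff, Fin.val_last, Fin.val_succ]; omega
      have h4 := h2 ⟨0, by omega⟩ (by rw [e0]; exact hm0) _ (hc.left_mem _)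
      have h5 := h3 ⟨k - 1, by omega⟩ (by
        have := Fin.lt_last_iff_ne_last.2 hml
        simp only [Fin.lt_def, Fin.le_def, Fin.val_last, Fin.val_castSucc] at this ⊢
        omega) _ (hc.right_mem _) (hinj.ne (by rw [e1]; exact hml.symm))
      rw [e0] at h4
      rw [e1] at h5
      refine ⟨hinj.ne hm0.ne', hinj.ne hml, f, hf, by simp [h4, h5], ?_⟩
      have hdiag := (hc.isSP i).not_isDiag he
      induction e using Sym2.ind with
      | _ a b =>
        obtain ⟨ha, hb⟩ := mem_verts_of_mem_edges he
        by_cases ham : a = p m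
        · have hbm : b ≠ p m := fun h => hdiag (by simp [ham, h])
          exact ⟨b, by simp, hbm, by simp [h4, h3 i hmi b hb hbm]⟩
        · exact ⟨a, by simp, ham, by simp [h4, h3 i hmi a ha ham]⟩
  rw [h1, Set.ncard_image_of_injective _ hinj, Set.ncard_coe_finset]
  simp

theorem verts_eq_of_edges_eq {D D' : SPTree V} (h : D.edges = D'.edges) : D.verts = D'.verts := by
  ext v
  simp only [mem_verts_iff, h]

/-- The children of an S-node, and their terminals, are determined by the graph. -/
theorem IsChain.unique {k k' : ℕ} {c : Fin k → SPTree V} {c' : Fin k' → SPTree V}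
    {p : Fin (k + 1) → V} {p' : Fin (k' + 1) → V} (hc : IsChain c p) (hc' : IsChain c' p')
    (hns : ∀ i, ¬ (c i).IsSeries) (hns' : ∀ i, ¬ (c' i).IsSeries) (h0 : p 0 = p' 0)
    (h1 : p (Fin.last k) = p' (Fin.last k')) (he : (series k c).edges = (series k' c').edges) :
    ∃ σ : Fin k ≃ Fin k', (∀ i, (σ i : ℕ) = i) ∧ ∀ i, (c i).edges = (c' (σ i)).edges ∧
      p i.castSucc = p' (σ i).castSucc ∧ p i.succ = p' (σ i).succ := by
  have hidx : ∀ (i : Fin k) (j : Fin k'), ∀ e, e ∈ (c i).edges → e ∈ (c' j).edges →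
      (i : ℕ) = j := by
    intro i j e hi hj
    rw [← hc.ncard_before hns hi, ← hc'.ncard_before hns' hj, before_congr he, h0, h1]
  have hL : ∀ i : Fin k, ∃ j : Fin k', (j : ℕ) = i ∧ (c i).edges ⊆ (c' j).edges := by
    intro i
    obtain ⟨e, hei⟩ := (hc.isSP i).exists_mem_edges
    obtain ⟨j, hej⟩ := mem_edges_node.1.1 (he ▸ mem_edges_node.1.2 ⟨i, hei⟩)
    refine ⟨j, (hidx i j e hei hej).symm, fun e' he' => ?_⟩
    obtain ⟨j', hj'⟩ := mem_edges_node.1.1 (he ▸ mem_edges_node.1.2 ⟨i, he'⟩)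
    have : j' = j := by
      ext
      rw [← hidx i j e hei hej, hidx i j' e' he' hj']
    exact this ▸ hj'
  have hR : ∀ j : Fin k', ∃ i : Fin k, (i : ℕ) = j ∧ (c' j).edges ⊆ (c i).edges := by
    intro j
    obtain ⟨e, hej⟩ := (hc'.isSP j).exists_mem_edges
    obtain ⟨i, hei⟩ := mem_edges_node.1.1 (he ▸ mem_edges_node.1.2 ⟨j, hej⟩)
    refine ⟨i, hidx i j e hei hej, fun e' he' => ?_⟩
    obtain ⟨i', hi'⟩ := mem_edges_node.1.1 (he ▸ mem_edges_node.1.2 ⟨j, he'⟩)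
    have : i' = i := by
      ext
      rw [hidx i j e hei hej, hidx i' j e' hi' he']
    exact this ▸ hi'
  obtain rfl : k = k' := by
    have hk := hc.two_le
    have hk' := hc'.two_le
    obtain ⟨j, hj, -⟩ := hL ⟨k - 1, by omega⟩
    obtain ⟨i, hi, -⟩ := hR ⟨k' - 1, by omega⟩
    have := j.2
    have := i.2
    simp only at hi hj
    omega
  have hE : ∀ i, (c i).edges = (c' i).edges := by
    intro i
    obtain ⟨j, hj, hj'⟩ := hL i
    obtain ⟨j', hi, hi'⟩ := hR i
    obtain rfl : j = i := Fin.ext hj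
    obtain rfl : j' = j := Fin.ext hi
    exact hj'.antisymm hi'
  have hp : ∀ m, p m = p' m := by
    intro m
    by_cases hm0 : m = 0
    · rw [hm0, h0]
    by_cases hm1 : m = Fin.last k
    · rw [hm1, h1]
    obtain ⟨i, rfl⟩ := Fin.exists_succ_eq.2 hm0
    have hi : (i : ℕ) + 1 < k := by
      simp only [Fin.ext_iff, Fin.val_last, Fin.val_succ] at hm1
      have := i.2
      omega
    have h2 : i.succ = (⟨i + 1, hi⟩ : Fin k).castSucc := rfl
    have h3 := hc'.right_mem i
    have h4 := hc'.left_mem ⟨i + 1, hi⟩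
    rw [← verts_eq_of_edges_eq (hE _)] at h3 h4
    exact (hc.overlap i ⟨i + 1, hi⟩ (by simp [Fin.lt_def]) _ h3 h4).2.symm
  exact ⟨Equiv.refl _, fun _ => rfl, fun i => ⟨hE i, hp _, hp _⟩⟩

/-- A child of a P-node that is not a P-node cannot be distributed over several children of
another P-node on the same graph: without the terminals, it is connected. -/
theorem IsBundle.exists_edges_subset {k : ℕ} {c : Fin k → SPTree V} {s t : V}
    (hc : IsBundle c s t) {D : SPTree V} (hD : D.IsSP s t) (hns : ¬ D.IsParallel)
    (hsub : D.edges ⊆ (parallel k c).edges) : ∃ i, D.edges ⊆ (c i).edges := by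
  classical
  cases D with
  | edge a b =>
    obtain ⟨i, hi⟩ := mem_edges_node.2.1 (hsub rfl)
    exact ⟨i, by rintro _ rfl; exact hi⟩
  | parallel _ _ => exact absurd trivial hns
  | series l d =>
    obtain ⟨p, rfl, rfl, hd⟩ := isSP_series_iff.1 hD
    have hl := hd.two_le
    have hinj := hd.junction_injective
    -- the first inner junction
    obtain ⟨m, hm⟩ : ∃ m : Fin (l + 1), (m : ℕ) = 1 := ⟨⟨1, by omega⟩, rfl⟩
    have hm0 : p m ≠ p 0 := hinj.ne (by simp [Fin.ext_iff, hm])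
    have hm1 : p m ≠ p (Fin.last l) := hinj.ne (by simp [Fin.ext_iff, hm]; omega)
    have hpm : p m ∈ (d ⟨0, by omega⟩).verts :=
      hd.mem_verts_iff.2 (Or.inr (Fin.ext (by simp [hm])))
    obtain ⟨e₀, he₀, hme₀⟩ := SPTree.mem_verts_iff.1 hpm
    obtain ⟨i, hi⟩ := mem_edges_node.2.1 (hsub (mem_edges_node.1.2 ⟨_, he₀⟩))
    have hpi : p m ∈ (c i).verts := SPTree.mem_verts_iff.2 ⟨_, hi, hme₀⟩
    have hchild : ∀ j, ∀ v ∈ (c j).verts, v ≠ p 0 → v ≠ p (Fin.last l) →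
        v ∈ (c i).verts → j = i := by
      intro j v hv h0 h1 hvi
      by_contra hne
      rcases hc.overlap j i hne v hv hvi with h | h
      exacts [h0 h, h1 h]
    obtain ⟨f, hf⟩ : ∃ f : V → Bool, f = fun v => decide (v ∈ (c i).verts) := ⟨_, rfl⟩
    have hflat : ∀ a b, s(a, b) ∈ (series l d).edges → p 0 ∉ s(a, b) →
        p (Fin.last l) ∉ s(a, b) → f a = f b := by
      intro a b hab h0 h1
      obtain ⟨j, hj⟩ := mem_edges_node.2.1 (hsub hab)
      obtain ⟨ha, hb⟩ := mem_verts_of_mem_edges hj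
      rw [Sym2.mem_iff, not_or] at h0 h1
      simp only [hf, decide_eq_decide]
      constructor
      · intro h
        exact hchild j a ha (Ne.symm h0.1) (Ne.symm h1.1) h ▸ hb
      · intro h
        exact hchild j b hb (Ne.symm h0.2) (Ne.symm h1.2) h ▸ ha
    have hfirst : ∀ j : Fin l, j.castSucc = 0 → p (Fin.last l) ∉ (d j).verts := by
      intro j hj h
      rcases hd.mem_verts_iff.1 h with h | h
      all_goals
        simp only [Fin.ext_iff, Fin.val_last, Fin.val_succ, Fin.val_castSucc, Fin.val_zero] at hj h
        omega
    have hlast : ∀ j : Fin l, j.castSucc ≠ 0 → p 0 ∉ (d j).verts := by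
      intro j hj h
      rcases hd.mem_verts_iff.1 h with h | h
      · exact hj h.symm
      · simp [Fin.ext_iff] at h
    have hmem : ∀ {j : Fin l} {e : Sym2 V} {v : V}, e ∈ (d j).edges → v ∈ e → v ∈ (d j).verts :=
      fun he hv => SPTree.mem_verts_iff.2 ⟨_, he, hv⟩
    -- every inner vertex is connected with the end of its child that is next to the junction `p 1`
    have hzero : ∀ j : Fin l, j.castSucc = 0 → ∀ v ∈ (d j).verts, v ≠ p 0 → f v = f (p j.succ) := by
      intro j hj v hv hv0
      refine (hd.isSP j).eq_of_flatOff_terminal.2 ?_ v hv (hj ▸ hv0)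
      rintro a b ⟨hab, h0⟩
      exact hflat a b (mem_edges_node.1.2 ⟨j, hab⟩) (hj ▸ h0) fun h => hfirst j hj (hmem hab h)
    have hpos : ∀ j : Fin l, j.castSucc ≠ 0 → ∀ v ∈ (d j).verts, v ≠ p (Fin.last l) →
        f v = f (p j.castSucc) := by
      intro j hj v hv hv1
      have h1 : ∀ a b, s(a, b) ∈ (d j).edges → p (Fin.last l) ∉ s(a, b) → f a = f b :=
        fun a b hab h => hflat a b (mem_edges_node.1.2 ⟨j, hab⟩)
          (fun h0 => hlast j hj (hmem hab h0)) h
      by_cases hjl : j.succ = Fin.last l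
      · exact (hd.isSP j).eq_of_flatOff_terminal.1 (fun a b hab => h1 a b hab.1 (hjl ▸ hab.2)) v hv
          (hjl ▸ hv1)
      · refine (hd.isSP j).eq_of_flat (fun a b hab => h1 a b hab fun h => ?_) hv
        rcases hd.mem_verts_iff.1 (hmem hab h) with h | h
        · simp only [Fin.ext_iff, Fin.val_last, Fin.val_castSucc] at h
          omega
        · exact hjl h.symm
    have hjunction : ∀ n : Fin (l + 1), n ≠ 0 → n ≠ Fin.last l → f (p n) = true := by
      intro n
      induction n using Fin.induction with
      | zero => exact fun h => absurd rfl h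
      | succ j ih =>
        intro _ hjl
        by_cases hj : j.castSucc = 0
        · have : j.succ = m := by
            simp only [Fin.ext_iff, Fin.val_succ, Fin.val_castSucc, Fin.val_zero] at hj ⊢
            omega
          rw [this, hf]
          exact decide_eq_true hpi
        · rw [hpos j hj _ (hd.right_mem j) (hinj.ne hjl)]
          refine ih hj fun h => ?_
          simp only [Fin.ext_iff, Fin.val_last, Fin.val_castSucc] at h
          omega
    have hinner : ∀ v ∈ (series l d).verts, v ≠ p 0 → v ≠ p (Fin.last l) → v ∈ (c i).verts := by
      intro v hv h0 h1
      suffices f v = true by simpa [hf] using this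
      obtain ⟨j, hj⟩ := mem_verts_node.1.1 hv
      by_cases hj0 : j.castSucc = 0
      · rw [hzero j hj0 v hj h0]
        refine hjunction _ (Fin.succ_ne_zero j) fun h => ?_
        simp only [Fin.ext_iff, Fin.val_last, Fin.val_succ, Fin.val_castSucc, Fin.val_zero] at h hj0
        omega
      · rw [hpos j hj0 v hj h1]
        refine hjunction _ hj0 fun h => ?_
        simp only [Fin.ext_iff, Fin.val_last, Fin.val_castSucc] at h
        omega
    refine ⟨i, fun e he => ?_⟩
    obtain ⟨j, hj⟩ := mem_edges_node.1.1 he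
    obtain ⟨i', hi'⟩ := mem_edges_node.2.1 (hsub he)
    -- no child contains both terminals, so every edge has an inner vertex
    obtain ⟨y, hye, hy0, hy1⟩ : ∃ y ∈ e, y ≠ p 0 ∧ y ≠ p (Fin.last l) := by
      have hdiag := (hd.isSP j).not_isDiag hj
      have hnot : ¬ (p 0 ∈ (d j).verts ∧ p (Fin.last l) ∈ (d j).verts) := by
        rintro ⟨h0, h1⟩
        by_cases hj0 : j.castSucc = 0
        exacts [hfirst j hj0 h1, hlast j hj0 h0]
      induction e using Sym2.ind with
      | _ a b =>
        obtain ⟨ha, hb⟩ := mem_verts_of_mem_edges hj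
        by_contra! hno
        have h2 := hno a (by simp)
        have h3 := hno b (by simp)
        have hab : a ≠ b := fun h => hdiag (by simp [h])
        by_cases ha0 : a = p 0
        · have hb1 := h3 (ha0 ▸ hab.symm)
          exact hnot ⟨ha0 ▸ ha, hb1 ▸ hb⟩
        · have ha1 := h2 ha0
          have hb0 : b = p 0 := by
            by_contra hb0
            exact hab (ha1.trans (h3 hb0).symm)
          exact hnot ⟨hb0 ▸ hb, ha1 ▸ ha⟩
    have hy := hinner y (SPTree.mem_verts_iff.2 ⟨e, he, hye⟩) hy0 hy1
    exact hchild i' y (SPTree.mem_verts_iff.2 ⟨e, hi', hye⟩) hy0 hy1 hy ▸ hi'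

/-- The children of a P-node are determined by the graph, up to their order. -/
theorem IsBundle.unique {k k' : ℕ} {c : Fin k → SPTree V} {c' : Fin k' → SPTree V} {s t : V}
    (hc : IsBundle c s t) (hc' : IsBundle c' s t) (hnp : ∀ i, ¬ (c i).IsParallel)
    (hnp' : ∀ i, ¬ (c' i).IsParallel) (he : (parallel k c).edges = (parallel k' c').edges) :
    ∃ σ : Fin k ≃ Fin k', ∀ i, (c i).edges = (c' (σ i)).edges := by
  have hsub : ∀ {k : ℕ} {c : Fin k → SPTree V} (i : Fin k), (c i).edges ⊆ (parallel k c).edges :=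
    fun i e he => mem_edges_node.2.2 ⟨i, he⟩
  choose φ hφ using fun i => hc'.exists_edges_subset (hc.isSP i) (hnp i) (he ▸ hsub i)
  choose ψ hψ using fun i => hc.exists_edges_subset (hc'.isSP i) (hnp' i) (he ▸ hsub i)
  have h1 : ∀ {k : ℕ} {c : Fin k → SPTree V}, IsBundle c s t → ∀ i j,
      (c i).edges ⊆ (c j).edges → i = j := by
    intro k c hc i j hij
    by_contra hne
    obtain ⟨e, he⟩ := (hc.isSP i).exists_mem_edges
    exact Set.disjoint_left.1 (hc.disjoint i j hne) he (hij he)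
  have h2 : ∀ i, ψ (φ i) = i := fun i => (h1 hc _ _ ((hφ i).trans (hψ _))).symm
  have h3 : ∀ i, φ (ψ i) = i := fun i => (h1 hc' _ _ ((hψ i).trans (hφ _))).symm
  refine ⟨⟨φ, ψ, h2, h3⟩, fun i => (hφ i).antisymm ?_⟩
  have := hψ (φ i)
  rwa [h2] at this

theorem iUnion_edges_ne_singleton {k : ℕ} {c : Fin k → SPTree V} (hk : 2 ≤ k)
    (hne : ∀ i, ∃ e, e ∈ (c i).edges)
    (hdis : ∀ i j, i ≠ j → Disjoint (c i).edges (c j).edges) (u v : V) :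
    (⋃ i, (c i).edges) ≠ {s(u, v)} := by
  intro h
  have h1 : ∀ i, s(u, v) ∈ (c i).edges := by
    intro i
    obtain ⟨e, he⟩ := hne i
    have h2 : e ∈ ⋃ i, (c i).edges := Set.mem_iUnion.2 ⟨i, he⟩
    rw [h] at h2
    exact (show e = s(u, v) from h2) ▸ he
  exact Set.disjoint_left.1 (hdis ⟨0, by omega⟩ ⟨1, by omega⟩ (by simp)) (h1 _) (h1 _)

/-- Two alternating decomposition trees of the same oriented graph agree, up to the order of the
children of P-nodes. -/
theorem isoVia_id_of_edges_eq {D D' : SPTree V} {s t : V} (hD : D.IsSP s t) (hD' : D'.IsSP s t)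
    (ha : D.Alternating) (ha' : D'.Alternating) (he : D.edges = D'.edges) : IsoVia id D D' := by
  have hnode : ∀ {k : ℕ} {c : Fin k → SPTree V} {a b s t : V}, ((series k c).IsSP s t →
      (series k c).edges ≠ (edge a b).edges) ∧ ((parallel k c).IsSP s t →
      (parallel k c).edges ≠ (edge a b).edges) := by
    intro k c a b s t
    constructor
    · intro h
      obtain ⟨p, -, -, hc⟩ := isSP_series_iff.1 h
      exact iUnion_edges_ne_singleton hc.two_le (fun i => (hc.isSP i).exists_mem_edges)
        hc.disjoint_edges a b
    · intro h
      have hc := isSP_parallel_iff.1 h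
      exact iUnion_edges_ne_singleton hc.two_le (fun i => (hc.isSP i).exists_mem_edges)
        hc.disjoint a b
  have hmixed : ∀ {k k' : ℕ} {c : Fin k → SPTree V} {c' : Fin k' → SPTree V} {s t : V},
      (series k c).IsSP s t → (series k c).Alternating → (parallel k' c').IsSP s t →
      (series k c).edges ≠ (parallel k' c').edges := by
    intro k k' c c' s t h ha h' he
    obtain ⟨p, rfl, rfl, hc⟩ := isSP_series_iff.1 h
    have hk := hc.two_le
    refine h'.not_separates (fun h => h) (p ⟨1, by omega⟩) ((separates_congr he _ _ _).1 ?_)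
    refine (hc.separates_iff fun i => (ha i).1).2 ⟨_, ?_, ?_, rfl⟩
    all_goals simp only [ne_eq, Fin.ext_iff, Fin.val_zero, Fin.val_last]; omega
  induction D generalizing D' s t with
  | edge a b =>
    cases D' with
    | edge a' b' =>
      obtain ⟨rfl, rfl, -⟩ := hD
      obtain ⟨rfl, rfl, -⟩ := hD'
      exact ⟨rfl, rfl⟩
    | series _ _ => exact absurd he.symm (hnode.1 hD')
    | parallel _ _ => exact absurd he.symm (hnode.2 hD')
  | series k c ih =>
    cases D' with
    | edge _ _ => exact absurd he (hnode.1 hD)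
    | parallel _ _ => exact absurd he (hmixed hD ha hD')
    | series k' c' =>
      obtain ⟨p, rfl, rfl, hc⟩ := isSP_series_iff.1 hD
      obtain ⟨p', h0, h1, hc'⟩ := isSP_series_iff.1 hD'
      obtain ⟨σ, hσ, h⟩ := hc.unique hc' (fun i => (ha i).1) (fun i => (ha' i).1) h0.symm h1.symm he
      refine ⟨σ, hσ, fun i => ih i (hc.isSP i) ?_ (ha i).2 (ha' _).2 (h i).1⟩
      rw [(h i).2.1, (h i).2.2]
      exact hc'.isSP _
  | parallel k c ih =>
    cases D' with
    | edge _ _ => exact absurd he (hnode.2 hD)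
    | series _ _ => exact absurd he.symm (hmixed hD' ha' hD)
    | parallel k' c' =>
      have hc := isSP_parallel_iff.1 hD
      have hc' := isSP_parallel_iff.1 hD'
      obtain ⟨σ, h⟩ := hc.unique hc' (fun i => (ha i).1) (fun i => (ha' i).1) he
      exact ⟨σ, fun i => ih i (hc.isSP i) (hc'.isSP _) (ha i).2 (ha' _).2 (h i)⟩

/-! ### Moving decomposition trees along isomorphisms -/

/-- Relabel the vertices of a decomposition tree. -/
def map (φ : V → V) : SPTree V → SPTree V
  | edge u v => edge (φ u) (φ v)
  | series k c => series k fun i => (c i).map φ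
  | parallel k c => parallel k fun i => (c i).map φ

theorem isoVia_map (φ : V → V) (D : SPTree V) : IsoVia φ D (D.map φ) := by
  induction D with
  | edge u v => exact ⟨rfl, rfl⟩
  | series k c ih => exact ⟨Equiv.refl _, fun _ => rfl, ih⟩
  | parallel k c ih => exact ⟨Equiv.refl _, ih⟩

theorem edges_map (φ : V → V) (D : SPTree V) : (D.map φ).edges = Sym2.map φ '' D.edges := by
  ext e
  constructor
  · intro h
    obtain ⟨e', h1, h2⟩ := (isoVia_map φ D).exists_of_mem_edges h
    exact ⟨e', h1, h2⟩
  · rintro ⟨e', h1, rfl⟩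
    exact (isoVia_map φ D).map_mem_edges h1

theorem IsSP.map {φ : V → V} (hφ : Function.Injective φ) {D : SPTree V} {s t : V}
    (h : D.IsSP s t) : (D.map φ).IsSP (φ s) (φ t) := by
  have hmem : ∀ {D : SPTree V} {w : V}, w ∈ (D.map φ).verts → ∃ v ∈ D.verts, φ v = w := by
    intro D w hw
    rw [← (isoVia_map φ D).image_verts] at hw
    exact hw
  induction D generalizing s t with
  | edge u v =>
    obtain ⟨rfl, rfl, hne⟩ := h
    exact ⟨rfl, rfl, hφ.ne hne⟩
  | series k c ih =>
    obtain ⟨p, rfl, rfl, hc⟩ := isSP_series_iff.1 h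
    refine isSP_series_iff.2 ⟨fun m => φ (p m), rfl, rfl, hc.two_le, fun i => ih i (hc.isSP i), ?_⟩
    intro i j hij w hi hj
    obtain ⟨v, hv, rfl⟩ := hmem hi
    obtain ⟨v', hv', h1⟩ := hmem hj
    obtain rfl := hφ h1
    obtain ⟨h2, h3⟩ := hc.overlap i j hij v' hv hv'
    exact ⟨h2, congrArg φ h3⟩
  | parallel k c ih =>
    have hc := isSP_parallel_iff.1 h
    refine isSP_parallel_iff.2 ⟨hc.two_le, fun i => ih i (hc.isSP i), ?_, ?_⟩
    · intro i j hij w hi hj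
      obtain ⟨v, hv, rfl⟩ := hmem hi
      obtain ⟨v', hv', h1⟩ := hmem hj
      obtain rfl := hφ h1
      exact (hc.overlap i j hij v' hv hv').imp (congrArg φ) (congrArg φ)
    · intro i j hij
      rw [edges_map, edges_map]
      exact Set.disjoint_image_of_injective (Sym2.map.injective hφ) (hc.disjoint i j hij)

theorem Alternating.map (φ : V → V) {D : SPTree V} (h : D.Alternating) :
    (D.map φ).Alternating := by
  have h1 : ∀ D : SPTree V, ((D.map φ).IsSeries ↔ D.IsSeries) ∧
      ((D.map φ).IsParallel ↔ D.IsParallel) := by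
    intro D
    cases D <;> exact ⟨Iff.rfl, Iff.rfl⟩
  induction D with
  | edge u v => trivial
  | series k c ih => exact fun i => ⟨fun h' => (h i).1 ((h1 _).1.1 h'), ih i (h i).2⟩
  | parallel k c ih => exact fun i => ⟨fun h' => (h i).1 ((h1 _).2.1 h'), ih i (h i).2⟩

end SPTree

/-! ### Spanning trees, near trees and orbits in terms of the decomposition tree -/

theorem SimpleGraph.Reachable.eq_of_flat {V : Type*} {T : SimpleGraph V} {f : V → Bool}
    (hf : Flat f T.edgeSet) {v w : V} (h : T.Reachable v w) : f v = f w := by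
  obtain ⟨p⟩ := h
  induction p with
  | nil => rfl
  | cons hadj _ ih => exact (hf _ _ hadj).trans ih

theorem SimpleGraph.flat_reachable {V : Type*} (T : SimpleGraph V) (v : V)
    [DecidablePred (T.Reachable v)] : Flat (fun w => decide (T.Reachable v w)) T.edgeSet := by
  intro a b hab
  have hab : T.Adj a b := hab
  simp only [decide_eq_decide]
  exact ⟨fun h => h.trans hab.reachable, fun h => h.trans hab.symm.reachable⟩

namespace SPTree

universe u

variable {V : Type u} {D : SPTree V} {G : SimpleGraph V} {s t : V}

theorem IsDecompositionOf.mem_verts (h : D.IsDecompositionOf G s t) (v : V) : v ∈ D.verts :=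
  h.verts_eq ▸ Set.mem_univ v

theorem IsDecompositionOf.edges_inter (h : D.IsDecompositionOf G s t) {T : SimpleGraph V}
    (hT : T ≤ G) : D.edges ∩ T.edgeSet = T.edgeSet := by
  rw [h.edges_eq]
  exact Set.inter_eq_right.2 (SimpleGraph.edgeSet_mono hT)

theorem IsDecompositionOf.connected_iff (h : D.IsDecompositionOf G s t) {T : SimpleGraph V}
    (hT : T ≤ G) : T.Connected ↔ D.Connects s t true T.edgeSet := by
  classical
  constructor
  · intro hcon f hf _ v _
    rw [h.edges_inter hT] at hf
    exact (hcon.preconnected v s).eq_of_flat hf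
  · intro hcon
    have h1 := fun v => hcon _ ((T.flat_reachable s).mono Set.inter_subset_right)
      (fun h => nomatch h) v (h.mem_verts v)
    have h2 : ∀ v, T.Reachable s v := fun v => by
      simpa using h1 v
    exact (SimpleGraph.connected_iff_exists_forall_reachable T).2 ⟨s, h2⟩

theorem IsDecompositionOf.exists_graph (h : D.IsDecompositionOf G s t) {F : Set (Sym2 V)}
    (hF : F ⊆ D.edges) : ∃ T ≤ G, T.edgeSet = F := by
  have hd : ∀ e ∈ F, ¬ e.IsDiag := fun e he => h.isSP.not_isDiag (hF he)
  have h1 : (SimpleGraph.fromEdgeSet F).edgeSet = F := by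
    rw [SimpleGraph.edgeSet_fromEdgeSet]
    ext e
    exact ⟨fun he => he.1, fun he => ⟨he, hd e he⟩⟩
  refine ⟨_, ?_, h1⟩
  rw [← SimpleGraph.edgeSet_subset_edgeSet, h1, ← h.edges_eq]
  exact hF

theorem IsDecompositionOf.isTree_iff (h : D.IsDecompositionOf G s t) {T : SimpleGraph V}
    (hT : T ≤ G) : T.IsTree ↔ D.IsTreeOn true T.edgeSet := by
  rw [SimpleGraph.isTree_iff_minimal_connected]
  constructor
  · rintro ⟨hcon, hmin⟩
    obtain ⟨F, hF, hF'⟩ := ((h.connected_iff hT).1 hcon).exists_isTreeOn h.isSP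
    obtain ⟨T', hT', rfl⟩ := h.exists_graph
      (hF.trans ((SimpleGraph.edgeSet_mono hT).trans h.edges_eq.symm.subset))
    have hle : T' ≤ T := SimpleGraph.edgeSet_subset_edgeSet.1 hF
    have := hmin ((h.connected_iff hT').2 (hF'.connects h.isSP)) hle
    rwa [le_antisymm hle this] at hF'
  · intro hF
    refine ⟨(h.connected_iff hT).2 (hF.connects h.isSP), fun T' hcon hle => ?_⟩
    have h1 := hF.mem_of_connects h.isSP (SimpleGraph.edgeSet_mono hle)
      ((h.connected_iff (hle.trans hT)).1 hcon)
    refine SimpleGraph.edgeSet_subset_edgeSet.1 fun e he => h1 e ?_ he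
    rw [h.edges_eq]
    exact SimpleGraph.edgeSet_mono hT he

theorem IsDecompositionOf.mem_spanningTreeSet_iff (h : D.IsDecompositionOf G s t)
    {T : SimpleGraph V} : T ∈ spanningTreeSet G ↔ T ≤ G ∧ D.IsTreeOn true T.edgeSet :=
  and_congr_right fun hT => h.isTree_iff hT

theorem IsDecompositionOf.mem_nearTreeSet_iff (h : D.IsDecompositionOf G s t)
    {N : SimpleGraph V} : N ∈ nearTreeSet G s t ↔ N ≤ G ∧ D.IsTreeOn false N.edgeSet := by
  classical
  have hcut : ∀ {N : SimpleGraph V}, N ≤ G → (¬ N.Reachable s t ↔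
      ∃ g : V → Bool, Flat g (D.edges ∩ N.edgeSet) ∧ g s ≠ g t) := by
    intro N hN
    rw [h.edges_inter hN]
    constructor
    · exact fun hst => ⟨_, N.flat_reachable s, by simp [hst]⟩
    · rintro ⟨g, hg, hst⟩ hr
      exact hst (hr.eq_of_flat hg)
  constructor
  · rintro ⟨T, hT, e, he, rfl, hst⟩
    obtain ⟨hTG, hT⟩ := h.mem_spanningTreeSet_iff.1 hT
    have hN : T.deleteEdges {e} ≤ G := (SimpleGraph.deleteEdges_le _).trans hTG
    refine ⟨hN, (isTreeOn_false_iff h.isSP).2 ⟨e, ?_, ?_, ?_, (hcut hN).1 hst⟩⟩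
    · rw [h.edges_eq]
      exact SimpleGraph.edgeSet_mono hTG he
    · simp [SimpleGraph.edgeSet_deleteEdges]
    · rwa [SimpleGraph.edgeSet_deleteEdges, Set.insert_sdiff_singleton, Set.insert_eq_of_mem he]
  · rintro ⟨hN, hF⟩
    obtain ⟨e, he, heN, hT, hg⟩ := (isTreeOn_false_iff h.isSP).1 hF
    have hNE : N.edgeSet ⊆ D.edges := (SimpleGraph.edgeSet_mono hN).trans h.edges_eq.symm.subset
    obtain ⟨T, hTG, hTe⟩ := h.exists_graph (Set.insert_subset he hNE)
    refine ⟨T, h.mem_spanningTreeSet_iff.2 ⟨hTG, hTe ▸ hT⟩, e, hTe ▸ Set.mem_insert _ _, ?_,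
      (hcut hN).2 hg⟩
    rw [← SimpleGraph.edgeSet_inj, SimpleGraph.edgeSet_deleteEdges, hTe,
      Set.insert_sdiff_self_of_notMem heN]

theorem edgeSet_map_equiv (T : SimpleGraph V) (σ : V ≃ V) :
    (T.map σ.toEmbedding).edgeSet = Sym2.map σ '' T.edgeSet := by
  ext e
  induction e using Sym2.ind with
  | _ a b =>
    simp only [SimpleGraph.mem_edgeSet, SimpleGraph.map_adj, Set.mem_image]
    constructor
    · rintro ⟨x, y, hxy, rfl, rfl⟩
      exact ⟨s(x, y), hxy, rfl⟩
    · rintro ⟨e, he, heq⟩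
      induction e using Sym2.ind with
      | _ x y =>
        rcases Sym2.eq_iff.1 heq with ⟨h1, h2⟩ | ⟨h1, h2⟩
        · exact ⟨x, y, he, h1, h2⟩
        · exact ⟨y, x, SimpleGraph.Adj.symm he, h2, h1⟩

/-- Subgraphs are equivalent under the automorphisms that fix the terminals if and only if their
sets of edges have the same type. -/
theorem IsDecompositionOf.orEquiv_iff (h : D.IsDecompositionOf G s t) {T₁ T₂ : SimpleGraph V}
    (hT₁ : T₁ ≤ G) (hT₂ : T₂ ≤ G) :
    OrEquiv G s t T₁ T₂ ↔ ty D T₁.edgeSet = ty D T₂.edgeSet := by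
  have hsub : ∀ {T : SimpleGraph V}, T ≤ G → T.edgeSet ⊆ D.edges := fun hT =>
    (SimpleGraph.edgeSet_mono hT).trans h.edges_eq.symm.subset
  constructor
  · rintro ⟨σ, ⟨hs, ht⟩, rfl⟩
    -- the automorphism permutes the edges, so it maps `D` to another tree of the same graph
    have himage : Sym2.map σ '' D.edges = D.edges := by
      rw [h.edges_eq]
      have h1 : (G.map σ.toEquiv.toEmbedding).edgeSet = G.edgeSet := by
        rw [SimpleGraph.edgeSet_inj]
        ext a b
        simp only [SimpleGraph.map_adj]
        constructor
        · rintro ⟨x, y, hxy, rfl, rfl⟩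
          exact σ.map_rel_iff.2 hxy
        · intro hab
          exact ⟨σ.symm a, σ.symm b, σ.symm.map_rel_iff.2 hab, σ.apply_symm_apply a,
            σ.apply_symm_apply b⟩
      rw [edgeSet_map_equiv] at h1
      exact h1
    have hσ : (D.map σ).IsSP s t := by
      have := h.isSP.map (φ := σ) σ.injective
      have hs' : σ s = s := hs
      have ht' : σ t = t := ht
      rwa [hs', ht'] at this
    have h2 : IsoVia id (D.map σ) D := isoVia_id_of_edges_eq hσ h.isSP (h.alternating.map σ)
      h.alternating (by rw [edges_map, himage])
    have h3 : IsoVia σ D D := (isoVia_map σ D).trans h2 fun _ _ _ _ _ _ h h' =>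
      ⟨h.1.trans h'.1, h.2.trans h'.2⟩
    rw [edgeSet_map_equiv]
    exact h3.ty_image h.isSP h.isSP (hsub hT₂)
  · intro hty
    obtain ⟨φ, hφ⟩ := (ty_eq_ty.1 hty.symm).exists_isoVia h.isSP h.isSP
    have hiso : IsoVia φ D D := Match.imp hφ fun _ _ _ _ _ _ h => h.2
    have hinj : Function.Injective φ := by
      have := hiso.injOn h.isSP h.isSP
      rwa [h.verts_eq, Set.injOn_univ] at this
    have hsurj : Function.Surjective φ := by
      have := hiso.image_verts
      rwa [h.verts_eq, Set.image_univ, Set.range_eq_univ] at this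
    have himg : ∀ e, e.map φ ∈ D.edges ↔ e ∈ D.edges := by
      refine fun e => ⟨fun he => ?_, hiso.map_mem_edges⟩
      obtain ⟨e', he', heq⟩ := hiso.exists_of_mem_edges he
      exact Sym2.map.injective hinj heq ▸ he'
    have hadj : ∀ a b, G.Adj (φ a) (φ b) ↔ G.Adj a b := by
      intro a b
      have := himg s(a, b)
      rw [h.edges_eq] at this
      exact this
    let σ : G ≃g G := ⟨Equiv.ofBijective φ ⟨hinj, hsurj⟩, hadj _ _⟩
    have hst := hiso.terminals h.isSP h.isSP
    refine ⟨σ, ⟨hst.1, hst.2⟩, ?_⟩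
    rw [← SimpleGraph.edgeSet_inj, edgeSet_map_equiv]
    have hmark : ∀ e ∈ D.edges, e ∈ T₂.edgeSet ↔ e.map φ ∈ T₁.edgeSet := by
      have key : ∀ {D D' : SPTree V}, Match (fun u v u' v' => (s(u, v) ∈ T₂.edgeSet ↔
          s(u', v') ∈ T₁.edgeSet) ∧ φ u = u' ∧ φ v = v') D D' → ∀ e ∈ D.edges,
          (e ∈ T₂.edgeSet ↔ e.map φ ∈ T₁.edgeSet) := by
        intro D D' hm
        induction D generalizing D' with
        | edge u v =>
          cases D' <;> try exact hm.elim
          obtain ⟨h1, rfl, rfl⟩ := hm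
          rintro _ rfl
          exact h1
        | series k c ih =>
          cases D' <;> try exact hm.elim
          obtain ⟨e', -, hm⟩ := hm
          intro e he
          obtain ⟨i, hi⟩ := mem_edges_node.1.1 he
          exact ih i (hm i) e hi
        | parallel k c ih =>
          cases D' <;> try exact hm.elim
          obtain ⟨e', hm⟩ := hm
          intro e he
          obtain ⟨i, hi⟩ := mem_edges_node.2.1 he
          exact ih i (hm i) e hi
      exact key hφ
    ext e
    constructor
    · intro he
      obtain ⟨e', he', rfl⟩ := hiso.exists_of_mem_edges (hsub hT₁ he)
      exact ⟨e', (hmark e' he').2 he, rfl⟩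
    · rintro ⟨e', he', rfl⟩
      exact (hmark e' (hsub hT₂ he')).1 he'

/-! ### Representatives of the orbits -/

theorem IsDecompositionOf.edgeSet_graph (h : D.IsDecompositionOf G s t) {F : Forest V}
    (hF : ∀ e ∈ F, e ∈ D.edges) : F.graph ≤ G ∧ F.graph.edgeSet = toSet F := by
  have h1 : F.graph.edgeSet = toSet F := by
    rw [Forest.graph, SimpleGraph.edgeSet_fromEdgeSet]
    ext e
    exact ⟨fun he => he.1, fun he => ⟨he, h.isSP.not_isDiag (hF e he)⟩⟩
  refine ⟨?_, h1⟩
  rw [← SimpleGraph.edgeSet_subset_edgeSet, h1, ← h.edges_eq]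
  exact hF

/-- A list with one member of each type contains one member of each orbit. -/
theorem IsDecompositionOf.isRepresentatives (h : D.IsDecompositionOf G s t) {b : Bool}
    {L : List (Forest V)} (hL : Lists D b L) {S : Set (SimpleGraph V)}
    (hS : ∀ T, T ∈ S ↔ T ≤ G ∧ D.IsTreeOn b T.edgeSet) : IsRepresentatives G s t S L := by
  have hg := fun F hF => h.edgeSet_graph (hL.sub F hF)
  refine ⟨fun F hF => (hS _).2 ⟨(hg F hF).1, ?_⟩, fun T hT => ?_⟩
  · rw [(hg F hF).2]
    exact hL.mem F hF
  · obtain ⟨hTG, hT⟩ := (hS T).1 hT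
    have hiff : ∀ i : Fin L.length, OrEquiv G s t (L.get i).graph T ↔
        ty D (toSet (L.get i)) = ty D T.edgeSet := fun i => by
      rw [h.orEquiv_iff (hg _ (L.get_mem i)).1 hTG, (hg _ (L.get_mem i)).2]
    simp only [hiff]
    obtain ⟨F, hF, hty⟩ := hL.complete _ hT
    obtain ⟨i, rfl⟩ := List.mem_iff_get.1 hF
    refine ⟨i, hty, fun j hj => ?_⟩
    have hnd := List.nodup_iff_injective_get.1 hL.nodup
    have h1 := @hnd (Fin.cast (by simp) j) (Fin.cast (by simp) i) (by
      simpa using hj.trans hty.symm)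
    simpa [Fin.ext_iff] using h1

theorem IsDecompositionOf.ncard_orbitsOr (h : D.IsDecompositionOf G s t) {b : Bool}
    {L : List (Forest V)} (hL : Lists D b L) {S : Set (SimpleGraph V)}
    (hS : ∀ T, T ∈ S ↔ T ≤ G ∧ D.IsTreeOn b T.edgeSet) :
    (orbitsOr G s t S).ncard = L.length := by
  classical
  have hg := fun F hF => h.edgeSet_graph (hL.sub F hF)
  have horb : ∀ {T T' : SimpleGraph V}, T ≤ G → T' ≤ G →
      ({T₁ | OrEquiv G s t T₁ T} = {T₁ | OrEquiv G s t T₁ T'} ↔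
        ty D T.edgeSet = ty D T'.edgeSet) := by
    intro T T' hT hT'
    constructor
    · intro heq
      have h1 : T ∈ {T₁ | OrEquiv G s t T₁ T} := (h.orEquiv_iff hT hT).2 rfl
      rw [heq] at h1
      exact (h.orEquiv_iff hT hT').1 h1
    · intro hty
      have hle : ∀ {T₁ T : SimpleGraph V}, T ≤ G → OrEquiv G s t T₁ T → T₁ ≤ G := by
        rintro _ T hT ⟨σ, -, rfl⟩ a b hab
        obtain ⟨-, x, y, hxy, rfl, rfl⟩ := hab
        exact σ.map_rel_iff.2 (hT hxy)
      ext T₁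
      constructor
      · intro h1
        exact (h.orEquiv_iff (hle hT h1) hT').2 (((h.orEquiv_iff (hle hT h1) hT).1 h1).trans hty)
      · intro h1
        exact (h.orEquiv_iff (hle hT' h1) hT).2
          (((h.orEquiv_iff (hle hT' h1) hT').1 h1).trans hty.symm)
  have h1 : orbitsOr G s t S =
      ((L.map fun F => {T₁ | OrEquiv G s t T₁ F.graph}).toFinset : Set (Set (SimpleGraph V))) := by
    ext O
    simp only [orbitsOr, Set.mem_image, List.coe_toFinset, List.mem_map, Set.mem_ofPred_eq]
    constructor
    · rintro ⟨T, hT, rfl⟩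
      obtain ⟨hTG, hT⟩ := (hS T).1 hT
      obtain ⟨F, hF, hty⟩ := hL.complete _ hT
      refine ⟨F, hF, (horb (hg F hF).1 hTG).2 ?_⟩
      rw [(hg F hF).2, hty]
    · rintro ⟨F, hF, rfl⟩
      refine ⟨F.graph, (hS _).2 ⟨(hg F hF).1, ?_⟩, rfl⟩
      rw [(hg F hF).2]
      exact hL.mem F hF
  rw [h1, Set.ncard_coe_finset, List.toFinset_card_of_nodup, List.length_map]
  refine List.nodup_map_of_imp hL.nodup fun F hF F' hF' heq => ?_
  have := (horb (hg F hF).1 (hg F' hF').1).1 heq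
  rwa [(hg F hF).2, (hg F' hF').2] at this

theorem IsDecompositionOf.card_eq [Fintype V] (h : D.IsDecompositionOf G s t) :
    Fintype.card V = D.inner + 2 := by
  rw [← h.isSP.ncard_verts, h.verts_eq, Set.ncard_univ, Nat.card_eq_fintype_card]

end SPTree

theorem mainTheorem1 :
    ∃ c C : ℝ, 0 < c ∧ 0 < C ∧
      ∀ (V : Type*) [Fintype V] [DecidableEq V] (G : SimpleGraph V) (s t : V) (D : SPTree V),
        D.IsDecompositionOf G s t →
          (IsRepresentatives G s t (spanningTreeSet G) D.bothTrees.val.1 ∧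
            IsRepresentatives G s t (nearTreeSet G s t) D.bothTrees.val.2 ∧
            c * (Fintype.card V * ((orbitsOr G s t (spanningTreeSet G)).ncard +
                (orbitsOr G s t (nearTreeSet G s t)).ncard)) ≤ D.bothTrees.steps ∧
            D.bothTrees.steps ≤ C * (Fintype.card V *
              ((orbitsOr G s t (spanningTreeSet G)).ncard +
                (orbitsOr G s t (nearTreeSet G s t)).ncard))) ∧
          (IsRepresentatives G s t (spanningTreeSet G) D.spanningTrees.val ∧
            c * (Fintype.card V * (orbitsOr G s t (spanningTreeSet G)).ncard) ≤
              D.spanningTrees.steps ∧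
            D.spanningTrees.steps ≤
              C * (Fintype.card V * (orbitsOr G s t (spanningTreeSet G)).ncard)) := by
  -- `4400 = 2 * 2200`, from `IsSP.spanningTrees_steps_le` and the bound for the number of edges
  refine ⟨1 / 4, 4400, by norm_num, by norm_num, ?_⟩
  intro V _ _ G s t D h
  obtain ⟨hs, hn⟩ := h.isSP.lists_bothTrees
  have hst := h.isSP.lists_spanningTrees
  have hS := fun T => h.mem_spanningTreeSet_iff (T := T)
  have hN := fun T => h.mem_nearTreeSet_iff (N := T)
  have hb := h.isSP.bounds_bothTrees h.alternating
  obtain ⟨hlow, hlow'⟩ := h.isSP.le_steps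
  have hup' := (h.isSP.spanningTrees_steps_le h.alternating).1
  -- the number of edges is linear in the number of vertices
  have hm : D.esize ≤ 2 * (D.inner + 2) :=
    ((h.isSP.esize_le h.alternating).1).trans (by omega)
  have hup : D.bothTrees.steps ≤
      300 * D.esize * (3 * (D.bothTrees.val.1.length + D.bothTrees.val.2.length)) := by
    by_cases hser : D.IsSeries
    · exact (hb.cost_series hser).trans (Nat.mul_le_mul_left _ (by omega))
    · exact (hb.cost hser).trans (Nat.mul_le_mul_left _ (by omega))
  rw [h.ncard_orbitsOr hs hS, h.ncard_orbitsOr hn hN, h.card_eq]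
  rw [SPTree.spanningTrees_val] at hlow' hup'
  refine ⟨⟨h.isRepresentatives hs hS, h.isRepresentatives hn hN, ?_, ?_⟩,
    h.isRepresentatives hst hS, ?_, ?_⟩
  · have h1 : (D.inner + 2) * (D.bothTrees.val.1.length + D.bothTrees.val.2.length) ≤
        4 * D.bothTrees.steps := by
      nlinarith
    have h2 : (((D.inner + 2) * (D.bothTrees.val.1.length + D.bothTrees.val.2.length) : ℕ) : ℝ) ≤
        ((4 * D.bothTrees.steps : ℕ) : ℝ) := Nat.cast_le.2 h1
    push_cast at h2 ⊢
    linarith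
  · have h1 : D.bothTrees.steps ≤ 4400 * ((D.inner + 2) *
        (D.bothTrees.val.1.length + D.bothTrees.val.2.length)) := by
      have := Nat.mul_le_mul_right
        (D.bothTrees.val.1.length + D.bothTrees.val.2.length) hm
      nlinarith
    exact_mod_cast h1
  · have h1 : (D.inner + 2) * D.bothTrees.val.1.length ≤ 4 * D.spanningTrees.steps := by
      nlinarith
    have h2 : (((D.inner + 2) * D.bothTrees.val.1.length : ℕ) : ℝ) ≤
        ((4 * D.spanningTrees.steps : ℕ) : ℝ) := Nat.cast_le.2 h1
    push_cast at h2 ⊢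
    linarith
  · have h1 : D.spanningTrees.steps ≤ 4400 * ((D.inner + 2) * D.bothTrees.val.1.length) := by
      have := Nat.mul_le_mul_right D.bothTrees.val.1.length hm
      nlinarith
    exact_mod_cast h1
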